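/- Let $(M,J,g)$ be an almost Hermitian manifold of real dimension $2n$: $M$ is a smooth manifold, $J$ a smooth almost complex structure, and $g$ a smooth Riemannian metric with $g(JX,JY)=g(X,Y)$. Let $\omega(X,Y)=g(JX,Y)$ be the fundamental form, let $\mathcal A^k$ be the space of smooth complex-valued $k$-forms, and let $\star$ be the complex-linear Hodge star of $g$ and of the volume form $\omega^n/n!$. Put $$L\eta=\omega\wedge\eta,\qquad \Lambda=\star^{-1}L\,\star,\qquad d^*=-\star d\,\star,$$ let $\mathbb I$ be the extension of $J$ to forms, $(\mathbb I\eta)(X_1,\dots,X_k)=\eta(JX_1,\dots,JX_k)$ (so that $\mathbb I=i^{\,p-q}$ on forms of type $(p,q)$), and let $[A,B]=AB-(-1)^{|A||B|}BA$ be the graded commutator. Let $P^k=\mathcal A^k\cap\ker\Lambda$ be the space of primitive $k$-forms, with $P^m=0$ for $m<0$. Let $k\ge 0$ and $\alpha\in P^k$. Then there are forms $\alpha_r\in P^{k+1-2r}$ $(r\ge 0)$ with $$d\alpha=\alpha_0+L\alpha_1+L^2\alpha_2+\cdots ,$$ which are unique if $k\le n$ (for $k>n$ one has $\alpha=0$),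 such that for all integers $j\ge 0$ $$\begin{aligned} [\Lambda,d]L^j\alpha-\star\,\mathbb I^{-1}d\,\mathbb I\,\star L^j\alpha ={}&\frac1{j+1}\,\mathbb I^{-1}[d^*,\Lambda]\,\mathbb I\,L^{j+1}\alpha\\ &+j\,\Lambda[d,L]L^{j-1}\alpha+j(j-1)(k-n+j-1)\,[d,L]L^{j-2}\alpha\\ &+\sum_{r\ge 2}f_{n,k,j}(r)\,L^{j+r-1}\alpha_r , \end{aligned}$$ where $$f_{n,k,j}(r)=\bigl(r(n-k+r)-j\bigr)+(-1)^r\,\frac{j!\,(n-k-j+r)!}{(j+r-1)!\,(n-k-j)!}.$$ Here the terms with the factors $j$ and $j(j-1)$ are read as $0$ when those factors vanish, and the last summand of $f_{n,k,j}(r)$ is read as $0$ when $j>n-k$ (that is, $1/m!=0$ for $m<0$). -/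

import Mathlib

open scoped Manifold ContDiff Bundle Nat

noncomputable section

namespace AlmostHermitian

/-! ### Linear algebra of complex-valued alternating forms on a real vector space -/

section Pointwise

variable {V : Type*} [AddCommGroup V] [Module ℝ V] [TopologicalSpace V]

/-- Complex-valued exterior forms on `V` of all degrees: the component in degree `k` is an
alternating real-multilinear map `V ^ k → ℂ`. -/
abbrev ExtForm (V : Type*) [AddCommGroup V] [Module ℝ V] [TopologicalSpace V] : Type _ :=
  ∀ k : ℕ, V [⋀^Fin k]→L[ℝ] ℂ

/-- The tensor product `(v₁, …, v_m) ↦ a (v₁, …, v_p) * b (v_{p+1}, …, v_{p+q})`, `m = p + q`. -/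
def tensor {p q m : ℕ} (h : p + q = m) (a : V [⋀^Fin p]→L[ℝ] ℂ) (b : V [⋀^Fin q]→L[ℝ] ℂ) :
    ContinuousMultilinearMap ℝ (fun _ : Fin m => V) ℂ where
  toMultilinearMap :=
    ((LinearMap.mul' ℝ ℂ).compMultilinearMap
      (MultilinearMap.domCoprod a.toMultilinearMap b.toMultilinearMap)).domDomCongr
        (finSumFinEquiv.trans (finCongr h))
  cont := by
    have h1 : Continuous fun v : Fin m → V => a (fun i => v (Fin.cast h (Fin.castAdd q i))) :=
      a.cont.comp (by fun_prop)
    have h2 : Continuous fun v : Fin m → V => b (fun i => v (Fin.cast h (Fin.natAdd p i))) :=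
      b.cont.comp (by fun_prop)
    exact h1.mul h2

theorem tensor_apply {p q m : ℕ} (h : p + q = m) (a : V [⋀^Fin p]→L[ℝ] ℂ)
    (b : V [⋀^Fin q]→L[ℝ] ℂ) (v : Fin m → V) :
    tensor h a b v = a (fun i => v (Fin.cast h (Fin.castAdd q i))) *
      b (fun i => v (Fin.cast h (Fin.natAdd p i))) := rfl

/-- The wedge product of a `p`-form and a `q`-form,
`(a ∧ b)(v) = 1 / (p! q!) * ∑ σ, sgn σ * a (v_{σ 1}, …, v_{σ p}) * b (v_{σ (p+1)}, …)`. -/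
def wedge {p q m : ℕ} (h : p + q = m) (a : V [⋀^Fin p]→L[ℝ] ℂ) (b : V [⋀^Fin q]→L[ℝ] ℂ) :
    V [⋀^Fin m]→L[ℝ] ℂ :=
  ((p ! : ℂ) * (q ! : ℂ))⁻¹ • ContinuousMultilinearMap.alternatization (tensor h a b)

/-- The Lefschetz operator `a ↦ w ∧ a` of a 2-form `w`. -/
def ptL (w : V [⋀^Fin 2]→L[ℝ] ℂ) (a : ExtForm V) : ExtForm V
  | 0 => 0
  | 1 => 0
  | k + 2 => wedge (Nat.add_comm 2 k) w (a k)

/-- The constant `1`, as a form of degree `0`. -/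
def ptOne : ExtForm V
  | 0 => ContinuousAlternatingMap.constOfIsEmpty ℝ V (Fin 0) (1 : ℂ)
  | _ + 1 => 0

/-- The form `(1 / n!) * w ^ n` of degree `2 n`. -/
def ptVol (n : ℕ) (w : V [⋀^Fin 2]→L[ℝ] ℂ) : ExtForm V :=
  ((n ! : ℂ))⁻¹ • (ptL w)^[n] ptOne

/-- Interior product: `(contract u a)(v₁, …, v_k) = a (u, v₁, …, v_k)`. -/
def contract (u : V) (a : ExtForm V) : ExtForm V := fun k =>
  { (a (k + 1)).toAlternatingMap.curryLeft u with
    cont := by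
      have : Continuous fun v : Fin k → V => a (k + 1) (Fin.cons u v) :=
        (a (k + 1)).cont.comp (continuous_const.finCons continuous_id)
      exact this }

theorem contract_apply (u : V) (a : ExtForm V) (k : ℕ) (v : Fin k → V) :
    contract u a k v = a (k + 1) (Fin.cons u v) := rfl

/-- Iterated interior product:
`(contractAll [u₁, …, u_l] a)(v₁, …, v_k) = a (u₁, …, u_l, v₁, …, v_k)`. -/
def contractAll (us : List V) (a : ExtForm V) : ExtForm V :=
  us.foldl (fun c u => contract u c) a

/-- The Hodge star of the symmetric bilinear form `g` and the volume form `vol`, in a basis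
`b₁, …, b_N` of `V`: with `(g^{ij})` the inverse of the matrix `(g (b_i, b_j))`, on `k`-forms
`⋆ a = 1 / k! * ∑_{i₁ … i_k, j₁ … j_k} g^{i₁ j₁} ⋯ g^{i_k j_k} a (b_{i₁}, …, b_{i_k})
  vol (b_{j₁}, …, b_{j_k}, ⬝)`.
This does not depend on the basis, and it is the complex-linear operator with
`c ∧ ⋆ (conj a) = ⟨c, a⟩ vol`, where `⟨ , ⟩` is the Hermitian inner product on forms induced by `g`
and `vol` is a unit volume form. -/
def ptStar {N : ℕ} (b : Module.Basis (Fin N) ℝ V) (g : V →L[ℝ] V →L[ℝ] ℝ) (vol : ExtForm V)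
    (a : ExtForm V) : ExtForm V :=
  ∑ k ∈ Finset.range (N + 1), ((k ! : ℂ))⁻¹ • ∑ i : Fin k → Fin N, ∑ j : Fin k → Fin N,
    (((∏ l, (Matrix.of fun s t => g (b s) (b t))⁻¹ (i l) (j l) : ℝ) : ℂ) * a k (fun l => b (i l))) •
      contractAll (List.ofFn fun l => b (j l)) vol

/-- The extension of `J : V → V` to forms, `(v₁, …, v_k) ↦ a (J v₁, …, J v_k)`. -/
def ptI (J : V →L[ℝ] V) (a : ExtForm V) : ExtForm V := fun k =>
  (a k).compContinuousLinearMap J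

end Pointwise

/-! ### Almost Hermitian manifolds -/

section Manifold

/-- The model space of real dimension `2 n`. -/
abbrev Model (n : ℕ) : Type := EuclideanSpace ℝ (Fin (2 * n))

/-- The tangent space at `x` of a manifold of real dimension `2 n`. -/
abbrev Tan (n : ℕ) {M : Type*} [TopologicalSpace M] [ChartedSpace (Model n) M] (x : M) : Type :=
  TangentSpace 𝓘(ℝ, Model n) x

/-- An almost Hermitian structure on a smooth manifold of real dimension `2 n`: a smooth almost
complex structure `J` and a smooth Riemannian metric `g` for which `J` is orthogonal. -/
structure AlmostHermitianStructure (n : ℕ) (M : Type*) [TopologicalSpace M]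
    [ChartedSpace (Model n) M] [IsManifold 𝓘(ℝ, Model n) ∞ M] where
  J : ∀ x : M, Tan n x →L[ℝ] Tan n x
  contMDiff_J : ContMDiff 𝓘(ℝ, Model n) (𝓘(ℝ, Model n).prod 𝓘(ℝ, Model n →L[ℝ] Model n)) ∞
    (fun x : M => Bundle.TotalSpace.mk' (Model n →L[ℝ] Model n)
      (E := fun x : M => Tan n x →L[ℝ] Tan n x) x (J x))
  J_J : ∀ (x : M) (v : Tan n x), J x (J x v) = -v
  g : Bundle.ContMDiffRiemannianMetric 𝓘(ℝ, Model n) ∞ (Model n) (fun x : M => Tan n x)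
  g_J_J : ∀ (x : M) (v w : Tan n x), g.inner x (J x v) (J x w) = g.inner x v w

variable {n : ℕ} {M : Type*} [TopologicalSpace M] [ChartedSpace (Model n) M]

variable (n M) in
/-- Complex-valued differential forms of all degrees on `M` (not necessarily smooth). -/
abbrev Form : Type _ := ∀ x : M, ExtForm (Tan n x)

/-- The degree-`k` component of `a` in the preferred chart `φ` at `x₀`: the pull-back of `a k` by
`φ⁻¹`. -/
def chartRep (a : Form n M) (k : ℕ) (x₀ : M) : Model n → Model n [⋀^Fin k]→L[ℝ] ℂ := fun y =>
  (a ((extChartAt 𝓘(ℝ, Model n) x₀).symm y) k).compContinuousLinearMap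
    (mfderiv 𝓘(ℝ, Model n) 𝓘(ℝ, Model n) (extChartAt 𝓘(ℝ, Model n) x₀).symm y)

/-- Smoothness of a form: all its components are smooth in charts. -/
def IsSmooth (a : Form n M) : Prop :=
  ∀ (k : ℕ) (x₀ : M), ContDiffOn ℝ ∞ (chartRep a k x₀) (extChartAt 𝓘(ℝ, Model n) x₀).target

/-- `a` has degree `k`. -/
def HasDegree (k : ℕ) (a : Form n M) : Prop := ∀ (x : M) (m : ℕ), m ≠ k → a x m = 0

/-- The exterior derivative: at `x` it is computed in the preferred chart at `x`. -/
def d (a : Form n M) : Form n M := fun x k =>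
  match k with
  | 0 => 0
  | k + 1 => (extDeriv (chartRep a k x) (extChartAt 𝓘(ℝ, Model n) x x)).compContinuousLinearMap
      (mfderiv 𝓘(ℝ, Model n) 𝓘(ℝ, Model n) (extChartAt 𝓘(ℝ, Model n) x) x)

/-- The commutator `A B - B A`. In every use below one of `A`, `B` has even degree, so that this is
the graded commutator. -/
def comm (A B : Form n M → Form n M) (a : Form n M) : Form n M := A (B a) - B (A a)

/-- The basis of the tangent space at `x` given by the preferred chart. -/
def tanBasis (x : M) : Module.Basis (Fin (2 * n)) ℝ (Tan n x) :=
  (EuclideanSpace.basisFun (Fin (2 * n)) ℝ).toBasis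

namespace AlmostHermitianStructure

variable [IsManifold 𝓘(ℝ, Model n) ∞ M] (S : AlmostHermitianStructure n M)

/-- The fundamental 2-form `ω (u, v) = g (J u, v)`. -/
def omega (x : M) : Tan n x [⋀^Fin 2]→L[ℝ] ℂ where
  toFun v := ((S.g.inner x (S.J x (v 0)) (v 1) : ℝ) : ℂ)
  map_update_add' := by
    intro inst v i u w
    rw [Subsingleton.elim inst (instDecidableEqFin 2)]
    fin_cases i <;> simp
  map_update_smul' := by
    intro inst v i c u
    rw [Subsingleton.elim inst (instDecidableEqFin 2)]
    fin_cases i <;> simp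
  cont := by
    have h : ∀ (G : Model n →L[ℝ] Model n →L[ℝ] ℝ) (A : Model n →L[ℝ] Model n),
        Continuous fun v : Fin 2 → Model n => ((G (A (v 0)) (v 1) : ℝ) : ℂ) := by
      intro G A
      fun_prop
    exact h (S.g.inner x) (S.J x)
  map_eq_zero_of_eq' := by
    have key : ∀ u : Tan n x, S.g.inner x (S.J x u) u = 0 := by
      intro u
      have h1 := S.g_J_J x (S.J x u) u
      rw [S.J_J, map_neg, neg_apply, S.g.symm x u] at h1
      linarith
    intro v i j hv hij
    have h01 : v 0 = v 1 := by
      fin_cases i <;> fin_cases j <;> simp_all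
    simp [h01, key]

/-- The Lefschetz operator `L a = ω ∧ a`. -/
def L (a : Form n M) : Form n M := fun x => ptL (S.omega x) (a x)

/-- The volume form `ω ^ n / n!`. -/
def vol : Form n M := fun x => ptVol n (S.omega x)

/-- The Hodge star of `g` and `vol`, extended complex-linearly. -/
def star (a : Form n M) : Form n M := fun x => ptStar (tanBasis x) (S.g.inner x) (S.vol x) (a x)

/-- The inverse of the Hodge star, which is `(-1) ^ k ⋆` on `k`-forms. -/
def starInv (a : Form n M) : Form n M := S.star fun x k => (-1 : ℂ) ^ k • a x k

/-- The operator `Λ = ⋆⁻¹ L ⋆`. -/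
def Lam (a : Form n M) : Form n M := S.starInv (S.L (S.star a))

/-- The operator `d* = - ⋆ d ⋆`. -/
def dStar (a : Form n M) : Form n M := -S.star (d (S.star a))

/-- The extension `𝕀` of `J` to forms; it is `i ^ (p - q)` on forms of type `(p, q)`. -/
def I (a : Form n M) : Form n M := fun x => ptI (S.J x) (a x)

/-- The inverse of `𝕀`, which is the extension of `J⁻¹ = -J`. -/
def IInv (a : Form n M) : Form n M := fun x => ptI (-S.J x) (a x)

/-- `a` is a smooth primitive form of degree `k`. -/
def IsPrimitive (k : ℕ) (a : Form n M) : Prop :=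
  IsSmooth a ∧ HasDegree k a ∧ S.Lam a = 0

/-- `c₀, c₁, c₂, …` are the primitive components of the `m`-form `b`: `b = ∑ r, L ^ r c_r` with
`c_r` smooth and primitive of degree `m - 2 r` (and `c_r = 0` if `m < 2 r`). -/
def IsLefschetzDecomposition (m : ℕ) (b : Form n M) (c : ℕ → Form n M) : Prop :=
  (∀ r, 2 * r ≤ m → S.IsPrimitive (m - 2 * r) (c r)) ∧ (∀ r, m < 2 * r → c r = 0) ∧
    b = ∑ r ∈ Finset.range (m / 2 + 1), S.L^[r] (c r)

end AlmostHermitianStructure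

/-- The coefficient
`f_{n,k,j}(r) = (r (n - k + r) - j) + (-1) ^ r * j! (n-k-j+r)! / ((j+r-1)! (n-k-j)!)`, for `r ≥ 1`,
where `1 / m! = 0` for `m < 0`, so that the last term is absent for `j > n - k`. -/
def coeff (n k j r : ℕ) : ℂ :=
  ((r : ℂ) * ((n : ℂ) - k + r) - j) +
    if k + j ≤ n then
      (-1 : ℂ) ^ r * (((j ! : ℂ) * ((n - k - j + r) ! : ℂ)) /
        (((j + r - 1) ! : ℂ) * ((n - k - j) ! : ℂ)))
    else 0

end Manifold

end AlmostHermitian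

end

/-! Write T = [d, L]. By the Leibniz rule T is exterior product with dω, so it acts pointwise and
commutes with L; hence d L^j α = L^j dα + j T L^(j-1) α. On powers of L applied to a primitive α the
other operators only change the exponent: Λ L^j α = j(n-k-j+1) L^(j-1) α by the sl₂ relations, and 𝕀
⋆ L^j α = c_j L^(n-k-j) α by Weil's formula, with c_j = ± j!/(n-k-j)!, read as 0 for j > n-k. After
substitution the left side splits into terms in T and terms in D = dα.

The terms in T are j Λ T L^(j-1) α, then -j(j-1)(n-k-j+1) T L^(j-2) α, then -c_j (n-k-j) ⋆ 𝕀⁻¹ T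
L^(n-k-j-1) α. The first two stand on the right side as they are. The third is the term with d*:
since ⋆ exchanges L and Λ, one has [d*, Λ] = -⋆ T ⋆, and c_(j+1) = (j+1)(n-k-j) c_j.

The terms in D are Λ L^j D - j(n-k-j+1) L^(j-1) D - c_j ⋆ 𝕀⁻¹ L^(n-k-j) D. Inserting D = ∑ L^r α_r
and using the same two formulas for α_r, primitive of degree k+1-2r, turns the r-th contribution
into f(r) L^(j+r-1) α_r. It vanishes for r = 0 and r = 1.

Weil's formula comes from comparing ⋆ with exp(L) w 𝕀 exp(Λ), where w = (-1)^(k(k+1)/2) in degree k.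
Both operators X satisfy X(u ∧ a) = ι_u X((-1)^(deg a) a), and their values at 1 agree in top
degree.

The main lemmas are `Lam_L_pow`, `star_L_pow_of_prim`, `d_L_apply`, `comm_dStar_Lam_apply` and
`sum_components`; they meet in `comm_Lam_d_sub_star_apply`. The Lefschetz decomposition is pure sl₂
algebra. It is proved for an abstract `LefschetzModule`, which is used both for the exterior algebra
of one tangent space and for all smooth forms; the second use gives smooth components at once. -/

noncomputable section

namespace AlmostHermitian

/-! ### Lefschetz theory of a graded module with raising and lowering operators -/

/-- A graded complex vector space with operators `L` and `Λ` of degrees `2` and `-2` that satisfy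
`[Λ, L] = n - k` in degree `k`. -/
structure LefschetzModule (n : ℕ) (E : Type*) [AddCommGroup E] [Module ℂ E] where
  deg : ℕ → Submodule ℂ E
  L : Module.End ℂ E
  Lam : Module.End ℂ E
  L_mem : ∀ k, ∀ a ∈ deg k, L a ∈ deg (k + 2)
  Lam_mem : ∀ k, ∀ a ∈ deg (k + 2), Lam a ∈ deg k
  Lam_zero : ∀ k < 2, ∀ a ∈ deg k, Lam a = 0
  deg_eq_zero : ∀ k, 2 * n < k → ∀ a ∈ deg k, a = 0
  comm : ∀ k, ∀ a ∈ deg k, Lam (L a) = L (Lam a) + ((n : ℂ) - k) • a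

namespace LefschetzModule

variable {n : ℕ} {E : Type*} [AddCommGroup E] [Module ℂ E] (S : LefschetzModule n E)

/-- Primitive elements of degree `k`. -/
def prim (k : ℕ) : Submodule ℂ E := S.deg k ⊓ LinearMap.ker S.Lam

theorem mem_prim {k : ℕ} {a : E} : a ∈ S.prim k ↔ a ∈ S.deg k ∧ S.Lam a = 0 := by
  simp [prim]

theorem L_pow_mem {k : ℕ} {a : E} (ha : a ∈ S.deg k) (s : ℕ) :
    (S.L ^ s) a ∈ S.deg (k + 2 * s) := by
  induction s with
  | zero => simpa using ha
  | succ s ih =>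
    rw [pow_succ', Module.End.mul_apply]
    exact S.L_mem _ _ ih

theorem Lam_pow_mem {k : ℕ} (s : ℕ) {a : E} (ha : a ∈ S.deg (k + 2 * s)) :
    (S.Lam ^ s) a ∈ S.deg k := by
  induction s generalizing a with
  | zero => simpa using ha
  | succ s ih =>
    rw [pow_succ, Module.End.mul_apply]
    exact ih (S.Lam_mem _ _ ha)

/-- Moving Λ past one L at a time collects the weights n-k, n-k-2, …, n-k-2s, whose sum is the
coefficient. -/
theorem Lam_L_pow {k : ℕ} {a : E} (ha : a ∈ S.prim k) (s : ℕ) :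
    S.Lam ((S.L ^ (s + 1)) a) = (((s : ℂ) + 1) * ((n : ℂ) - k - s)) • (S.L ^ s) a := by
  have h := S.mem_prim.1 ha
  induction s with
  | zero => simpa [h.2] using S.comm k a h.1
  | succ s ih =>
    rw [pow_succ', Module.End.mul_apply, S.comm _ _ (S.L_pow_mem h.1 (s + 1)), ih, map_smul,
      ← Module.End.mul_apply S.L, ← pow_succ', ← add_smul]
    congr 1
    push_cast
    ring

theorem Lam_pow_L_pow {k : ℕ} {a : E} (ha : a ∈ S.prim k) (s : ℕ) :
    (S.Lam ^ s) ((S.L ^ s) a) =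
      (∏ i ∈ Finset.range s, (((i : ℂ) + 1) * ((n : ℂ) - k - i))) • a := by
  induction s with
  | zero => simp
  | succ s ih =>
    rw [pow_succ, Module.End.mul_apply, S.Lam_L_pow ha, map_smul, ih, smul_smul,
      Finset.prod_range_succ, mul_comm]

/-- Only the factor with i = n - k could vanish; it is absent in both cases. -/
theorem prod_ne_zero {k s : ℕ} (h : n < k ∨ s + k ≤ n) :
    (∏ i ∈ Finset.range s, (((i : ℂ) + 1) * ((n : ℂ) - k - i))) ≠ 0 := by
  refine Finset.prod_ne_zero_iff.2 fun i hi => mul_ne_zero (by exact_mod_cast i.succ_ne_zero) ?_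
  rw [Finset.mem_range] at hi
  intro h0
  have h1 : (n : ℂ) = (k + i : ℕ) := by push_cast; linear_combination h0
  have h2 : n = k + i := by exact_mod_cast h1
  omega

/-- The power L^(n+1) a vanishes for degree reasons, while Λ^(n+1) L^(n+1) is a nonzero scalar on a.
-/
theorem prim_eq_zero {k : ℕ} (hk : n < k) {a : E} (ha : a ∈ S.prim k) : a = 0 := by
  have h := S.Lam_pow_L_pow ha (n + 1)
  rw [S.deg_eq_zero _ (by omega) _ (S.L_pow_mem (S.mem_prim.1 ha).1 (n + 1)), map_zero] at h
  exact (smul_eq_zero.1 h.symm).resolve_left (prod_ne_zero (Or.inl hk))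

theorem L_pow_eq_zero {k s : ℕ} (hs : n < k + s) {a : E} (ha : a ∈ S.prim k) :
    (S.L ^ s) a = 0 := by
  by_cases hk : n < k
  · rw [S.prim_eq_zero hk ha, map_zero]
  obtain ⟨t, rfl⟩ : ∃ t, s = t + (n - k + 1) := ⟨s - (n - k + 1), by omega⟩
  rw [pow_add, Module.End.mul_apply]
  -- The coefficient of Λ L^(n-k+1) a contains n - k - (n - k) = 0, so this element is primitive;
  -- its degree 2n-k+2 exceeds n.
  have h0 : (S.L ^ (n - k + 1)) a = 0 := by
    refine S.prim_eq_zero (k := k + 2 * (n - k + 1)) (by omega)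
      (S.mem_prim.2 ⟨S.L_pow_mem (S.mem_prim.1 ha).1 _, ?_⟩)
    rw [S.Lam_L_pow ha]
    have : (n : ℂ) - k - (n - k : ℕ) = 0 := by
      rw [Nat.cast_sub (by omega)]; ring
    rw [this, mul_zero, zero_smul]
  rw [h0, map_zero]

theorem Lam_pow_L_pow_eq_zero {k s t : ℕ} (hst : s < t) {a : E} (ha : a ∈ S.prim k) :
    (S.Lam ^ t) ((S.L ^ s) a) = 0 := by
  obtain ⟨u, rfl⟩ : ∃ u, t = (u + 1) + s := ⟨t - s - 1, by omega⟩
  rw [pow_add, Module.End.mul_apply, S.Lam_pow_L_pow ha, map_smul, pow_succ, Module.End.mul_apply,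
    (S.mem_prim.1 ha).2, map_zero, smul_zero]

/-- `c` consists of the primitive components of `b`, an element of degree `m`. -/
def IsDecomposition (m : ℕ) (b : E) (c : ℕ → E) : Prop :=
  (∀ r, 2 * r ≤ m → c r ∈ S.prim (m - 2 * r)) ∧ (∀ r, m < 2 * r → c r = 0) ∧
    b = ∑ r ∈ Finset.range (m / 2 + 1), (S.L ^ r) (c r)

/-- Peeling off the component with the highest power of L: if Λ^(s+1) b = 0 then Λ^s b is primitive,
and subtracting γ⁻¹ L^s Λ^s b from b leaves an element killed by Λ^s. -/
theorem exists_decomposition_aux {m : ℕ} (hm : m ≤ n + 1) (s : ℕ) (hs : s ≤ m / 2 + 1) {b : E}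
    (hb : b ∈ S.deg m) (h : (S.Lam ^ s) b = 0) :
    ∃ c : ℕ → E, (∀ r, r < s → c r ∈ S.prim (m - 2 * r)) ∧ (∀ r, s ≤ r → c r = 0) ∧
      b = ∑ r ∈ Finset.range s, (S.L ^ r) (c r) := by
  induction s generalizing b with
  | zero => exact ⟨0, by simp, by simp, by simpa using h⟩
  | succ s ih =>
    have hc : (S.Lam ^ s) b ∈ S.prim (m - 2 * s) := by
      refine S.mem_prim.2 ⟨S.Lam_pow_mem s (by rwa [Nat.sub_add_cancel (by omega)]), ?_⟩
      rwa [← Module.End.mul_apply, ← pow_succ']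
    set γ : ℂ := ∏ i ∈ Finset.range s, (((i : ℂ) + 1) * ((n : ℂ) - (m - 2 * s : ℕ) - i)) with hγ
    -- For s ≥ 1, or m ≤ n, the bound m - s ≤ n makes γ nonzero. The remaining case s = 0, m = n + 1
    -- concerns a primitive element of degree above n.
    have hγ0 : γ ≠ 0 ∨ (S.Lam ^ s) b = 0 := by
      by_cases hn : n < m - 2 * s
      · exact Or.inr (S.prim_eq_zero hn hc)
      · exact Or.inl (prod_ne_zero (by omega))
    have hL : (S.L ^ s) (γ⁻¹ • (S.Lam ^ s) b) ∈ S.deg m := by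
      have := S.L_pow_mem (Submodule.smul_mem _ γ⁻¹ (S.mem_prim.1 hc).1) s
      rwa [Nat.sub_add_cancel (by omega)] at this
    obtain ⟨c, h1, h2, h3⟩ := ih (by omega) (Submodule.sub_mem _ hb hL) (by
      rw [map_sub, S.Lam_pow_L_pow (Submodule.smul_mem _ _ hc), ← hγ, smul_smul]
      rcases hγ0 with h0 | h0
      · rw [mul_inv_cancel₀ h0, one_smul, sub_self]
      · rw [h0, smul_zero, sub_zero])
    refine ⟨Function.update c s (γ⁻¹ • (S.Lam ^ s) b), fun r hr => ?_, fun r hr => ?_, ?_⟩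
    · by_cases hrs : r = s
      · subst hrs
        rw [Function.update_self]
        exact Submodule.smul_mem _ _ hc
      · rw [Function.update_of_ne hrs]
        exact h1 r (by omega)
    · rw [Function.update_of_ne (by omega)]
      exact h2 r (by omega)
    · rw [Finset.sum_range_succ, Function.update_self, eq_comm, ← eq_sub_iff_add_eq, h3]
      refine Finset.sum_congr rfl fun r hr => ?_
      rw [Function.update_of_ne (Finset.mem_range.1 hr).ne]

theorem exists_decomposition {m : ℕ} (hm : m ≤ n + 1) {b : E} (hb : b ∈ S.deg m) :
    ∃ c : ℕ → E, S.IsDecomposition m b c := by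
  obtain ⟨c, h1, h2, h3⟩ := S.exists_decomposition_aux hm (m / 2 + 1) le_rfl hb (by
    rw [pow_succ', Module.End.mul_apply]
    -- Λ^(m/2) b has degree m % 2 < 2, where Λ vanishes.
    refine S.Lam_zero (m % 2) (by omega) _ (S.Lam_pow_mem _ ?_)
    rwa [Nat.mod_add_div])
  exact ⟨c, fun r hr => h1 r (by omega), fun r hr => h2 r (by omega), h3⟩

/-- If t is the last index with c_t ≠ 0, then Λ^t kills every other term of the sum and multiplies
c_t by a nonzero scalar. -/
theorem decomposition_zero_unique {m : ℕ} (hm : m ≤ n + 1) {c : ℕ → E}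
    (h : S.IsDecomposition m 0 c) : c = 0 := by
  by_contra hne
  obtain ⟨h1, h2, h3⟩ := h
  have hex : ∃ t, ∀ r, t ≤ r → c r = 0 := ⟨m / 2 + 1, fun r hr => h2 r (by omega)⟩
  classical
  obtain ⟨t, ht, hmin⟩ : ∃ t, (∀ r, t ≤ r → c r = 0) ∧ ∀ s < t, ¬ ∀ r, s ≤ r → c r = 0 :=
    ⟨Nat.find hex, Nat.find_spec hex, fun s hs => Nat.find_min hex hs⟩
  rcases t with _ | t
  · exact hne (funext fun r => ht r (Nat.zero_le r))
  refine hmin t t.lt_succ_self fun r hr => ?_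
  rcases hr.lt_or_eq with hlt | rfl
  · exact ht r hlt
  by_cases htm : m < 2 * t
  · exact h2 t htm
  have hp := h1 t (by omega)
  by_cases hn : n < m - 2 * t
  · exact S.prim_eq_zero hn hp
  have h4 := congrArg (S.Lam ^ t) h3
  rw [map_zero, map_sum, Finset.sum_eq_single t, S.Lam_pow_L_pow hp] at h4
  · exact (smul_eq_zero.1 h4.symm).resolve_left (prod_ne_zero (by omega))
  · intro r hr hrt
    rcases lt_or_gt_of_ne hrt with hlt | hgt
    · exact S.Lam_pow_L_pow_eq_zero hlt (h1 r (by omega))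
    · rw [ht r hgt, map_zero, map_zero]
  · intro hmem
    simp only [Finset.mem_range] at hmem
    omega

theorem decomposition_unique {m : ℕ} (hm : m ≤ n + 1) {b : E} {c c' : ℕ → E}
    (h : S.IsDecomposition m b c) (h' : S.IsDecomposition m b c') : c' = c := by
  refine sub_eq_zero.1 (S.decomposition_zero_unique hm ⟨fun r hr => ?_, fun r hr => ?_, ?_⟩)
  · exact Submodule.sub_mem _ (h'.1 r hr) (h.1 r hr)
  · simp [h.2.1 r hr, h'.2.1 r hr]
  · simp only [Pi.sub_apply, map_sub, Finset.sum_sub_distrib]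
    rw [← h.2.2, ← h'.2.2, sub_self]

end LefschetzModule

end AlmostHermitian
end

noncomputable section

namespace AlmostHermitian

/-! ### Scalar multiplication of forms

The instances below are found by unification with the module structures, unlike the direct ones. -/

section Instances

variable {V : Type*} [AddCommGroup V] [Module ℝ V] [TopologicalSpace V]

/-- Scalar multiplication on forms of degree `k`, from the module structure. -/
abbrev smulFormDegree (k : ℕ) : SMul ℂ (V [⋀^Fin k]→L[ℝ] ℂ) :=
  Module.toDistribMulAction.toDistribSMul.toSMulZeroClass.toSMul

attribute [local instance] smulFormDegree

/-- Scalar multiplication on forms, from the module structure. -/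
abbrev smulExtForm : SMul ℂ (ExtForm V) :=
  Module.toDistribMulAction.toDistribSMul.toSMulZeroClass.toSMul

end Instances

/-! ### Contraction of wedge products -/

section Wedge

attribute [local instance] smulFormDegree smulExtForm

/-- A permutation is determined by the place l that it sends to 0 and by what it does to the other
places. -/
theorem bijective_decomposeFin_mul_cycleRange (m : ℕ) :
    Function.Bijective fun x : Fin (m + 1) × Equiv.Perm (Fin m) =>
      Equiv.Perm.decomposeFin.symm (0, x.2) * x.1.cycleRange := by
  rw [Fintype.bijective_iff_injective_and_card]
  refine ⟨?_, by simp [Fintype.card_perm, Nat.factorial_succ]⟩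
  rintro ⟨l, τ⟩ ⟨l', τ'⟩ h
  have hl : l = l' := by
    have h1 := congrArg (fun σ : Equiv.Perm (Fin (m + 1)) => σ.symm 0) h
    have key : ∀ (l : Fin (m + 1)) (τ : Equiv.Perm (Fin m)),
        (Equiv.Perm.decomposeFin.symm (0, τ) * l.cycleRange).symm 0 = l := by
      intro l τ
      rw [Equiv.symm_apply_eq]
      simp
    simpa only [key] using h1
  subst hl
  have h2 := Equiv.Perm.decomposeFin.symm.injective (mul_right_cancel h)
  simpa using h2

/-- Groups the permutations by the slot l into which u falls; the cycle moving it there has sign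
(-1)^l. -/
theorem sum_perm_cons {W : Type*} (m : ℕ) (f : (Fin (m + 1) → W) → ℂ) (u : W) (v : Fin m → W) :
    ∑ σ : Equiv.Perm (Fin (m + 1)), Equiv.Perm.sign σ • f ((Fin.cons u v : Fin (m + 1) → W) ∘ σ) =
      ∑ l : Fin (m + 1), ∑ τ : Equiv.Perm (Fin m),
        ((-1 : ℂ) ^ (l : ℕ)) * (Equiv.Perm.sign τ • f (l.insertNth u (v ∘ τ))) := by
  rw [← Fintype.sum_prod_type', ← (bijective_decomposeFin_mul_cycleRange m).sum_comp]
  refine Finset.sum_congr rfl fun x _ => ?_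
  obtain ⟨l, τ⟩ := x
  have h1 : (Fin.cons u v : Fin (m + 1) → W) ∘
      (Equiv.Perm.decomposeFin.symm (0, τ) * l.cycleRange) = l.insertNth u (v ∘ τ) := by
    funext i
    cases i using Fin.succAboveCases l with
    | x => simp
    | p i => simp
  rw [h1, Equiv.Perm.sign_mul, Fin.sign_cycleRange, Equiv.Perm.decomposeFin.symm_sign]
  simp only [if_true, one_mul, mul_comm (Equiv.Perm.sign τ), mul_smul, Units.smul_def]
  simp

variable {V : Type*} [AddCommGroup V] [Module ℝ V] [TopologicalSpace V]

/-- Interior product on forms of a fixed degree. -/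
def ctr {k : ℕ} (u : V) (a : V [⋀^Fin (k + 1)]→L[ℝ] ℂ) : V [⋀^Fin k]→L[ℝ] ℂ :=
  { a.toAlternatingMap.curryLeft u with
    cont := by
      have : Continuous fun v : Fin k → V => a (Fin.cons u v) :=
        a.cont.comp (continuous_const.finCons continuous_id)
      exact this }

theorem ctr_apply {k : ℕ} (u : V) (a : V [⋀^Fin (k + 1)]→L[ℝ] ℂ) (v : Fin k → V) :
    ctr u a v = a (Fin.cons u v) := rfl

theorem ext_ctr {k : ℕ} {a b : V [⋀^Fin (k + 1)]→L[ℝ] ℂ} (h : ∀ u, ctr u a = ctr u b) :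
    a = b := by
  ext v
  have := congrArg (fun c => c (Fin.tail v)) (h (v 0))
  simpa [ctr_apply] using this

theorem apply_insertNth {k : ℕ} (a : V [⋀^Fin (k + 1)]→L[ℝ] ℂ) (l : Fin (k + 1)) (u : V)
    (v : Fin k → V) : a (l.insertNth u v) = (-1 : ℂ) ^ (l : ℕ) * ctr u a v := by
  have := a.toAlternatingMap.map_insertNth l u v
  simp only [zsmul_eq_mul, Int.cast_pow, Int.cast_neg, Int.cast_one] at this
  exact this

theorem tensor_insertNth_castAdd {p q m : ℕ} (h : p + 1 + q = m + 1) (h' : p + q = m)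
    (a : V [⋀^Fin (p + 1)]→L[ℝ] ℂ) (b : V [⋀^Fin q]→L[ℝ] ℂ) (i : Fin (p + 1)) (u : V)
    (v : Fin m → V) :
    tensor h a b ((Fin.cast h (Fin.castAdd q i)).insertNth u v) =
      (-1 : ℂ) ^ (i : ℕ) * tensor h' (ctr u a) b v := by
  have h1 : (fun x => ((Fin.cast h (Fin.castAdd q i)).insertNth u v : Fin (m + 1) → V)
      (Fin.cast h (Fin.castAdd q x))) =
      (i.insertNth u fun x => v (Fin.cast h' (Fin.castAdd q x)) : Fin (p + 1) → V) := by
    funext x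
    cases x using Fin.succAboveCases i with
    | x => simp
    | p x =>
      have : Fin.cast h (Fin.castAdd q (i.succAbove x)) =
          (Fin.cast h (Fin.castAdd q i)).succAbove (Fin.cast h' (Fin.castAdd q x)) := by
        ext
        simp only [Fin.succAbove, Fin.lt_def, Fin.val_cast, Fin.val_castAdd, Fin.val_castSucc,
          Fin.val_succ, apply_ite]
        split_ifs <;> rfl
      rw [this, Fin.insertNth_apply_succAbove, Fin.insertNth_apply_succAbove]
  have h2 : (fun x => ((Fin.cast h (Fin.castAdd q i)).insertNth u v : Fin (m + 1) → V)
      (Fin.cast h (Fin.natAdd (p + 1) x))) = fun x => v (Fin.cast h' (Fin.natAdd p x)) := by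
    funext x
    have : Fin.cast h (Fin.natAdd (p + 1) x) =
        (Fin.cast h (Fin.castAdd q i)).succAbove (Fin.cast h' (Fin.natAdd p x)) := by
      ext
      simp only [Fin.succAbove, Fin.lt_def, Fin.val_cast, Fin.val_castAdd, Fin.val_castSucc,
        Fin.val_natAdd]
      rw [if_neg (by omega)]
      simp only [Fin.val_succ, Fin.val_cast, Fin.val_natAdd]
      omega
    rw [this, Fin.insertNth_apply_succAbove]
  rw [tensor_apply, tensor_apply, h1, h2, apply_insertNth, mul_assoc]

theorem tensor_insertNth_natAdd {p q m : ℕ} (h : p + (q + 1) = m + 1) (h' : p + q = m)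
    (a : V [⋀^Fin p]→L[ℝ] ℂ) (b : V [⋀^Fin (q + 1)]→L[ℝ] ℂ) (j : Fin (q + 1)) (u : V)
    (v : Fin m → V) :
    tensor h a b ((Fin.cast h (Fin.natAdd p j)).insertNth u v) =
      (-1 : ℂ) ^ (j : ℕ) * tensor h' a (ctr u b) v := by
  have h1 : (fun x => ((Fin.cast h (Fin.natAdd p j)).insertNth u v : Fin (m + 1) → V)
      (Fin.cast h (Fin.natAdd p x))) =
      (j.insertNth u fun x => v (Fin.cast h' (Fin.natAdd p x)) : Fin (q + 1) → V) := by
    funext x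
    cases x using Fin.succAboveCases j with
    | x => simp
    | p x =>
      have : Fin.cast h (Fin.natAdd p (j.succAbove x)) =
          (Fin.cast h (Fin.natAdd p j)).succAbove (Fin.cast h' (Fin.natAdd p x)) := by
        ext
        simp only [Fin.succAbove, Fin.lt_def, Fin.val_cast, Fin.val_natAdd, Fin.val_castSucc,
          Fin.val_succ, apply_ite, Nat.add_lt_add_iff_left]
        split_ifs <;> rfl
      rw [this, Fin.insertNth_apply_succAbove, Fin.insertNth_apply_succAbove]
  have h2 : (fun x => ((Fin.cast h (Fin.natAdd p j)).insertNth u v : Fin (m + 1) → V)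
      (Fin.cast h (Fin.castAdd (q + 1) x))) = fun x => v (Fin.cast h' (Fin.castAdd q x)) := by
    funext x
    have : Fin.cast h (Fin.castAdd (q + 1) x) =
        (Fin.cast h (Fin.natAdd p j)).succAbove (Fin.cast h' (Fin.castAdd q x)) := by
      ext
      simp only [Fin.succAbove, Fin.lt_def, Fin.val_cast, Fin.val_castAdd, Fin.val_castSucc,
        Fin.val_natAdd]
      rw [if_pos (by omega)]
      simp
    rw [this, Fin.insertNth_apply_succAbove]
  rw [tensor_apply, tensor_apply, h1, h2, apply_insertNth]
  ring

theorem wedge_apply {p q m : ℕ} (h : p + q = m) (a : V [⋀^Fin p]→L[ℝ] ℂ)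
    (b : V [⋀^Fin q]→L[ℝ] ℂ) (v : Fin m → V) :
    wedge h a b v = ((p ! : ℂ) * (q ! : ℂ))⁻¹ *
      ∑ σ : Equiv.Perm (Fin m), Equiv.Perm.sign σ • tensor h a b (v ∘ σ) := by
  rw [wedge, ContinuousAlternatingMap.smul_apply,
    ContinuousMultilinearMap.alternatization_apply_apply, smul_eq_mul]

/-- Separates the permutations that feed u to the first factor from those that feed it to the
second. -/
theorem wedge_cons {p q m : ℕ} (h : p + q = m + 1) (a : V [⋀^Fin p]→L[ℝ] ℂ)
    (b : V [⋀^Fin q]→L[ℝ] ℂ) (u : V) (v : Fin m → V) :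
    wedge h a b (Fin.cons u v) = ((p ! : ℂ) * (q ! : ℂ))⁻¹ *
      (∑ i : Fin p, (-1 : ℂ) ^ (i : ℕ) * ∑ τ : Equiv.Perm (Fin m), Equiv.Perm.sign τ •
        tensor h a b ((Fin.cast h (Fin.castAdd q i)).insertNth u (v ∘ τ)) +
      ∑ j : Fin q, (-1 : ℂ) ^ (p + j : ℕ) * ∑ τ : Equiv.Perm (Fin m), Equiv.Perm.sign τ •
        tensor h a b ((Fin.cast h (Fin.natAdd p j)).insertNth u (v ∘ τ))) := by
  rw [wedge_apply, sum_perm_cons]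
  congr 1
  rw [← (finCongr h).sum_comp, Fin.sum_univ_add]
  simp [Finset.mul_sum]

/-- Each of the p + 1 slots contributes the same amount, since the two signs (-1)^i cancel; the
factor p + 1 turns (p+1)! into p!. -/
theorem sum_castAdd {p q m : ℕ} (h : p + 1 + q = m + 1) (h' : p + q = m)
    (a : V [⋀^Fin (p + 1)]→L[ℝ] ℂ) (b : V [⋀^Fin q]→L[ℝ] ℂ) (u : V) (v : Fin m → V) :
    (((p + 1) ! : ℂ) * (q ! : ℂ))⁻¹ * ∑ i : Fin (p + 1), (-1 : ℂ) ^ (i : ℕ) *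
      ∑ τ : Equiv.Perm (Fin m), Equiv.Perm.sign τ •
        tensor h a b ((Fin.cast h (Fin.castAdd q i)).insertNth u (v ∘ τ)) =
      wedge h' (ctr u a) b v := by
  have h1 : ∀ i : Fin (p + 1), (-1 : ℂ) ^ (i : ℕ) *
      ∑ τ : Equiv.Perm (Fin m), Equiv.Perm.sign τ •
        tensor h a b ((Fin.cast h (Fin.castAdd q i)).insertNth u (v ∘ τ)) =
      ∑ τ : Equiv.Perm (Fin m), Equiv.Perm.sign τ • tensor h' (ctr u a) b (v ∘ τ) := by
    intro i
    simp only [tensor_insertNth_castAdd h h', ← mul_smul_comm, ← Finset.mul_sum]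
    rw [← mul_assoc, ← mul_pow]
    simp
  rw [Finset.sum_congr rfl fun i _ => h1 i, wedge_apply, Finset.sum_const, Finset.card_univ,
    Fintype.card_fin, nsmul_eq_mul, ← mul_assoc]
  congr 1
  have : ((p ! : ℕ) : ℂ) ≠ 0 := by exact_mod_cast p.factorial_ne_zero
  have : ((q ! : ℕ) : ℂ) ≠ 0 := by exact_mod_cast q.factorial_ne_zero
  have : ((p + 1 : ℕ) : ℂ) ≠ 0 := by exact_mod_cast p.succ_ne_zero
  rw [Nat.factorial_succ]
  push_cast at *
  field_simp

theorem sum_natAdd {p q m : ℕ} (h : p + (q + 1) = m + 1) (h' : p + q = m)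
    (a : V [⋀^Fin p]→L[ℝ] ℂ) (b : V [⋀^Fin (q + 1)]→L[ℝ] ℂ) (u : V) (v : Fin m → V) :
    ((p ! : ℂ) * ((q + 1) ! : ℂ))⁻¹ * ∑ j : Fin (q + 1), (-1 : ℂ) ^ (p + j : ℕ) *
      ∑ τ : Equiv.Perm (Fin m), Equiv.Perm.sign τ •
        tensor h a b ((Fin.cast h (Fin.natAdd p j)).insertNth u (v ∘ τ)) =
      (-1 : ℂ) ^ p * wedge h' a (ctr u b) v := by
  have h1 : ∀ i : Fin (q + 1), (-1 : ℂ) ^ (p + i : ℕ) *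
      ∑ τ : Equiv.Perm (Fin m), Equiv.Perm.sign τ •
        tensor h a b ((Fin.cast h (Fin.natAdd p i)).insertNth u (v ∘ τ)) =
      (-1 : ℂ) ^ p * ∑ τ : Equiv.Perm (Fin m), Equiv.Perm.sign τ •
        tensor h' a (ctr u b) (v ∘ τ) := by
    intro i
    simp only [tensor_insertNth_natAdd h h', ← mul_smul_comm, ← Finset.mul_sum]
    rw [← mul_assoc, pow_add, mul_assoc ((-1 : ℂ) ^ p), ← mul_pow]
    simp
  rw [Finset.sum_congr rfl fun i _ => h1 i, wedge_apply, Finset.sum_const, Finset.card_univ,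
    Fintype.card_fin, nsmul_eq_mul, ← mul_assoc, ← mul_assoc, ← mul_assoc]
  congr 1
  have : ((p ! : ℕ) : ℂ) ≠ 0 := by exact_mod_cast p.factorial_ne_zero
  have : ((q ! : ℕ) : ℂ) ≠ 0 := by exact_mod_cast q.factorial_ne_zero
  have : ((q + 1 : ℕ) : ℂ) ≠ 0 := by exact_mod_cast q.succ_ne_zero
  rw [Nat.factorial_succ]
  push_cast at *
  field_simp

/-- The graded Leibniz rule for interior products. -/
theorem ctr_wedge {p q m : ℕ} (h : p + 1 + (q + 1) = m + 1) (h₁ : p + (q + 1) = m)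
    (h₂ : p + 1 + q = m) (a : V [⋀^Fin (p + 1)]→L[ℝ] ℂ) (b : V [⋀^Fin (q + 1)]→L[ℝ] ℂ) (u : V) :
    ctr u (wedge h a b) = wedge h₁ (ctr u a) b + (-1 : ℂ) ^ (p + 1) • wedge h₂ a (ctr u b) := by
  ext v
  rw [ctr_apply, wedge_cons, mul_add, sum_castAdd h h₁, sum_natAdd h h₂]
  rfl

theorem ctr_wedge_zero {p m : ℕ} (h : p + 1 + 0 = m + 1) (h₁ : p + 0 = m)
    (a : V [⋀^Fin (p + 1)]→L[ℝ] ℂ) (b : V [⋀^Fin 0]→L[ℝ] ℂ) (u : V) :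
    ctr u (wedge h a b) = wedge h₁ (ctr u a) b := by
  ext v
  rw [ctr_apply, wedge_cons, mul_add, sum_castAdd h h₁]
  simp

theorem zero_wedge {q : ℕ} (h : 0 + q = q) (a : V [⋀^Fin 0]→L[ℝ] ℂ) (b : V [⋀^Fin q]→L[ℝ] ℂ) :
    wedge h a b = a 0 • b := by
  ext v
  have h1 : ∀ σ : Equiv.Perm (Fin q), Equiv.Perm.sign σ • tensor h a b (v ∘ σ) = a 0 * b v := by
    intro σ
    have h2 : (fun i => (v ∘ σ) (Fin.cast h (Fin.natAdd 0 i))) = v ∘ σ := by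
      funext i
      rw [show Fin.cast h (Fin.natAdd 0 i) = i from Fin.ext (by simp)]
    rw [tensor_apply, h2, Subsingleton.elim (fun i : Fin 0 => _) (0 : Fin 0 → V), ← mul_smul_comm]
    have h3 := b.toAlternatingMap.map_perm v σ
    rw [ContinuousAlternatingMap.coe_toAlternatingMap] at h3
    rw [h3, smul_smul, Int.units_mul_self, one_smul]
  rw [wedge_apply, Finset.sum_congr rfl fun σ _ => h1 σ, Finset.sum_const, Finset.card_univ,
    Fintype.card_perm, Fintype.card_fin, nsmul_eq_mul, ContinuousAlternatingMap.smul_apply,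
    smul_eq_mul]
  have : ((q ! : ℕ) : ℂ) ≠ 0 := by exact_mod_cast q.factorial_ne_zero
  simp only [Nat.factorial_zero, Nat.cast_one, one_mul]
  field_simp

theorem wedge_add {p q m : ℕ} (h : p + q = m) (a : V [⋀^Fin p]→L[ℝ] ℂ)
    (b b' : V [⋀^Fin q]→L[ℝ] ℂ) : wedge h a (b + b') = wedge h a b + wedge h a b' := by
  ext v
  simp only [wedge_apply, ContinuousAlternatingMap.add_apply, tensor_apply, mul_add, smul_add,
    Finset.sum_add_distrib]

theorem wedge_smul {p q m : ℕ} (h : p + q = m) (c : ℂ) (a : V [⋀^Fin p]→L[ℝ] ℂ)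
    (b : V [⋀^Fin q]→L[ℝ] ℂ) : wedge h a (c • b) = c • wedge h a b := by
  ext v
  simp only [wedge_apply, ContinuousAlternatingMap.smul_apply, tensor_apply, smul_eq_mul,
    mul_left_comm _ c, ← mul_smul_comm, ← Finset.mul_sum]

theorem wedge_comp {W : Type*} [AddCommGroup W] [Module ℝ W] [TopologicalSpace W] {p q m : ℕ}
    (h : p + q = m) (a : V [⋀^Fin p]→L[ℝ] ℂ) (b : V [⋀^Fin q]→L[ℝ] ℂ) (A : W →L[ℝ] V) :
    (wedge h a b).compContinuousLinearMap A =
      wedge h (a.compContinuousLinearMap A) (b.compContinuousLinearMap A) := by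
  ext v
  simp only [ContinuousAlternatingMap.compContinuousLinearMap_apply, wedge_apply, tensor_apply]
  rfl

end Wedge

end AlmostHermitian
end

noncomputable section

namespace AlmostHermitian

/-! ### The operators of exterior algebra -/

section Operators

attribute [local instance] smulFormDegree smulExtForm

variable {V : Type*} [AddCommGroup V] [Module ℝ V] [TopologicalSpace V]

/-- Interior product, as a linear operator. -/
def intOp (u : V) : Module.End ℂ (ExtForm V) where
  toFun := contract u
  map_add' _ _ := rfl
  map_smul' _ _ := rfl

/-- Exterior product with a 1-form. -/
def covOp (l : V [⋀^Fin 1]→L[ℝ] ℂ) : Module.End ℂ (ExtForm V) where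
  toFun a k := match k with
    | 0 => 0
    | k + 1 => wedge (Nat.add_comm 1 k) l (a k)
  map_add' a b := by
    funext k
    rcases k with _ | k
    · exact (add_zero _).symm
    · exact wedge_add _ _ _ _
  map_smul' c a := by
    funext k
    rcases k with _ | k
    · exact (smul_zero (A := V [⋀^Fin 0]→L[ℝ] ℂ) c).symm
    · exact wedge_smul _ _ _ _

/-- Exterior product with a 2-form, as a linear operator. -/
def lefOp (w : V [⋀^Fin 2]→L[ℝ] ℂ) : Module.End ℂ (ExtForm V) where
  toFun := ptL w
  map_add' a b := by
    funext k
    rcases k with _ | _ | k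
    · exact (add_zero _).symm
    · exact (add_zero _).symm
    · exact wedge_add _ _ _ _
  map_smul' c a := by
    funext k
    rcases k with _ | _ | k
    · exact (smul_zero (A := V [⋀^Fin 0]→L[ℝ] ℂ) c).symm
    · exact (smul_zero (A := V [⋀^Fin 1]→L[ℝ] ℂ) c).symm
    · exact wedge_smul _ _ _ _

/-- The operator `(-1) ^ k` on forms of degree `k`. -/
def parOp : Module.End ℂ (ExtForm V) where
  toFun a k := (-1 : ℂ) ^ k • a k
  map_add' _ _ := funext fun _ => smul_add _ _ _
  map_smul' c a := funext fun k => smul_comm (α := V [⋀^Fin k]→L[ℝ] ℂ) _ c (a k)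

/-- The operator `k` on forms of degree `k`. -/
def degOp : Module.End ℂ (ExtForm V) where
  toFun a k := (k : ℂ) • a k
  map_add' _ _ := funext fun _ => smul_add _ _ _
  map_smul' c a := funext fun k => smul_comm (α := V [⋀^Fin k]→L[ℝ] ℂ) _ c (a k)

/-- Pull-back by a linear map. -/
def pullOp {W : Type*} [AddCommGroup W] [Module ℝ W] [TopologicalSpace W] (A : W →L[ℝ] V) :
    ExtForm V →ₗ[ℂ] ExtForm W where
  toFun a k := (a k).compContinuousLinearMap A
  map_add' _ _ := rfl
  map_smul' _ _ := rfl

theorem intOp_apply (u : V) (a : ExtForm V) (k : ℕ) : intOp u a k = ctr u (a (k + 1)) := rfl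
theorem covOp_zero (l : V [⋀^Fin 1]→L[ℝ] ℂ) (a : ExtForm V) : covOp l a 0 = 0 := rfl
theorem covOp_succ (l : V [⋀^Fin 1]→L[ℝ] ℂ) (a : ExtForm V) (k : ℕ) :
    covOp l a (k + 1) = wedge (Nat.add_comm 1 k) l (a k) := rfl
theorem lefOp_zero (w : V [⋀^Fin 2]→L[ℝ] ℂ) (a : ExtForm V) : lefOp w a 0 = 0 := rfl
theorem lefOp_one (w : V [⋀^Fin 2]→L[ℝ] ℂ) (a : ExtForm V) : lefOp w a 1 = 0 := rfl
theorem lefOp_add_two (w : V [⋀^Fin 2]→L[ℝ] ℂ) (a : ExtForm V) (k : ℕ) :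
    lefOp w a (k + 2) = wedge (Nat.add_comm 2 k) w (a k) := rfl
theorem parOp_apply (a : ExtForm V) (k : ℕ) : (parOp a : ExtForm V) k = (-1 : ℂ) ^ k • a k := rfl
theorem degOp_apply (a : ExtForm V) (k : ℕ) : degOp a k = (k : ℂ) • a k := rfl
theorem pullOp_apply {W : Type*} [AddCommGroup W] [Module ℝ W] [TopologicalSpace W]
    (A : W →L[ℝ] V) (a : ExtForm V) (k : ℕ) :
    pullOp A a k = (a k).compContinuousLinearMap A := rfl

theorem intOp_add (u v : V) (a : ExtForm V) : intOp (u + v) a = intOp u a + intOp v a := by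
  funext k
  ext x
  exact (a (k + 1)).cons_add x u v

theorem intOp_smul (r : ℝ) (u : V) (a : ExtForm V) : intOp (r • u) a = (r : ℂ) • intOp u a := by
  funext k
  ext x
  exact ((a (k + 1)).cons_smul x r u).trans (Complex.real_smul ..)

theorem intOp_zero (a : ExtForm V) : intOp (0 : V) a = 0 := by
  simpa using intOp_smul 0 (0 : V) a

theorem intOp_neg (u : V) (a : ExtForm V) : intOp (-u) a = -intOp u a := by
  simpa using intOp_smul (-1) u a

theorem intOp_sum {ι : Type*} (s : Finset ι) (r : ι → ℝ) (u : ι → V) (a : ExtForm V) :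
    intOp (∑ i ∈ s, r i • u i) a = ∑ i ∈ s, (r i : ℂ) • intOp (u i) a := by
  classical
  induction s using Finset.induction_on with
  | empty => simpa using intOp_zero a
  | insert i s hi ih => rw [Finset.sum_insert hi, Finset.sum_insert hi, intOp_add, intOp_smul, ih]

theorem intOp_intOp (u v : V) (a : ExtForm V) :
    intOp u (intOp v a) = -intOp v (intOp u a) := by
  funext k
  ext x
  have h := (a (k + 2)).toAlternatingMap.map_swap (Fin.cons v (Fin.cons u x))
    (i := 0) (j := 1) (by simp)
  have h2 : (Fin.cons v (Fin.cons u x) : Fin (k + 2) → V) ∘ Equiv.swap 0 1 =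
      Fin.cons u (Fin.cons v x) := by
    funext i
    refine Fin.cases (by simp) (fun i => Fin.cases (by simp) (fun i => ?_) i) i
    rw [Function.comp_apply, Equiv.swap_apply_of_ne_of_ne (Fin.succ_ne_zero _)]
    · simp
    · intro h
      exact Fin.succ_ne_zero _ (Fin.succ_injective _ h)
  rw [h2] at h
  exact (neg_eq_iff_eq_neg.2 h).symm

theorem intOp_covOp (u : V) (l : V [⋀^Fin 1]→L[ℝ] ℂ) (a : ExtForm V) :
    intOp u (covOp l a) = l (fun _ => u) • a - covOp l (intOp u a) := by
  have h0 : ctr u l 0 = l fun _ => u := by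
    rw [ctr_apply]
    congr 1
    funext i
    rw [Fin.fin_one_eq_zero i, Fin.cons_zero]
  funext k
  rcases k with _ | k
  · rw [intOp_apply, covOp_succ, ctr_wedge_zero _ rfl, zero_wedge, h0]
    exact (sub_zero _).symm
  · rw [intOp_apply, covOp_succ, ctr_wedge _ (Nat.zero_add _) (Nat.add_comm 1 k), zero_wedge, h0]
    simp only [Pi.sub_apply, Pi.smul_apply, covOp_succ, intOp_apply]
    simp [sub_eq_add_neg]

theorem intOp_lefOp (u : V) (w : V [⋀^Fin 2]→L[ℝ] ℂ) (a : ExtForm V) :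
    intOp u (lefOp w a) = lefOp w (intOp u a) + covOp (ctr u w) a := by
  funext k
  rcases k with _ | _ | k
  · rw [intOp_apply, lefOp_one]
    exact (add_zero _).symm
  · rw [intOp_apply, lefOp_add_two, ctr_wedge_zero _ rfl]
    exact (zero_add _).symm
  · rw [intOp_apply, lefOp_add_two, ctr_wedge _ (Nat.add_comm 1 _) (Nat.add_comm 2 k)]
    rw [show (-1 : ℂ) ^ (1 + 1) = 1 by norm_num, one_smul]
    exact add_comm _ _

/-- A form of positive degree is determined by its contractions, so induction on the degree of the
output applies. Commutation rules of exterior products are thereby reduced to commutation with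
`intOp`. -/
theorem end_eq_zero_of_intOp {X : Module.End ℂ (ExtForm V)} (h0 : ∀ a, X a 0 = 0) (c : ℂ)
    (h : ∀ u a, intOp u (X a) = c • X (intOp u a)) : X = 0 := by
  have key : ∀ k a, X a k = 0 := by
    intro k
    induction k with
    | zero => exact h0
    | succ k ih =>
      intro a
      refine ext_ctr fun u => ?_
      rw [← intOp_apply, h]
      exact (congrArg (c • ·) (ih _)).trans (smul_zero (A := V [⋀^Fin k]→L[ℝ] ℂ) c)
  exact LinearMap.ext fun a => funext fun k => key k a

theorem covOp_covOp (l l' : V [⋀^Fin 1]→L[ℝ] ℂ) (a : ExtForm V) :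
    covOp l (covOp l' a) = -covOp l' (covOp l a) := by
  have h : covOp l * covOp l' + covOp l' * covOp l = 0 := by
    refine end_eq_zero_of_intOp (fun a => by simp [covOp_zero]) 1 fun u a => ?_
    simp only [LinearMap.add_apply, Module.End.mul_apply, map_add, intOp_covOp, map_sub, map_smul]
    module
  exact eq_neg_of_add_eq_zero_left (congrArg (fun X => X a) h)

theorem lefOp_covOp (w : V [⋀^Fin 2]→L[ℝ] ℂ) (l : V [⋀^Fin 1]→L[ℝ] ℂ) (a : ExtForm V) :
    lefOp w (covOp l a) = covOp l (lefOp w a) := by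
  have h : lefOp w * covOp l - covOp l * lefOp w = 0 := by
    refine end_eq_zero_of_intOp (fun a => by simp [covOp_zero, lefOp_zero]) (-1) fun u a => ?_
    simp only [LinearMap.sub_apply, Module.End.mul_apply, map_add, intOp_covOp, intOp_lefOp,
      map_sub, map_smul, covOp_covOp (ctr u w) l]
    module
  exact sub_eq_zero.1 (congrArg (fun X => X a) h)

theorem lefOp_lefOp (w w' : V [⋀^Fin 2]→L[ℝ] ℂ) (a : ExtForm V) :
    lefOp w (lefOp w' a) = lefOp w' (lefOp w a) := by
  have h : lefOp w * lefOp w' - lefOp w' * lefOp w = 0 := by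
    refine end_eq_zero_of_intOp (fun a => by simp [lefOp_zero]) 1 fun u a => ?_
    simp only [LinearMap.sub_apply, Module.End.mul_apply, map_add, intOp_lefOp,
      map_sub, lefOp_covOp]
    module
  exact sub_eq_zero.1 (congrArg (fun X => X a) h)

/-- Iterates the contraction rule on the first argument. The result is the alternating sum that also
defines `extDeriv`, which makes `extD_eq` a comparison of terms. -/
theorem covOp_succ_apply (l : V [⋀^Fin 1]→L[ℝ] ℂ) (a : ExtForm V) (k : ℕ) (v : Fin (k + 1) → V) :
    covOp l a (k + 1) v =
      ∑ i : Fin (k + 1), (-1 : ℂ) ^ (i : ℕ) * (l (fun _ => v i) * a k (i.removeNth v)) := by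
  induction k generalizing a with
  | zero =>
    have h := congrArg (fun c : ExtForm V => c 0 (Fin.tail v)) (intOp_covOp (v 0) l a)
    simp only [intOp_apply, ctr_apply, Pi.sub_apply, covOp_zero, sub_zero, Pi.smul_apply,
      ContinuousAlternatingMap.smul_apply, Fin.cons_self_tail] at h
    rw [h]
    simp [Fin.removeNth_zero]
  | succ k ih =>
    have h := congrArg (fun c : ExtForm V => c (k + 1) (Fin.tail v)) (intOp_covOp (v 0) l a)
    simp only [intOp_apply, ctr_apply, Pi.sub_apply, Pi.smul_apply, ih,
      ContinuousAlternatingMap.smul_apply, ContinuousAlternatingMap.sub_apply,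
      Fin.cons_self_tail] at h
    rw [h, Fin.sum_univ_succ (n := k + 1), sub_eq_add_neg, ← Finset.sum_neg_distrib]
    congr 1
    · simp [Fin.removeNth_zero]
    · refine Finset.sum_congr rfl fun i _ => ?_
      have h3 : (Fin.cons (v 0) (i.removeNth (Fin.tail v)) : Fin (k + 1) → V) =
          i.succ.removeNth v := by
        funext j
        refine Fin.cases ?_ (fun j => ?_) j
        · simp [Fin.removeNth]
        · simp [Fin.removeNth, Fin.tail]
      rw [h3, Fin.val_succ, pow_succ, Fin.tail]
      ring

theorem parOp_parOp (a : ExtForm V) : parOp (parOp a) = a := by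
  funext k
  rw [parOp_apply, parOp_apply, smul_smul, ← mul_pow]
  simp

theorem parOp_intOp (u : V) (a : ExtForm V) : parOp (intOp u a) = -intOp u (parOp a) := by
  funext k
  ext v
  simp [parOp_apply, intOp_apply, ctr_apply, pow_succ]

theorem parOp_covOp (l : V [⋀^Fin 1]→L[ℝ] ℂ) (a : ExtForm V) :
    parOp (covOp l a) = -covOp l (parOp a) := by
  funext k
  rcases k with _ | k
  · simp [parOp_apply, covOp_zero]
  · simp [parOp_apply, covOp_succ, pow_succ, wedge_smul]

section Pull

variable {W : Type*} [AddCommGroup W] [Module ℝ W] [TopologicalSpace W] (A : W →L[ℝ] V)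

theorem pullOp_covOp (l : V [⋀^Fin 1]→L[ℝ] ℂ) (a : ExtForm V) :
    pullOp A (covOp l a) = covOp (l.compContinuousLinearMap A) (pullOp A a) := by
  funext k
  rcases k with _ | k
  · rfl
  · exact wedge_comp _ _ _ _

theorem pullOp_lefOp (w : V [⋀^Fin 2]→L[ℝ] ℂ) (a : ExtForm V) :
    pullOp A (lefOp w a) = lefOp (w.compContinuousLinearMap A) (pullOp A a) := by
  funext k
  rcases k with _ | _ | k
  · rfl
  · rfl
  · exact wedge_comp _ _ _ _

theorem intOp_pullOp (u : W) (a : ExtForm V) :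
    intOp u (pullOp A a) = pullOp A (intOp (A u) a) := by
  funext k
  ext v
  simp only [pullOp_apply, intOp_apply, ctr_apply,
    ContinuousAlternatingMap.compContinuousLinearMap_apply]
  congr 1
  funext i
  refine Fin.cases ?_ (fun i => ?_) i <;> simp

end Pull

/-- Forms of degree `k`. -/
def degSub (k : ℕ) : Submodule ℂ (ExtForm V) where
  carrier := {a | ∀ m, m ≠ k → a m = 0}
  add_mem' ha hb m hm := by simp [ha m hm, hb m hm]
  zero_mem' _ _ := rfl
  smul_mem' c a ha m hm := by simp [ha m hm]

theorem intOp_mem {k : ℕ} {a : ExtForm V} (ha : a ∈ degSub (k + 1)) (u : V) :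
    intOp u a ∈ degSub k := fun m hm => by
  rw [intOp_apply, ha (m + 1) (by omega)]
  rfl

theorem wedge_zero {p q m : ℕ} (h : p + q = m) (a : V [⋀^Fin p]→L[ℝ] ℂ) :
    wedge h a (0 : V [⋀^Fin q]→L[ℝ] ℂ) = 0 := by
  simpa using wedge_smul h 0 a (0 : V [⋀^Fin q]→L[ℝ] ℂ)

theorem lefOp_mem {k : ℕ} {a : ExtForm V} (ha : a ∈ degSub k) (w : V [⋀^Fin 2]→L[ℝ] ℂ) :
    lefOp w a ∈ degSub (k + 2) := fun m hm => by
  rcases m with _ | _ | m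
  · rfl
  · rfl
  · rw [lefOp_add_two, ha m (by omega), wedge_zero]

theorem pullOp_mem {W : Type*} [AddCommGroup W] [Module ℝ W] [TopologicalSpace W]
    (A : W →L[ℝ] V) {k : ℕ} {a : ExtForm V} (ha : a ∈ degSub k) : pullOp A a ∈ degSub k :=
  fun m hm => by
    rw [pullOp_apply, ha m hm]
    rfl

theorem intOp_of_mem_zero {a : ExtForm V} (ha : a ∈ degSub 0) (u : V) : intOp u a = 0 := by
  funext m
  rw [intOp_apply, ha _ (Nat.succ_ne_zero m)]
  rfl

theorem parOp_of_mem {k : ℕ} {a : ExtForm V} (ha : a ∈ degSub k) :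
    parOp a = (-1 : ℂ) ^ k • a := by
  funext m
  by_cases hm : m = k
  · subst hm
    exact parOp_apply a m
  · rw [parOp_apply, Pi.smul_apply, ha m hm]
    exact (smul_zero (A := V [⋀^Fin m]→L[ℝ] ℂ) _).trans
      (smul_zero (M := ℂ) (A := V [⋀^Fin m]→L[ℝ] ℂ) _).symm

theorem degOp_of_mem {k : ℕ} {a : ExtForm V} (ha : a ∈ degSub k) :
    degOp a = (k : ℂ) • a := by
  funext m
  by_cases hm : m = k
  · subst hm
    exact degOp_apply a m
  · rw [degOp_apply, Pi.smul_apply, ha m hm]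
    exact (smul_zero (A := V [⋀^Fin m]→L[ℝ] ℂ) _).trans
      (smul_zero (M := ℂ) (A := V [⋀^Fin m]→L[ℝ] ℂ) _).symm

theorem ptOne_mem : (ptOne : ExtForm V) ∈ degSub 0 := fun m hm => by
  rcases m with _ | m
  · exact absurd rfl hm
  · rfl

theorem eq_smul_ptOne {a : ExtForm V} (ha : a ∈ degSub 0) : a = (a 0 0) • ptOne := by
  funext m
  rcases m with _ | m
  · ext v
    rw [Subsingleton.elim v 0]
    simp [ptOne]
  · rw [ha _ (Nat.succ_ne_zero m)]
    exact (smul_zero (M := ℂ) (A := V [⋀^Fin (m + 1)]→L[ℝ] ℂ) _).symm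

theorem single_mem (k : ℕ) (a : V [⋀^Fin k]→L[ℝ] ℂ) : (Pi.single k a : ExtForm V) ∈ degSub k :=
  fun m hm => by
    rw [Pi.single_eq_of_ne hm]

theorem eq_zero_of_finrank_lt [FiniteDimensional ℝ V] {k : ℕ} (hk : Module.finrank ℝ V < k)
    (a : V [⋀^Fin k]→L[ℝ] ℂ) : a = 0 := by
  ext v
  refine a.toAlternatingMap.map_linearDependent v fun h => ?_
  have := h.fintype_card_le_finrank
  rw [Fintype.card_fin] at this
  omega

theorem eq_sum_single [FiniteDimensional ℝ V] {N : ℕ} (hN : Module.finrank ℝ V = N)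
    (a : ExtForm V) : a = ∑ k ∈ Finset.range (N + 1), (Pi.single k (a k) : ExtForm V) := by
  funext m
  rw [Finset.sum_apply]
  by_cases hm : m < N + 1
  · rw [Finset.sum_eq_single m, Pi.single_eq_same]
    · intro k _ hk
      exact Pi.single_eq_of_ne (Ne.symm hk) _
    · intro h
      exact absurd (Finset.mem_range.2 hm) h
  · rw [eq_zero_of_finrank_lt (by omega) (a m), Finset.sum_eq_zero]
    intro k hk
    rw [Finset.mem_range] at hk
    exact Pi.single_eq_of_ne (by omega) _

end Operators

end AlmostHermitian
end

noncomputable section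

namespace AlmostHermitian

/-! ### Hermitian vector spaces -/

section Hermitian

attribute [local instance] smulFormDegree smulExtForm

/-- A Hermitian structure on a real vector space of dimension `2 n`, with its fundamental form and
a basis. -/
structure HermitianSpace (n : ℕ) (V : Type*) [AddCommGroup V] [Module ℝ V]
    [TopologicalSpace V] where
  g : V →L[ℝ] V →L[ℝ] ℝ
  J : V →L[ℝ] V
  w : V [⋀^Fin 2]→L[ℝ] ℂ
  b : Module.Basis (Fin (2 * n)) ℝ V
  symm : ∀ u v, g u v = g v u
  pos : ∀ u, u ≠ 0 → 0 < g u u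
  J_J : ∀ u, J (J u) = -u
  g_J_J : ∀ u v, g (J u) (J v) = g u v
  w_apply : ∀ v, w v = (g (J (v 0)) (v 1) : ℝ)

namespace HermitianSpace

variable {n : ℕ} {V : Type*} [AddCommGroup V] [Module ℝ V] [TopologicalSpace V]
  (S : HermitianSpace n V)

theorem g_J_left (u v : V) : S.g (S.J u) v = -S.g u (S.J v) := by
  rw [← S.g_J_J u, S.J_J]
  simp

theorem eq_of_g {u v : V} (h : ∀ x, S.g x u = S.g x v) : u = v := by
  by_contra hne
  have h1 := S.pos (u - v) (sub_ne_zero.2 hne)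
  have h2 : S.g (u - v) (u - v) = 0 := by
    rw [map_sub (S.g (u - v)), h, sub_self]
  exact h1.ne' h2

/-- The 1-form `g (u, ·)`. -/
def flat (u : V) : V [⋀^Fin 1]→L[ℝ] ℂ := ctr (-S.J u) S.w

theorem flat_apply (u : V) (v : Fin 1 → V) : S.flat u v = (S.g u (v 0) : ℝ) := by
  rw [flat, ctr_apply, w_apply]
  simp only [Fin.cons_zero]
  rw [show (1 : Fin 2) = Fin.succ 0 from rfl, Fin.cons_succ, map_neg, S.J_J, neg_neg]

theorem flat_comp_J (u : V) : (S.flat u).compContinuousLinearMap S.J = -S.flat (S.J u) := by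
  ext v
  rw [ContinuousAlternatingMap.compContinuousLinearMap_apply,
    ContinuousAlternatingMap.neg_apply, flat_apply, flat_apply, S.g_J_left]
  simp

/-- Exterior product with `g (u, ·)`. -/
def e (u : V) : Module.End ℂ (ExtForm V) := covOp (S.flat u)

/-- The Lefschetz operator. -/
def L : Module.End ℂ (ExtForm V) := lefOp S.w

/-- The extension of `J` to forms. -/
def I : Module.End ℂ (ExtForm V) := pullOp S.J

theorem e_zero (u : V) (a : ExtForm V) : S.e u a 0 = 0 := rfl

theorem e_succ_apply (u : V) (a : ExtForm V) (k : ℕ) (v : Fin (k + 1) → V) :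
    S.e u a (k + 1) v = ∑ i : Fin (k + 1),
      (-1 : ℂ) ^ (i : ℕ) * ((S.g u (v i) : ℝ) * a k (i.removeNth v)) := by
  simp only [e, covOp_succ_apply, flat_apply]

theorem e_sum {ι : Type*} (s : Finset ι) (r : ι → ℝ) (u : ι → V) (a : ExtForm V) :
    S.e (∑ i ∈ s, r i • u i) a = ∑ i ∈ s, (r i : ℂ) • S.e (u i) a := by
  funext k
  rw [Finset.sum_apply]
  rcases k with _ | k
  · refine (Finset.sum_eq_zero fun i _ => ?_).symm
    exact smul_zero (A := V [⋀^Fin 0]→L[ℝ] ℂ) (r i : ℂ)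
  ext v
  rw [ContinuousAlternatingMap.sum_apply]
  simp only [Pi.smul_apply, ContinuousAlternatingMap.smul_apply, e_succ_apply]
  simp only [map_sum, map_smul, sum_apply, smul_apply, smul_eq_mul, Finset.mul_sum,
    Finset.sum_mul, Complex.ofReal_sum, Complex.ofReal_mul]
  rw [Finset.sum_comm]
  exact Finset.sum_congr rfl fun _ _ => Finset.sum_congr rfl fun _ _ => by ring

theorem e_neg (u : V) (a : ExtForm V) : S.e (-u) a = -S.e u a := by
  have := S.e_sum {()} (fun _ => -1) (fun _ => u) a
  simpa using this

theorem int_e (u v : V) (a : ExtForm V) :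
    intOp u (S.e v a) = (S.g v u : ℂ) • a - S.e v (intOp u a) := by
  rw [e, intOp_covOp, flat_apply]

theorem int_L (u : V) (a : ExtForm V) :
    intOp u (S.L a) = S.L (intOp u a) + S.e (S.J u) a := by
  rw [L, intOp_lefOp, e, flat, S.J_J, neg_neg]

theorem L_e (u : V) (a : ExtForm V) : S.L (S.e u a) = S.e u (S.L a) := lefOp_covOp _ _ _

theorem par_e (u : V) (a : ExtForm V) : parOp (S.e u a) = -S.e u (parOp a) := parOp_covOp _ _

theorem I_e (u : V) (a : ExtForm V) : S.I (S.e u a) = -S.e (S.J u) (S.I a) := by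
  rw [I, e, pullOp_covOp, flat_comp_J, ← S.e_neg, e, flat, flat, map_neg, neg_neg]
  congr 2
  ext v
  simp [ctr_apply, w_apply, S.J_J]

theorem I_int (u : V) (a : ExtForm V) : S.I (intOp u a) = -intOp (S.J u) (S.I a) := by
  rw [I, intOp_pullOp, S.J_J, intOp_neg, map_neg, neg_neg]

theorem w_comp_J : S.w.compContinuousLinearMap S.J = S.w := by
  ext v
  rw [ContinuousAlternatingMap.compContinuousLinearMap_apply, w_apply, w_apply]
  simp [S.g_J_J]

theorem I_L (a : ExtForm V) : S.I (S.L a) = S.L (S.I a) := by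
  rw [I, L, pullOp_lefOp, w_comp_J]

/-! ### The reciprocal basis -/

/-- The Gram matrix of the basis. -/
def gram : Matrix (Fin (2 * n)) (Fin (2 * n)) ℝ := Matrix.of fun s t => S.g (S.b s) (S.b t)

theorem gram_apply (s t : Fin (2 * n)) : S.gram s t = S.g (S.b s) (S.b t) := rfl

theorem isUnit_gram : IsUnit S.gram.det := by
  rw [isUnit_iff_ne_zero]
  intro h
  obtain ⟨v, hv, hGv⟩ := Matrix.exists_mulVec_eq_zero_iff.2 h
  have h0 : ∑ t, v t • S.b t ≠ 0 := by
    intro h1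
    refine hv (funext fun t => ?_)
    exact Fintype.linearIndependent_iff.1 S.b.linearIndependent v h1 t
  have h1 := S.pos _ h0
  have h2 : ∀ s, S.g (S.b s) (∑ t, v t • S.b t) = 0 := by
    intro s
    have := congrFun hGv s
    rw [map_sum]
    simpa [Matrix.mulVec, dotProduct, gram_apply, mul_comm] using this
  have h3 : S.g (∑ t, v t • S.b t) (∑ t, v t • S.b t) = 0 := by
    generalize hx : ∑ t, v t • S.b t = x at h2
    nth_rewrite 1 [← hx]
    simp [h2, sum_apply]
  exact h1.ne' h3

/-- The reciprocal basis. -/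
def c (s : Fin (2 * n)) : V := ∑ t, S.gram⁻¹ s t • S.b t

/-- This expansion and the next one replace orthonormal frames: the basis is arbitrary, and sums
over pairs (b_i, c_i) collapse as for an orthonormal basis. -/
theorem sum_g_b_c (x : V) : ∑ i, S.g (S.b i) x • S.c i = x := by
  have h : (∑ i, (S.g (S.b i)).toLinearMap.smulRight (S.c i)) = LinearMap.id := by
    refine S.b.ext fun k => ?_
    simp only [LinearMap.sum_apply, LinearMap.smulRight_apply, ContinuousLinearMap.coe_coe,
      LinearMap.id_apply, c, Finset.smul_sum, smul_smul]
    rw [Finset.sum_comm]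
    simp only [← Finset.sum_smul]
    have h1 : ∀ j, ∑ i, S.g (S.b i) (S.b k) * S.gram⁻¹ i j = (1 : Matrix _ _ ℝ) k j := by
      intro j
      rw [← Matrix.mul_nonsing_inv S.gram S.isUnit_gram, Matrix.mul_apply]
      exact Finset.sum_congr rfl fun i _ => by rw [gram_apply, S.symm]
    simp [h1, Matrix.one_apply]
  simpa using congrArg (fun f => f x) h

theorem sum_g_c_b (x : V) : ∑ i, S.g (S.c i) x • S.b i = x := by
  refine S.eq_of_g fun y => ?_
  rw [map_sum]
  conv_rhs => rw [← S.sum_g_b_c y]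
  simp only [map_sum, map_smul, sum_apply, smul_apply, smul_eq_mul]
  exact Finset.sum_congr rfl fun i _ => by rw [S.symm y, mul_comm]

theorem sum_g_b_c_self : ∑ i, S.g (S.b i) (S.c i) = 2 * n := by
  have h : ∀ i, S.g (S.b i) (S.c i) = (1 : Matrix (Fin (2 * n)) (Fin (2 * n)) ℝ) i i := by
    intro i
    rw [← Matrix.nonsing_inv_mul S.gram S.isUnit_gram, Matrix.mul_apply, c, map_sum]
    exact Finset.sum_congr rfl fun j _ => by rw [map_smul, smul_eq_mul, gram_apply, S.symm]
  simp [h]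

/-! ### The dual Lefschetz operator -/

/-- The dual Lefschetz operator, given by contraction. -/
def Lam : Module.End ℂ (ExtForm V) :=
  (1 / 2 : ℂ) • ∑ i, intOp (S.J (S.c i)) * intOp (S.b i)

theorem Lam_apply (a : ExtForm V) :
    S.Lam a = (1 / 2 : ℂ) • ∑ i, intOp (S.J (S.c i)) (intOp (S.b i) a) := by
  simp [Lam]

/-- The two contractions in Λ meet u once each; each expansion in a basis gives half of ι_(Ju). -/
theorem Lam_e (u : V) (a : ExtForm V) :
    S.Lam (S.e u a) = S.e u (S.Lam a) + intOp (S.J u) a := by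
  have h1 : ∀ i, intOp (S.J (S.c i)) (intOp (S.b i) (S.e u a)) =
      S.e u (intOp (S.J (S.c i)) (intOp (S.b i) a)) +
        ((S.g (S.b i) u : ℂ) • intOp (S.J (S.c i)) a +
          (S.g (S.c i) (S.J u) : ℂ) • intOp (S.b i) a) := by
    intro i
    rw [S.int_e, map_sub, map_smul, S.int_e, S.symm u (S.b i), S.symm u (S.J (S.c i)),
      S.g_J_left]
    push_cast
    module
  have h2 : ∑ i, (S.g (S.b i) u : ℂ) • intOp (S.J (S.c i)) a = intOp (S.J u) a := by
    conv_rhs => rw [← S.sum_g_b_c u, map_sum]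
    simp only [map_smul]
    rw [intOp_sum]
  have h3 : ∑ i, (S.g (S.c i) (S.J u) : ℂ) • intOp (S.b i) a = intOp (S.J u) a := by
    conv_rhs => rw [← S.sum_g_c_b (S.J u), intOp_sum]
  rw [Lam_apply, Lam_apply, Finset.sum_congr rfl fun i _ => h1 i, Finset.sum_add_distrib,
    Finset.sum_add_distrib, h2, h3, map_smul, map_sum]
  module

theorem Lam_int (u : V) (a : ExtForm V) : S.Lam (intOp u a) = intOp u (S.Lam a) := by
  rw [Lam_apply, Lam_apply, map_smul, map_sum]
  congr 1
  refine Finset.sum_congr rfl fun i _ => ?_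
  rw [intOp_intOp (S.b i), map_neg, intOp_intOp (S.J (S.c i)) u, neg_neg]

/-- The Euler operator. Contracting the sum with u gives ι_u a plus the same sum for ι_u a, so its
eigenvalue grows by one with each degree. -/
theorem sum_e_int_of {ι : Type*} [Fintype ι] {x y : ι → V}
    (h : ∀ u, ∑ i, S.g (y i) u • x i = u) (a : ExtForm V) :
    ∑ i, S.e (y i) (intOp (x i) a) = degOp a := by
  have key : ∀ k a, (∑ i, S.e (y i) (intOp (x i) a)) k = degOp a k := by
    intro k
    induction k with
    | zero =>
      intro a
      rw [Finset.sum_apply, degOp_apply, Nat.cast_zero, zero_smul]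
      exact Finset.sum_eq_zero fun i _ => rfl
    | succ k ih =>
      intro a
      refine ext_ctr fun u => ?_
      have h1 : intOp u (∑ i, S.e (y i) (intOp (x i) a)) =
          intOp u a + ∑ i, S.e (y i) (intOp (x i) (intOp u a)) := by
        have h2 : intOp u a = ∑ i, (S.g (y i) u : ℂ) • intOp (x i) a := by
          conv_lhs => rw [← h u, intOp_sum]
        rw [map_sum, add_comm, ← sub_eq_iff_eq_add', ← Finset.sum_sub_distrib, h2]
        refine Finset.sum_congr rfl fun i _ => ?_
        rw [S.int_e, ← h2, intOp_intOp u, map_neg, sub_neg_eq_add, add_sub_cancel_right]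
      rw [← intOp_apply, h1, Pi.add_apply, ih, degOp_apply, degOp_apply, intOp_apply]
      have h3 : ctr u (((k + 1 : ℕ) : ℂ) • a (k + 1)) = ((k + 1 : ℕ) : ℂ) • ctr u (a (k + 1)) := rfl
      rw [h3]
      push_cast
      module
  exact funext fun k => key k a

theorem sum_e_int (a : ExtForm V) : ∑ i, S.e (S.c i) (intOp (S.b i) a) = degOp a :=
  S.sum_e_int_of S.sum_g_c_b a

theorem sum_e_J_int_J (a : ExtForm V) :
    ∑ i, S.e (S.J (S.b i)) (intOp (S.J (S.c i)) a) = degOp a := by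
  refine S.sum_e_int_of (fun u => ?_) a
  have h := congrArg S.J (S.sum_g_b_c (S.J u))
  rw [S.J_J, map_sum, ← neg_eq_iff_eq_neg, ← Finset.sum_neg_distrib] at h
  refine Eq.trans (Finset.sum_congr rfl fun i _ => ?_) h
  rw [map_smul, S.g_J_left, neg_smul]

/-- Pushing both contractions through L leaves the trace 2n of the identity and two Euler operators
with a minus sign; the factor 1/2 gives n - deg. -/
theorem Lam_L (a : ExtForm V) : S.Lam (S.L a) = S.L (S.Lam a) + ((n : ℂ) • a - degOp a) := by
  have h1 : ∀ i, intOp (S.J (S.c i)) (intOp (S.b i) (S.L a)) =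
      S.L (intOp (S.J (S.c i)) (intOp (S.b i) a)) + ((S.g (S.b i) (S.c i) : ℂ) • a -
        S.e (S.J (S.b i)) (intOp (S.J (S.c i)) a) - S.e (S.c i) (intOp (S.b i) a)) := by
    intro i
    rw [S.int_L, map_add, S.int_L, S.int_e, S.g_J_J, S.J_J, S.e_neg]
    abel
  have h2 : ∑ i, (S.g (S.b i) (S.c i) : ℂ) • a = (2 * n : ℂ) • a := by
    rw [← Finset.sum_smul, ← Complex.ofReal_sum, S.sum_g_b_c_self]
    push_cast
    rfl
  rw [Lam_apply, Lam_apply, Finset.sum_congr rfl fun i _ => h1 i, Finset.sum_add_distrib,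
    Finset.sum_sub_distrib, Finset.sum_sub_distrib, h2, S.sum_e_int, S.sum_e_J_int_J, map_smul,
    map_sum]
  module

/-- Puts L into the shape of Λ with exterior products for contractions, so that the Hodge star,
which exchanges the two kinds of operators, exchanges L and Λ. -/
theorem L_eq (a : ExtForm V) :
    S.L a = (1 / 2 : ℂ) • ∑ i, S.e (S.b i) (S.e (S.J (S.c i)) a) := by
  have h : S.L - (1 / 2 : ℂ) • ∑ i, S.e (S.b i) * S.e (S.J (S.c i)) = 0 := by
    refine end_eq_zero_of_intOp (fun a => ?_) 1 fun u a => ?_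
    · have h0 : ∀ x : ExtForm V, ((1 / 2 : ℂ) • x) 0 = (1 / 2 : ℂ) • x 0 := fun _ => rfl
      simp only [LinearMap.sub_apply, LinearMap.smul_apply, LinearMap.sum_apply,
        Module.End.mul_apply, Pi.sub_apply, h0, Finset.sum_apply, e_zero, Finset.sum_const_zero]
      rw [smul_zero (A := V [⋀^Fin 0]→L[ℝ] ℂ) (1 / 2 : ℂ)]
      exact sub_zero _
    · have h1 : ∀ i, intOp u (S.e (S.b i) (S.e (S.J (S.c i)) a)) =
          S.e (S.b i) (S.e (S.J (S.c i)) (intOp u a)) +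
            ((S.g (S.b i) u : ℂ) • S.e (S.J (S.c i)) a +
              (S.g (S.c i) (S.J u) : ℂ) • S.e (S.b i) a) := by
        intro i
        rw [S.int_e, S.int_e, map_sub, map_smul, S.g_J_left]
        push_cast
        module
      have h2 : ∑ i, (S.g (S.b i) u : ℂ) • S.e (S.J (S.c i)) a = S.e (S.J u) a := by
        conv_rhs => rw [← S.sum_g_b_c u, map_sum]
        simp only [map_smul]
        rw [e_sum]
      have h3 : ∑ i, (S.g (S.c i) (S.J u) : ℂ) • S.e (S.b i) a = S.e (S.J u) a := by
        conv_rhs => rw [← S.sum_g_c_b (S.J u), e_sum]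
      simp only [LinearMap.sub_apply, LinearMap.smul_apply, LinearMap.sum_apply,
        Module.End.mul_apply, map_sub, map_smul, map_sum, h1, Finset.sum_add_distrib, h2, h3,
        S.int_L]
      module
  have h' := congrArg (fun X => X a) h
  simpa [sub_eq_zero] using h'

/-! ### Induction over the generators of the exterior algebra -/

/-- By the Euler operator every form of degree k + 1 is a combination of products of 1-forms with
its own contractions. -/
theorem degree_succ_induction {p : ExtForm V → Prop} (hadd : ∀ a b, p a → p b → p (a + b))
    (h0 : p 0) (hsmul : ∀ (z : ℂ) a, p a → p (z • a)) {k : ℕ}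
    (he : ∀ u, ∀ a ∈ degSub k, p (S.e u a)) {a : ExtForm V} (ha : a ∈ degSub (k + 1)) : p a := by
  have h1 : a = ((k : ℂ) + 1)⁻¹ • ∑ i, S.e (S.c i) (intOp (S.b i) a) := by
    rw [S.sum_e_int, degOp_of_mem ha, smul_smul]
    push_cast
    rw [inv_mul_cancel₀ (by exact_mod_cast k.succ_ne_zero), one_smul]
  rw [h1]
  refine hsmul _ _ (Finset.sum_induction _ p hadd h0 fun i _ => he _ _ (intOp_mem ha _))

/-- An operator which vanishes on `1`, and whose vanishing is preserved by exterior product with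
1-forms, vanishes. -/
theorem end_eq_zero_of_e {X : Module.End ℂ (ExtForm V)} (h1 : X ptOne = 0)
    (h : ∀ u k, ∀ a ∈ degSub k, X a = 0 → X (S.e u a) = 0) : X = 0 := by
  have key : ∀ k, ∀ a ∈ degSub k, X a = 0 := by
    intro k
    induction k with
    | zero =>
      intro a ha
      rw [eq_smul_ptOne ha, map_smul, h1, smul_zero]
    | succ k ih =>
      intro a ha
      refine S.degree_succ_induction (p := fun a => X a = 0) ?_ (map_zero X) ?_
        (fun u a ha => h u k a ha (ih a ha)) ha
      · intro a b ha hb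
        rw [map_add, ha, hb, add_zero]
      · intro z a ha
        rw [map_smul, ha, smul_zero]
  have : FiniteDimensional ℝ V := Module.Finite.of_basis S.b
  refine LinearMap.ext fun a => ?_
  rw [eq_sum_single rfl a, map_sum]
  exact Finset.sum_eq_zero fun k _ => key k _ (single_mem k _)

theorem end_eq_of_e {X Y : Module.End ℂ (ExtForm V)} (h1 : X ptOne = Y ptOne)
    (h : ∀ u k, ∀ a ∈ degSub k, X a = Y a → X (S.e u a) = Y (S.e u a)) (a : ExtForm V) :
    X a = Y a := by
  have := S.end_eq_zero_of_e (X := X - Y) (sub_eq_zero.2 h1) fun u k a ha h0 =>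
    sub_eq_zero.2 (h u k a ha (sub_eq_zero.1 h0))
  exact sub_eq_zero.1 (congrArg (fun Z => Z a) this)

theorem Lam_one : S.Lam ptOne = 0 := by
  rw [Lam_apply, Finset.sum_eq_zero, smul_zero]
  intro i _
  rw [intOp_of_mem_zero ptOne_mem, map_zero]

theorem I_one : S.I ptOne = ptOne := by
  funext k
  rcases k with _ | k
  · rfl
  · rfl

theorem I_Lam (a : ExtForm V) : S.I (S.Lam a) = S.Lam (S.I a) := by
  refine S.end_eq_of_e (X := S.I * S.Lam) (Y := S.Lam * S.I) ?_ (fun u k a _ h => ?_) a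
  · simp [Module.End.mul_apply, I_one, Lam_one]
  · simp only [Module.End.mul_apply] at h ⊢
    rw [S.Lam_e, map_add, S.I_e, h, S.I_int, S.J_J, S.I_e, map_neg, S.Lam_e, S.J_J, intOp_neg]
    abel

theorem Lam_mem {k : ℕ} {a : ExtForm V} (ha : a ∈ degSub (k + 2)) : S.Lam a ∈ degSub k := by
  rw [Lam_apply]
  exact Submodule.smul_mem _ _ (Submodule.sum_mem _ fun i _ => intOp_mem (intOp_mem ha _) _)

theorem Lam_eq_zero {k : ℕ} (hk : k < 2) {a : ExtForm V} (ha : a ∈ degSub k) : S.Lam a = 0 := by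
  rw [Lam_apply, Finset.sum_eq_zero, smul_zero]
  intro i _
  obtain rfl | rfl : k = 0 ∨ k = 1 := by omega
  · rw [intOp_of_mem_zero ha, map_zero]
  · exact intOp_of_mem_zero (intOp_mem ha _) _

theorem finrank_eq (S : HermitianSpace n V) : Module.finrank ℝ V = 2 * n := by
  rw [Module.finrank_eq_card_basis S.b, Fintype.card_fin]

theorem apply_eq_zero (S : HermitianSpace n V) {k : ℕ} (hk : 2 * n < k) (a : V [⋀^Fin k]→L[ℝ] ℂ) : a = 0 := by
  have : FiniteDimensional ℝ V := Module.Finite.of_basis S.b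
  exact eq_zero_of_finrank_lt (by rwa [S.finrank_eq]) a

/-- The exterior algebra of a Hermitian vector space, as a Lefschetz module. -/
def lefschetz : LefschetzModule n (ExtForm V) where
  deg := degSub
  L := S.L
  Lam := S.Lam
  L_mem _ _ ha := lefOp_mem ha _
  Lam_mem _ _ ha := S.Lam_mem ha
  Lam_zero _ hk _ ha := S.Lam_eq_zero hk ha
  deg_eq_zero k hk a ha := by
    funext m
    by_cases hm : m = k
    · subst hm
      exact S.apply_eq_zero hk _
    · exact ha m hm
  comm k a ha := by
    rw [S.Lam_L, degOp_of_mem ha]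
    module

end HermitianSpace

end Hermitian

end AlmostHermitian
end

noncomputable section

namespace AlmostHermitian

/-! ### The Hodge star of a Hermitian vector space -/

section Star

attribute [local instance] smulFormDegree smulExtForm

variable {V : Type*} [AddCommGroup V] [Module ℝ V] [TopologicalSpace V]

theorem contractAll_sum (us : List V) {ι : Type*} (s : Finset ι) (z : ι → ℂ)
    (w : ι → ExtForm V) :
    contractAll us (∑ i ∈ s, z i • w i) = ∑ i ∈ s, z i • contractAll us (w i) := by
  induction us generalizing w with
  | nil => rfl
  | cons u us ih =>
    have h : contract u (∑ i ∈ s, z i • w i) = ∑ i ∈ s, z i • contract u (w i) := by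
      have := map_sum (intOp u) (fun i => z i • w i) s
      simp only [map_smul] at this
      exact this
    change contractAll us (contract u _) = _
    rw [h, ih]
    rfl

theorem contractAll_intOp (us : List V) (u : V) (w : ExtForm V) :
    contractAll us (intOp u w) = (-1 : ℂ) ^ us.length • intOp u (contractAll us w) := by
  induction us generalizing w with
  | nil => exact (one_smul _ _).symm
  | cons v us ih =>
    change contractAll us (intOp v (intOp u w)) = _ • intOp u (contractAll us (intOp v w))
    rw [intOp_intOp, ← neg_one_smul ℂ (intOp u _)]
    have := contractAll_sum us {()} (fun _ => -1) (fun _ => intOp u (intOp v w))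
    simp only [Finset.sum_singleton] at this
    rw [this, ih, smul_smul, List.length_cons, pow_succ']

theorem contractAll_mem (us : List V) {m : ℕ} {w : ExtForm V} (hw : w ∈ degSub (m + us.length)) :
    contractAll us w ∈ degSub m := by
  induction us generalizing w with
  | nil => exact hw
  | cons v us ih => exact ih (intOp_mem hw v)

namespace HermitianSpace

variable {n : ℕ} (S : HermitianSpace n V)

/-- The contribution of the component of degree `k` to the Hodge star for the volume form `w`. -/
def starK (k : ℕ) (w : ExtForm V) : Module.End ℂ (ExtForm V) where
  toFun a := ((k ! : ℂ))⁻¹ • ∑ i : Fin k → Fin (2 * n), ∑ j : Fin k → Fin (2 * n),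
    (((∏ l, S.gram⁻¹ (i l) (j l) : ℝ) : ℂ) * a k (fun l => S.b (i l))) •
      contractAll (List.ofFn fun l => S.b (j l)) w
  map_add' a a' := by
    simp only [Pi.add_apply, ContinuousAlternatingMap.add_apply, mul_add, add_smul,
      Finset.sum_add_distrib, smul_add]
  map_smul' z a := by
    simp only [Pi.smul_apply, ContinuousAlternatingMap.smul_apply, smul_eq_mul,
      mul_left_comm _ z, RingHom.id_apply, mul_smul z, ← Finset.smul_sum]
    rw [smul_comm]

theorem starK_apply (k : ℕ) (w a : ExtForm V) :
    S.starK k w a = ((k ! : ℂ))⁻¹ • ∑ i : Fin k → Fin (2 * n), ∑ j : Fin k → Fin (2 * n),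
      (((∏ l, S.gram⁻¹ (i l) (j l) : ℝ) : ℂ) * a k (fun l => S.b (i l))) •
        contractAll (List.ofFn fun l => S.b (j l)) w := rfl

theorem starK_congr {k : ℕ} (w : ExtForm V) {a a' : ExtForm V} (h : a k = a' k) :
    S.starK k w a = S.starK k w a' := by
  rw [starK_apply, starK_apply, h]

theorem starK_zero (w a : ExtForm V) : S.starK 0 w a = a 0 0 • w := by
  rw [starK_apply, Fintype.sum_unique, Fintype.sum_unique]
  simp only [Nat.factorial_zero, Nat.cast_one, inv_one, one_smul, Finset.univ_eq_empty,
    Finset.prod_empty, Complex.ofReal_one, one_mul, List.ofFn_zero]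
  rw [Subsingleton.elim (fun l : Fin 0 => _) (0 : Fin 0 → V)]
  rfl

/-- Splits off the first pair of indices; the inverse Gram matrix turns the second basis vector into
a reciprocal one. The volume form is a free argument because the recursion contracts it. -/
theorem starK_succ (k : ℕ) (w a : ExtForm V) :
    S.starK (k + 1) w a =
      ((k : ℂ) + 1)⁻¹ • ∑ s, S.starK k (intOp (S.c s) w) (intOp (S.b s) a) := by
  have h1 : ∀ (s : Fin (2 * n)) (j : Fin k → Fin (2 * n)),
      contractAll (List.ofFn fun l => S.b (j l)) (intOp (S.c s) w) = ∑ t, (S.gram⁻¹ s t : ℂ) •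
        contractAll (List.ofFn fun l => S.b (j l)) (intOp (S.b t) w) := by
    intro s j
    rw [c, intOp_sum, contractAll_sum]
  have h2 : ∀ F : (Fin (k + 1) → Fin (2 * n)) → ExtForm V, ∑ i, F i =
      ∑ s : Fin (2 * n), ∑ i : Fin k → Fin (2 * n), F (Fin.cons s i) := by
    intro F
    rw [← (Fin.consEquiv fun _ : Fin (k + 1) => Fin (2 * n)).sum_comp, Fintype.sum_prod_type]
    rfl
  have h3 : ∀ (s : Fin (2 * n)) (i : Fin k → Fin (2 * n)),
      a (k + 1) (fun l => S.b ((Fin.cons s i : Fin (k + 1) → Fin (2 * n)) l)) =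
        intOp (S.b s) a k (fun l => S.b (i l)) := by
    intro s i
    rw [intOp_apply, ctr_apply]
    congr 1
    funext l
    refine Fin.cases ?_ (fun l => ?_) l <;> simp
  have h4 : ∀ (t : Fin (2 * n)) (j : Fin k → Fin (2 * n)),
      contractAll (List.ofFn fun l => S.b ((Fin.cons t j : Fin (k + 1) → Fin (2 * n)) l)) w =
        contractAll (List.ofFn fun l => S.b (j l)) (intOp (S.b t) w) := by
    intro t j
    rw [List.ofFn_succ]
    rfl
  rw [starK_apply, h2, Nat.factorial_succ]
  simp only [starK_apply, h1]
  rw [← Finset.smul_sum, smul_smul]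
  congr 1
  · push_cast
    rw [mul_inv]
  · refine Finset.sum_congr rfl fun s _ => Finset.sum_congr rfl fun i _ => ?_
    rw [h2, Finset.sum_comm]
    refine Finset.sum_congr rfl fun j _ => ?_
    rw [Finset.smul_sum]
    refine Finset.sum_congr rfl fun t _ => ?_
    rw [h3, h4, Fin.prod_univ_succ, smul_smul]
    simp only [Fin.cons_zero, Fin.cons_succ]
    congr 1
    push_cast
    ring

theorem starK_intOp (k : ℕ) (u : V) (w a : ExtForm V) :
    S.starK k (intOp u w) a = (-1 : ℂ) ^ k • intOp u (S.starK k w a) := by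
  rw [starK_apply, starK_apply, map_smul, smul_comm]
  congr 1
  rw [map_sum, Finset.smul_sum]
  refine Finset.sum_congr rfl fun i _ => ?_
  rw [map_sum, Finset.smul_sum]
  refine Finset.sum_congr rfl fun j _ => ?_
  rw [contractAll_intOp, map_smul, smul_comm, List.length_ofFn]

theorem starK_zero_e (w : ExtForm V) (u : V) (a : ExtForm V) : S.starK 0 w (S.e u a) = 0 := by
  rw [starK_zero, e_zero]
  exact zero_smul ℂ w

theorem sum_g_b_intOp_c (u : V) (w : ExtForm V) :
    ∑ s, (S.g u (S.b s) : ℂ) • intOp (S.c s) w = intOp u w := by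
  conv_rhs => rw [← S.sum_g_b_c u, intOp_sum]
  exact Finset.sum_congr rfl fun s _ => by rw [S.symm]

/-- In the inductive step the pairing of u with the basis gives one copy of the right side and the
induction hypothesis k + 1 more; together they cancel the factor 1/(k+2). -/
theorem starK_succ_e (k : ℕ) (w : ExtForm V) (u : V) (a : ExtForm V) :
    S.starK (k + 1) w (S.e u a) = (-1 : ℂ) ^ k • intOp u (S.starK k w a) := by
  induction k generalizing w a with
  | zero =>
    have h : ∀ s, S.starK 0 (intOp (S.c s) w) (intOp (S.b s) (S.e u a)) =
        a 0 0 • (S.g u (S.b s) : ℂ) • intOp (S.c s) w := by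
      intro s
      rw [S.int_e, map_sub, starK_zero_e, sub_zero, map_smul, starK_zero, smul_comm]
    rw [starK_succ, Finset.sum_congr rfl fun s _ => h s, ← Finset.smul_sum, S.sum_g_b_intOp_c,
      starK_zero, map_smul]
    simp
  | succ k ih =>
    have h : ∀ s, S.starK (k + 1) (intOp (S.c s) w) (intOp (S.b s) (S.e u a)) =
        (-1 : ℂ) ^ (k + 1) • ((S.g u (S.b s) : ℂ) • intOp (S.c s) (S.starK (k + 1) w a) +
          intOp u (S.starK k (intOp (S.c s) w) (intOp (S.b s) a))) := by
      intro s
      rw [S.int_e, map_sub, map_smul, starK_intOp, ih, pow_succ]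
      module
    have h2 := congrArg (fun x => ((k : ℂ) + 1) • x) (S.starK_succ k w a)
    simp only [smul_smul] at h2
    rw [mul_inv_cancel₀ (by exact_mod_cast k.succ_ne_zero), one_smul] at h2
    rw [starK_succ, Finset.sum_congr rfl fun s _ => h s, ← Finset.smul_sum,
      Finset.sum_add_distrib, S.sum_g_b_intOp_c, ← map_sum, ← h2, map_smul,
      show ∀ x : ExtForm V, x + ((k : ℂ) + 1) • x = ((k + 1 : ℕ) + 1 : ℂ) • x from
        fun x => by push_cast; module, smul_comm, inv_smul_smul₀ (by
          exact_mod_cast (k + 1).succ_ne_zero)]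

theorem starK_mem {k m : ℕ} {w : ExtForm V} (hw : w ∈ degSub (m + k)) (a : ExtForm V) :
    S.starK k w a ∈ degSub m := by
  rw [starK_apply]
  refine Submodule.smul_mem _ _ (Submodule.sum_mem _ fun i _ => Submodule.sum_mem _ fun j _ =>
    Submodule.smul_mem _ _ (contractAll_mem _ ?_))
  rwa [List.length_ofFn]

/-- The volume form. -/
def vol : ExtForm V := ((n ! : ℂ))⁻¹ • (S.L ^ n) ptOne

theorem L_pow_mem {k : ℕ} {a : ExtForm V} (ha : a ∈ degSub k) (j : ℕ) :
    (S.L ^ j) a ∈ degSub (k + 2 * j) := S.lefschetz.L_pow_mem ha j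

theorem vol_mem : S.vol ∈ degSub (2 * n) := by
  have := S.L_pow_mem ptOne_mem n
  rw [zero_add] at this
  exact Submodule.smul_mem _ _ this

/-- The Hodge star. -/
def star : Module.End ℂ (ExtForm V) := ∑ k ∈ Finset.range (2 * n + 1), S.starK k S.vol

theorem star_apply (a : ExtForm V) :
    S.star a = ∑ k ∈ Finset.range (2 * n + 1), S.starK k S.vol a := by
  simp [star]

theorem star_of_mem {k : ℕ} (hk : k ≤ 2 * n) {a : ExtForm V} (ha : a ∈ degSub k) :
    S.star a = S.starK k S.vol a := by
  rw [star_apply, Finset.sum_eq_single k]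
  · intro m _ hm
    rw [S.starK_congr (a' := 0) _ (ha m hm), map_zero]
  · intro h
    exact absurd (Finset.mem_range.2 (by omega)) h

theorem star_mem {k m : ℕ} (hkm : m + k = 2 * n) {a : ExtForm V} (ha : a ∈ degSub k) :
    S.star a ∈ degSub m := by
  rw [S.star_of_mem (by omega) ha]
  exact S.starK_mem (by rw [hkm]; exact S.vol_mem) a

theorem star_one : S.star ptOne = S.vol := by
  rw [S.star_of_mem (Nat.zero_le _) ptOne_mem, starK_zero]
  exact one_smul _ _

/-- With ⋆1 = vol this rule determines the Hodge star; the formula in a basis is not needed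
afterwards. -/
theorem star_e (u : V) (a : ExtForm V) : S.star (S.e u a) = intOp u (S.star (parOp a)) := by
  have h1 : ∀ k, intOp u (S.starK k S.vol (parOp a)) = S.starK (k + 1) S.vol (S.e u a) := by
    intro k
    rw [starK_succ_e, S.starK_congr (a' := (-1 : ℂ) ^ k • a) _ (parOp_apply a k), map_smul,
      map_smul]
  -- The shift of the index by one produces a term of degree 2n + 1, where all forms vanish.
  have h2 : S.starK (2 * n + 1) S.vol (S.e u a) = 0 := by
    rw [S.starK_congr (a' := 0) _ (S.apply_eq_zero (by omega) _), map_zero]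
  rw [star_apply, star_apply, map_sum, Finset.sum_congr rfl fun k _ => h1 k, Finset.sum_range_succ',
    starK_zero_e, add_zero, Finset.sum_range_succ, h2, add_zero]

theorem par_L (a : ExtForm V) : parOp (S.L a) = S.L (parOp a) := by
  rw [S.L_eq, S.L_eq, map_smul, map_sum]
  simp only [S.par_e, map_neg, neg_neg]

theorem par_Lam (a : ExtForm V) : parOp (S.Lam a) = S.Lam (parOp a) := by
  rw [S.Lam_apply, S.Lam_apply, map_smul, map_sum]
  simp only [parOp_intOp, map_neg, neg_neg]

theorem par_I (a : ExtForm V) : parOp (S.I a) = S.I (parOp a) := rfl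

theorem par_mem {k : ℕ} {a : ExtForm V} (ha : a ∈ degSub k) : parOp a ∈ degSub k := by
  rw [parOp_of_mem ha]
  exact Submodule.smul_mem _ _ ha

theorem par_vol : parOp S.vol = S.vol := by
  rw [parOp_of_mem S.vol_mem]
  simp

theorem par_one : parOp (ptOne : ExtForm V) = ptOne := by
  rw [parOp_of_mem ptOne_mem]
  simp

theorem map_par_of_mem {X Y : Module.End ℂ (ExtForm V)} {k : ℕ} {a : ExtForm V}
    (ha : a ∈ degSub k) (h : X a = Y a) : X (parOp a) = Y (parOp a) := by
  rw [parOp_of_mem ha, map_smul, map_smul, h]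

theorem star_par (a : ExtForm V) : S.star (parOp a) = parOp (S.star a) := by
  refine S.end_eq_of_e (X := S.star * parOp) (Y := parOp * S.star) ?_ (fun u k a ha h => ?_) a
  · simp only [Module.End.mul_apply, par_one, star_one, par_vol]
  · have h' := map_par_of_mem ha h
    simp only [Module.End.mul_apply, parOp_parOp] at h'
    simp only [Module.End.mul_apply]
    rw [S.par_e, map_neg, S.star_e, S.star_e, parOp_intOp, parOp_parOp, ← h']

theorem e_mem {k : ℕ} {a : ExtForm V} (ha : a ∈ degSub k) (u : V) : S.e u a ∈ degSub (k + 1) :=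
  fun m hm => by
    rcases m with _ | m
    · rfl
    · rw [e, covOp_succ, ha m (by omega), wedge_zero]

theorem eq_zero_of_mem (S : HermitianSpace n V) {k : ℕ} (hk : 2 * n < k) {a : ExtForm V} (ha : a ∈ degSub k) : a = 0 :=
  S.lefschetz.deg_eq_zero k hk a ha

/-- Induction over products with 1-forms. At a = 1 both sides vanish: the right one because u ∧ vol
has degree 2n + 1. -/
theorem star_int (u : V) (a : ExtForm V) :
    S.star (intOp u a) = -S.e u (S.star (parOp a)) := by
  refine S.end_eq_of_e (X := S.star * intOp u) (Y := -(S.e u * S.star * parOp)) ?_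
    (fun v k a ha h => ?_) a
  · simp only [Module.End.mul_apply, LinearMap.neg_apply]
    rw [intOp_of_mem_zero ptOne_mem, map_zero, par_one, star_one,
      S.eq_zero_of_mem (Nat.lt_succ_self _) (S.e_mem S.vol_mem u), neg_zero]
  · have h' := map_par_of_mem ha h
    simp only [Module.End.mul_apply, LinearMap.neg_apply, parOp_parOp] at h' ⊢
    rw [S.int_e, map_sub, map_smul, S.star_e, parOp_intOp, map_neg, map_neg, h', S.par_e, map_neg,
      map_neg, map_neg, S.star_e, parOp_parOp, neg_neg, neg_neg, S.int_e, S.symm u v]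
    abel

theorem star_L (a : ExtForm V) : S.star (S.L a) = S.Lam (S.star a) := by
  rw [S.L_eq, map_smul, map_sum, S.Lam_apply]
  congr 1
  refine Finset.sum_congr rfl fun i _ => ?_
  rw [S.star_e, S.par_e, map_neg, map_neg, S.star_e, parOp_parOp, intOp_intOp, neg_neg]

theorem star_L_pow (j : ℕ) (a : ExtForm V) : S.star ((S.L ^ j) a) = (S.Lam ^ j) (S.star a) := by
  induction j with
  | zero => rfl
  | succ j ih => rw [pow_succ', pow_succ', Module.End.mul_apply, Module.End.mul_apply, star_L, ih]

/-- Primitive forms. -/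
abbrev prim (k : ℕ) : Submodule ℂ (ExtForm V) := S.lefschetz.prim k

theorem Lam_pow_L_pow_sub {k j N : ℕ} (hN : k + N = n) (hj : j ≤ N) {a : ExtForm V}
    (ha : a ∈ S.prim k) :
    (S.Lam ^ j) ((S.L ^ N) a) = ((j ! * N ! : ℂ) / ((N - j) ! : ℂ)) • (S.L ^ (N - j)) a := by
  induction j with
  | zero =>
    have : ((N ! : ℕ) : ℂ) ≠ 0 := by exact_mod_cast N.factorial_ne_zero
    simp [this]
  | succ j ih =>
    obtain ⟨M, rfl⟩ : ∃ M, N = M + (j + 1) := ⟨N - (j + 1), by omega⟩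
    rw [pow_succ', Module.End.mul_apply, ih (by omega), map_smul,
      show M + (j + 1) - j = M + 1 by omega, Nat.add_sub_cancel]
    have h := S.lefschetz.Lam_L_pow ha M
    change S.Lam ((S.L ^ (M + 1)) a) = _ • (S.L ^ M) a at h
    rw [h, smul_smul]
    congr 1
    have h1 : ((M ! : ℕ) : ℂ) ≠ 0 := by exact_mod_cast M.factorial_ne_zero
    have h2 : ((M + 1 : ℕ) : ℂ) ≠ 0 := by exact_mod_cast M.succ_ne_zero
    rw [← hN, Nat.factorial_succ M, Nat.factorial_succ j]
    push_cast at h2 ⊢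
    field_simp
    ring

theorem one_mem_prim : ptOne ∈ S.prim 0 := S.lefschetz.mem_prim.2 ⟨ptOne_mem, S.Lam_one⟩

/-- Since ⋆ L^n 1 = Λ^n ⋆ 1 = Λ^n vol, the claim is Λ^n L^n 1 = (n!)². -/
theorem star_vol : S.star S.vol = ptOne := by
  have h := S.Lam_pow_L_pow_sub (Nat.zero_add n) le_rfl S.one_mem_prim
  have h1 : ((n ! : ℕ) : ℂ) ≠ 0 := by exact_mod_cast n.factorial_ne_zero
  rw [vol, map_smul, star_L_pow, star_one, vol, map_smul, h, smul_smul, smul_smul,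
    Nat.sub_self, pow_zero, Module.End.one_apply]
  have h2 : (n ! : ℂ)⁻¹ * (n ! : ℂ)⁻¹ * ((n ! : ℂ) * (n ! : ℂ) / (0 ! : ℂ)) = 1 := by
    rw [Nat.factorial_zero]
    field_simp
    simp
  rw [h2, one_smul]

theorem star_star (a : ExtForm V) : S.star (S.star a) = parOp a := by
  refine S.end_eq_of_e (X := S.star * S.star) (Y := parOp) ?_ (fun u k a ha h => ?_) a
  · simp only [Module.End.mul_apply, star_one, star_vol, par_one]
  · simp only [Module.End.mul_apply] at h ⊢
    rw [S.star_e, S.star_int, ← S.star_par, parOp_parOp, h, S.par_e]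

/-- Identifies the operator ⋆⁻¹ L ⋆ of the theorem with the contraction operator. -/
theorem star_par_L_star (a : ExtForm V) : S.star (parOp (S.L (S.star a))) = S.Lam a := by
  rw [S.par_L, S.star_L, S.star_par, S.star_star, parOp_parOp]

theorem I_L_pow (j : ℕ) (a : ExtForm V) : S.I ((S.L ^ j) a) = (S.L ^ j) (S.I a) := by
  induction j with
  | zero => rfl
  | succ j ih => rw [pow_succ', Module.End.mul_apply, Module.End.mul_apply, I_L, ih]

theorem I_star (a : ExtForm V) : S.I (S.star a) = S.star (S.I a) := by
  refine S.end_eq_of_e (X := S.I * S.star) (Y := S.star * S.I) ?_ (fun u k a ha h => ?_) a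
  · simp only [Module.End.mul_apply, I_one, star_one, vol, map_smul, I_L_pow]
  · have h' := map_par_of_mem ha h
    simp only [Module.End.mul_apply] at h' ⊢
    rw [S.star_e, S.I_int, h', S.I_e, map_neg, S.star_e, S.par_I]

end HermitianSpace

end Star

end AlmostHermitian
end

noncomputable section

namespace AlmostHermitian

/-! ### Weil's formula for the Hodge star of primitive forms -/

section Weil

attribute [local instance] smulFormDegree smulExtForm

variable {V : Type*} [AddCommGroup V] [Module ℝ V] [TopologicalSpace V]

/-- The sign `(-1) ^ (k (k + 1) / 2)`. -/
def weilSign (k : ℕ) : ℂ := (-1) ^ (k * (k + 1) / 2)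

theorem weilSign_succ (k : ℕ) : weilSign (k + 1) = (-1) ^ (k + 1) * weilSign k := by
  rw [weilSign, weilSign, ← pow_add,
    show (k + 1) * (k + 1 + 1) = k * (k + 1) + (k + 1) * 2 by ring,
    Nat.add_mul_div_right _ _ (by norm_num), add_comm]

theorem weilSign_mul_self (k : ℕ) : weilSign k * weilSign k = 1 := by
  rw [weilSign, ← mul_pow]
  simp

/-- The operator `(-1) ^ (k (k + 1) / 2)` on forms of degree `k`. -/
def weilOp : Module.End ℂ (ExtForm V) where
  toFun a k := weilSign k • a k
  map_add' _ _ := funext fun _ => smul_add _ _ _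
  map_smul' c a := funext fun k => smul_comm (α := V [⋀^Fin k]→L[ℝ] ℂ) _ c (a k)

theorem weilOp_apply (a : ExtForm V) (k : ℕ) : (weilOp a : ExtForm V) k = weilSign k • a k := rfl

theorem weilOp_of_mem {k : ℕ} {a : ExtForm V} (ha : a ∈ degSub k) :
    weilOp a = weilSign k • a := by
  funext m
  by_cases hm : m = k
  · subst hm
    exact weilOp_apply a m
  · rw [weilOp_apply, Pi.smul_apply, ha m hm]
    exact (smul_zero (A := V [⋀^Fin m]→L[ℝ] ℂ) _).trans
      (smul_zero (M := ℂ) (A := V [⋀^Fin m]→L[ℝ] ℂ) _).symm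

theorem weilOp_intOp (u : V) (a : ExtForm V) :
    weilOp (intOp u a) = intOp u (weilOp (parOp a)) := by
  funext k
  ext v
  simp only [weilOp_apply, intOp_apply, ctr_apply, parOp_apply, weilSign_succ,
    ContinuousAlternatingMap.smul_apply, smul_eq_mul]
  linear_combination (-(weilSign k * (a (k + 1)) (Fin.cons u v))) *
    ((mul_pow (-1 : ℂ) (-1) (k + 1)).symm.trans (by norm_num) :
      (-1 : ℂ) ^ (k + 1) * (-1) ^ (k + 1) = 1)

namespace HermitianSpace

variable {n : ℕ} (S : HermitianSpace n V)

theorem weilOp_e (u : V) (a : ExtForm V) : weilOp (S.e u a) = -S.e u (weilOp (parOp a)) := by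
  funext k
  rcases k with _ | k
  · rw [weilOp_apply, e_zero]
    exact (smul_zero (A := V [⋀^Fin 0]→L[ℝ] ℂ) _).trans (neg_zero).symm
  · rw [weilOp_apply, e, Pi.neg_apply, covOp_succ, covOp_succ, weilOp_apply, parOp_apply,
      wedge_smul, wedge_smul, weilSign_succ, pow_succ]
    module

theorem L_pow_apply_eq_zero (j : ℕ) (a : ExtForm V) {m : ℕ} (hm : m < 2 * j) :
    (S.L ^ j) a m = 0 := by
  induction j generalizing m with
  | zero => omega
  | succ j ih =>
    rw [pow_succ', Module.End.mul_apply]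
    rcases m with _ | _ | m
    · rfl
    · rfl
    · rw [L, lefOp_add_two]
      change wedge _ _ ((S.L ^ j) a m) = 0
      rw [ih (by omega), wedge_zero]

theorem L_pow_succ_eq_zero : S.L ^ (n + 1) = 0 := by
  refine LinearMap.ext fun a => funext fun m => ?_
  by_cases hm : m < 2 * (n + 1)
  · exact S.L_pow_apply_eq_zero _ a hm
  · exact S.apply_eq_zero (by omega) _

theorem Lam_pow_apply_eq_zero (j : ℕ) (a : ExtForm V) {m : ℕ} (hm : 2 * n < m + 2 * j) :
    (S.Lam ^ j) a m = 0 := by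
  induction j generalizing m with
  | zero => exact S.apply_eq_zero (by omega) _
  | succ j ih =>
    rw [pow_succ', Module.End.mul_apply, Lam_apply]
    have h : ∀ i, intOp (S.J (S.c i)) (intOp (S.b i) ((S.Lam ^ j) a)) m = 0 := by
      intro i
      rw [intOp_apply, intOp_apply, ih (by omega)]
      rfl
    rw [Pi.smul_apply, Finset.sum_apply, Finset.sum_eq_zero fun i _ => h i]
    exact smul_zero (A := V [⋀^Fin m]→L[ℝ] ℂ) (1 / 2 : ℂ)

theorem Lam_pow_succ_eq_zero : S.Lam ^ (n + 1) = 0 :=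
  LinearMap.ext fun a => funext fun _ => S.Lam_pow_apply_eq_zero _ a (by omega)

/-! ### Exponentials of L and Λ, and Weil's formula -/

theorem int_L_pow (u : V) (j : ℕ) (a : ExtForm V) :
    intOp u ((S.L ^ (j + 1)) a) =
      (S.L ^ (j + 1)) (intOp u a) + ((j : ℂ) + 1) • (S.L ^ j) (S.e (S.J u) a) := by
  induction j with
  | zero => simp [S.int_L]
  | succ j ih =>
    have h : ∀ k b, S.e (S.J u) ((S.L ^ k) b) = (S.L ^ k) (S.e (S.J u) b) := by
      intro k b
      induction k with
      | zero => rfl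
      | succ k ih => rw [pow_succ', Module.End.mul_apply, ← L_e, ih]; rfl
    have h1 : ∀ i b, S.L ((S.L ^ i) b) = (S.L ^ (i + 1)) b := fun i b => by
      rw [pow_succ', Module.End.mul_apply]
    rw [← h1, S.int_L, ih, map_add, map_smul, h, h1, h1]
    push_cast
    module

theorem Lam_pow_e (u : V) (j : ℕ) (a : ExtForm V) :
    (S.Lam ^ (j + 1)) (S.e u a) =
      S.e u ((S.Lam ^ (j + 1)) a) + ((j : ℂ) + 1) • intOp (S.J u) ((S.Lam ^ j) a) := by
  induction j with
  | zero => simp [S.Lam_e]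
  | succ j ih =>
    have h1 : ∀ i b, S.Lam ((S.Lam ^ i) b) = (S.Lam ^ (i + 1)) b := fun i b => by
      rw [pow_succ', Module.End.mul_apply]
    rw [← h1, ih, map_add, map_smul, S.Lam_e, S.Lam_int, h1, h1]
    push_cast
    module

/-- The exponential of `L`. -/
def expL : Module.End ℂ (ExtForm V) := ∑ j ∈ Finset.range (n + 2), ((j ! : ℂ))⁻¹ • S.L ^ j

/-- The exponential of `Λ`. -/
def expLam : Module.End ℂ (ExtForm V) := ∑ j ∈ Finset.range (n + 2), ((j ! : ℂ))⁻¹ • S.Lam ^ j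

theorem expL_apply (a : ExtForm V) :
    S.expL a = ∑ j ∈ Finset.range (n + 2), ((j ! : ℂ))⁻¹ • (S.L ^ j) a := by simp [expL]

theorem expLam_apply (a : ExtForm V) :
    S.expLam a = ∑ j ∈ Finset.range (n + 2), ((j ! : ℂ))⁻¹ • (S.Lam ^ j) a := by simp [expLam]

theorem inv_factorial_succ_mul (j : ℕ) : (((j + 1) ! : ℕ) : ℂ)⁻¹ * ((j : ℂ) + 1) = (j ! : ℂ)⁻¹ := by
  have h1 : ((j ! : ℕ) : ℂ) ≠ 0 := by exact_mod_cast j.factorial_ne_zero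
  have h2 : (j : ℂ) + 1 ≠ 0 := by exact_mod_cast j.succ_ne_zero
  rw [Nat.factorial_succ]
  push_cast
  field_simp

theorem int_expL (u : V) (a : ExtForm V) :
    intOp u (S.expL a) = S.expL (intOp u a + S.e (S.J u) a) := by
  have h1 : ∀ j, ((((j + 1) ! : ℕ) : ℂ))⁻¹ • intOp u ((S.L ^ (j + 1)) a) =
      ((((j + 1) ! : ℕ) : ℂ))⁻¹ • (S.L ^ (j + 1)) (intOp u a) +
        ((j ! : ℂ))⁻¹ • (S.L ^ j) (S.e (S.J u) a) := by
    intro j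
    rw [S.int_L_pow, smul_add, smul_smul, inv_factorial_succ_mul]
  rw [map_add, expL_apply, expL_apply, map_sum]
  simp only [map_smul]
  -- The exponential series runs up to j = n + 1, where the term is already zero; the index shift
  -- therefore loses nothing.
  rw [Finset.sum_range_succ', Finset.sum_congr rfl fun j _ => h1 j, Finset.sum_add_distrib,
    expL_apply, Finset.sum_range_succ' _ (n + 1), Finset.sum_range_succ (fun j =>
      ((j ! : ℂ))⁻¹ • (S.L ^ j) (S.e (S.J u) a)) (n + 1), S.L_pow_succ_eq_zero]
  simp only [pow_zero, Module.End.one_apply, LinearMap.zero_apply, smul_zero, add_zero]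
  abel

theorem expLam_e (u : V) (a : ExtForm V) :
    S.expLam (S.e u a) = S.e u (S.expLam a) + intOp (S.J u) (S.expLam a) := by
  have h1 : ∀ j, ((((j + 1) ! : ℕ) : ℂ))⁻¹ • (S.Lam ^ (j + 1)) (S.e u a) =
      S.e u (((((j + 1) ! : ℕ) : ℂ))⁻¹ • (S.Lam ^ (j + 1)) a) +
        intOp (S.J u) (((j ! : ℂ))⁻¹ • (S.Lam ^ j) a) := by
    intro j
    rw [S.Lam_pow_e, smul_add, smul_smul, inv_factorial_succ_mul, map_smul, map_smul]
  rw [expLam_apply, expLam_apply, Finset.sum_range_succ', Finset.sum_congr rfl fun j _ => h1 j,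
    Finset.sum_add_distrib, map_sum, map_sum, Finset.sum_range_succ' _ (n + 1),
    Finset.sum_range_succ (fun j => intOp (S.J u) (((j ! : ℂ))⁻¹ • (S.Lam ^ j) a)) (n + 1),
    S.Lam_pow_succ_eq_zero]
  simp only [pow_zero, Module.End.one_apply, LinearMap.zero_apply, smul_zero, add_zero, map_zero,
    map_smul]
  abel

/-- An operator whose component in degree `2 n - k` on forms of degree `k` is the Hodge star. -/
def weilStar : Module.End ℂ (ExtForm V) := S.expL * weilOp * S.I * S.expLam

theorem weilStar_apply (a : ExtForm V) : S.weilStar a = S.expL (weilOp (S.I (S.expLam a))) := rfl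

theorem par_expLam (a : ExtForm V) : parOp (S.expLam a) = S.expLam (parOp a) := by
  have h : ∀ j, parOp ((S.Lam ^ j) a) = (S.Lam ^ j) (parOp a) := by
    intro j
    induction j with
    | zero => rfl
    | succ j ih => rw [pow_succ', Module.End.mul_apply, par_Lam, ih]; rfl
  rw [expLam_apply, expLam_apply, map_sum]
  simp only [map_smul, h]

/-- The same rule as `star_e`. Conjugation by exp(Λ) turns e_u into e_u + ι_(Ju), 𝕀 turns this into
ι_u - e_(Ju), the Weil sign into ι_u + e_(Ju) up to parity, and exp(L) absorbs the exterior product,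
leaving ι_u. -/
theorem weilStar_e (u : V) (a : ExtForm V) :
    S.weilStar (S.e u a) = intOp u (S.weilStar (parOp a)) := by
  rw [weilStar_apply, weilStar_apply, S.expLam_e, map_add, S.I_e, S.I_int, S.J_J, intOp_neg,
    neg_neg, map_add, map_neg, S.weilOp_e, neg_neg, weilOp_intOp, S.par_I, S.par_expLam,
    S.int_expL, add_comm]

theorem expLam_of_Lam_eq_zero {a : ExtForm V} (ha : S.Lam a = 0) : S.expLam a = a := by
  rw [expLam_apply, Finset.sum_range_succ', Finset.sum_eq_zero]
  · simp
  · intro j _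
    rw [pow_succ, Module.End.mul_apply, ha, map_zero, smul_zero]

theorem expL_apply_of_mem {k j : ℕ} (hj : j < n + 2) {a : ExtForm V} (ha : a ∈ degSub k) :
    S.expL a (k + 2 * j) = (((j ! : ℂ))⁻¹ • (S.L ^ j) a : ExtForm V) (k + 2 * j) := by
  rw [expL_apply, Finset.sum_apply, Finset.sum_eq_single j]
  · intro i _ hij
    have h := S.L_pow_mem ha i (k + 2 * j) (by omega)
    rw [Pi.smul_apply, h]
    exact smul_zero (M := ℂ) (A := V [⋀^Fin (k + 2 * j)]→L[ℝ] ℂ) _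
  · intro h
    exact absurd (Finset.mem_range.2 hj) h

theorem weilStar_of_prim {k : ℕ} {a : ExtForm V} (ha : a ∈ S.prim k) :
    S.weilStar a = weilSign k • S.expL (S.I a) := by
  have h := S.lefschetz.mem_prim.1 ha
  rw [weilStar_apply, S.expLam_of_Lam_eq_zero h.2,
    weilOp_of_mem (show S.I a ∈ degSub k from pullOp_mem _ h.1), map_smul]

/-- Both operators obey one recursion, so it is enough to compare them at 1. There exp(L) 1 has
components in several even degrees, and only the top one equals vol; hence the restriction to degree
2n - k. -/
theorem weilStar_eq_star {k m : ℕ} (hkm : k + m = 2 * n) {a : ExtForm V} (ha : a ∈ degSub k) :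
    S.weilStar a m = S.star a m := by
  induction k generalizing m a with
  | zero =>
    rw [zero_add] at hkm
    subst hkm
    have h := S.expL_apply_of_mem (j := n) (by omega) ptOne_mem
    rw [zero_add] at h
    rw [eq_smul_ptOne ha, map_smul, map_smul, Pi.smul_apply, Pi.smul_apply,
      S.weilStar_of_prim S.one_mem_prim, I_one, star_one, vol, ← h]
    simp [weilSign]
  | succ k ih =>
    refine S.degree_succ_induction (p := fun a => S.weilStar a m = S.star a m) ?_ ?_ ?_ ?_ ha
    · intro a b h1 h2
      rw [map_add, map_add, Pi.add_apply, h1, h2]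
      rfl
    · rw [map_zero, map_zero]
    · intro z a h
      rw [map_smul, map_smul, Pi.smul_apply, h]
      rfl
    · intro u a ha
      rw [weilStar_e, star_e, intOp_apply, intOp_apply, ih (by omega) (par_mem ha)]

theorem I_mem_prim {k : ℕ} {a : ExtForm V} (ha : a ∈ S.prim k) : S.I a ∈ S.prim k := by
  have h := S.lefschetz.mem_prim.1 ha
  refine S.lefschetz.mem_prim.2 ⟨pullOp_mem _ h.1, ?_⟩
  change S.Lam (S.I a) = 0
  rw [← I_Lam]
  exact (congrArg S.I h.2).trans (map_zero _)

/-- On primitive forms exp(Λ) is the identity, and the component of exp(L) that raises the degree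
from k to 2n - k is L^N / N!. -/
theorem star_of_prim {k N : ℕ} (hN : k + N = n) {a : ExtForm V} (ha : a ∈ S.prim k) :
    S.star a = (weilSign k * (N ! : ℂ)⁻¹) • (S.L ^ N) (S.I a) := by
  have h := (S.lefschetz.mem_prim.1 ha).1
  have hI : S.I a ∈ degSub k := pullOp_mem _ h
  funext m
  by_cases hm : m = k + 2 * N
  · subst hm
    rw [← S.weilStar_eq_star (by omega) h, S.weilStar_of_prim ha, Pi.smul_apply,
      S.expL_apply_of_mem (by omega) hI, mul_smul]
    rfl
  · rw [S.star_mem (m := k + 2 * N) (by omega) h m hm,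
      Submodule.smul_mem _ (weilSign k * (N ! : ℂ)⁻¹) (S.L_pow_mem hI N) m hm]

/-- Weil's formula. -/
theorem star_L_pow_of_prim {k j m : ℕ} (hn : k + (j + m) = n) {a : ExtForm V}
    (ha : a ∈ S.prim k) :
    S.star ((S.L ^ j) a) = (weilSign k * ((j ! : ℂ) / (m ! : ℂ))) • (S.L ^ m) (S.I a) := by
  have h1 : (((j + m) ! : ℕ) : ℂ) ≠ 0 := by exact_mod_cast (j + m).factorial_ne_zero
  rw [S.star_L_pow, S.star_of_prim hn ha, map_smul,
    S.Lam_pow_L_pow_sub hn (Nat.le_add_right j m) (S.I_mem_prim ha), smul_smul,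
    Nat.add_sub_cancel_left]
  congr 1
  field_simp

theorem I_I (a : ExtForm V) : S.I (S.I a) = parOp a := by
  funext m
  ext v
  rw [parOp_apply]
  have h := (a m).toAlternatingMap.map_smul_univ (fun _ => (-1 : ℝ)) v
  simp only [neg_smul, one_smul, Finset.prod_const, Finset.card_univ, Fintype.card_fin] at h
  have h2 : S.I (S.I a) m v = a m fun i => -v i := by
    simp [I, pullOp_apply, S.J_J, Function.comp_def]
  rw [h2]
  refine h.trans ?_
  rw [ContinuousAlternatingMap.smul_apply, Complex.real_smul]
  push_cast
  rfl

theorem I_I_of_mem {k : ℕ} {a : ExtForm V} (ha : a ∈ degSub k) :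
    S.I (S.I a) = (-1 : ℂ) ^ k • a := by
  rw [I_I, parOp_of_mem ha]

end HermitianSpace

end Weil

end AlmostHermitian
end

noncomputable section

namespace AlmostHermitian

/-! ### Calculus of forms on a vector space -/

section Calculus

attribute [local instance] smulFormDegree smulExtForm

variable {E : Type*} [NormedAddCommGroup E] [NormedSpace ℝ E]

theorem contDiffOn_eval {k : ℕ} {m : WithTop ℕ∞} {s : Set E} {F : E → E [⋀^Fin k]→L[ℝ] ℂ}
    (h : ContDiffOn ℝ m F s) (v : Fin k → E) : ContDiffOn ℝ m (fun y => F y v) s :=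
  (ContinuousAlternatingMap.apply ℝ E ℂ v).contDiff.comp_contDiffOn h

/-- Evaluation on tuples of basis vectors is an injective linear map to a finite product, hence has
a linear left inverse, continuous in finite dimension. -/
theorem contDiffOn_of_eval [FiniteDimensional ℝ E] {k : ℕ} {m : WithTop ℕ∞} {s : Set E}
    {F : E → E [⋀^Fin k]→L[ℝ] ℂ} (h : ∀ v, ContDiffOn ℝ m (fun y => F y v) s) :
    ContDiffOn ℝ m F s := by
  set b := Module.finBasis ℝ E
  let ev : (E [⋀^Fin k]→L[ℝ] ℂ) →ₗ[ℝ] ((Fin k → Fin (Module.finrank ℝ E)) → ℂ) :=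
    { toFun := fun a i => a fun l => b (i l)
      map_add' := fun _ _ => rfl
      map_smul' := fun _ _ => rfl }
  have hev : LinearMap.ker ev = ⊥ := by
    rw [LinearMap.ker_eq_bot']
    intro a ha
    refine ContinuousAlternatingMap.toAlternatingMap_injective
      (Module.Basis.ext_alternating b fun i _ => ?_)
    exact congrFun ha i
  obtain ⟨r, hr⟩ := ev.exists_leftInverse_of_injective hev
  have h1 : F = fun y => LinearMap.toContinuousLinearMap r (ev (F y)) := by
    funext y
    exact (congrArg (fun f => f (F y)) hr).symm
  rw [h1]
  refine (LinearMap.toContinuousLinearMap r).contDiff.comp_contDiffOn ?_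
  exact contDiffOn_pi.2 fun i => h _

theorem fderiv_eval {k : ℕ} {y : E} {F : E → E [⋀^Fin k]→L[ℝ] ℂ} (h : DifferentiableAt ℝ F y)
    (u : E) (v : Fin k → E) : fderiv ℝ (fun z => F z v) y u = fderiv ℝ F y u v := by
  have := ((ContinuousAlternatingMap.apply ℝ E ℂ v).hasFDerivAt.comp y h.hasFDerivAt).fderiv
  exact congrArg (fun f => f u) this

theorem differentiableAt_eval {k : ℕ} {y : E} {F : E → E [⋀^Fin k]→L[ℝ] ℂ}
    (h : DifferentiableAt ℝ F y) (v : Fin k → E) : DifferentiableAt ℝ (fun z => F z v) y :=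
  (ContinuousAlternatingMap.apply ℝ E ℂ v).differentiableAt.comp y h

theorem contDiffOn_wedge [FiniteDimensional ℝ E] {p q m : ℕ} (h : p + q = m) {r : WithTop ℕ∞}
    {s : Set E} {a : E → E [⋀^Fin p]→L[ℝ] ℂ} {b : E → E [⋀^Fin q]→L[ℝ] ℂ}
    (ha : ContDiffOn ℝ r a s) (hb : ContDiffOn ℝ r b s) :
    ContDiffOn ℝ r (fun y => wedge h (a y) (b y)) s := by
  refine contDiffOn_of_eval fun v => ?_
  simp only [wedge_apply, tensor_apply]
  refine contDiffOn_const.mul (ContDiffOn.sum fun σ _ => ContDiffOn.const_smul _ ?_)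
  exact (contDiffOn_eval ha _).mul (contDiffOn_eval hb _)

theorem differentiableAt_of_eval [FiniteDimensional ℝ E] {k : ℕ} {y : E}
    {F : E → E [⋀^Fin k]→L[ℝ] ℂ} (h : ∀ v, DifferentiableAt ℝ (fun z => F z v) y) :
    DifferentiableAt ℝ F y := by
  set b := Module.finBasis ℝ E
  let ev : (E [⋀^Fin k]→L[ℝ] ℂ) →ₗ[ℝ] ((Fin k → Fin (Module.finrank ℝ E)) → ℂ) :=
    { toFun := fun a i => a fun l => b (i l)
      map_add' := fun _ _ => rfl
      map_smul' := fun _ _ => rfl }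
  have hev : LinearMap.ker ev = ⊥ := by
    rw [LinearMap.ker_eq_bot']
    intro a ha
    refine ContinuousAlternatingMap.toAlternatingMap_injective
      (Module.Basis.ext_alternating b fun i _ => ?_)
    exact congrFun ha i
  obtain ⟨r, hr⟩ := ev.exists_leftInverse_of_injective hev
  have h1 : F = fun y => LinearMap.toContinuousLinearMap r (ev (F y)) := by
    funext y
    exact (congrArg (fun f => f (F y)) hr).symm
  rw [h1]
  refine (LinearMap.toContinuousLinearMap r).differentiableAt.comp y ?_
  exact differentiableAt_pi.2 fun i => h _

theorem fderiv_wedge [FiniteDimensional ℝ E] {p q m : ℕ} (h : p + q = m) {y : E}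
    {a : E → E [⋀^Fin p]→L[ℝ] ℂ} {b : E → E [⋀^Fin q]→L[ℝ] ℂ}
    (ha : DifferentiableAt ℝ a y) (hb : DifferentiableAt ℝ b y) (u : E) :
    fderiv ℝ (fun z => wedge h (a z) (b z)) y u =
      wedge h (fderiv ℝ a y u) (b y) + wedge h (a y) (fderiv ℝ b y u) := by
  have hd : ∀ v : Fin m → E, HasFDerivAt (fun z => wedge h (a z) (b z) v)
      (((p ! : ℂ) * (q ! : ℂ))⁻¹ • ∑ σ : Equiv.Perm (Fin m), (Equiv.Perm.sign σ : ℤ) •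
        (a y (fun i => (v ∘ σ) (Fin.cast h (Fin.castAdd q i))) •
          fderiv ℝ (fun z => b z (fun i => (v ∘ σ) (Fin.cast h (Fin.natAdd p i)))) y +
        b y (fun i => (v ∘ σ) (Fin.cast h (Fin.natAdd p i))) •
          fderiv ℝ (fun z => a z (fun i => (v ∘ σ) (Fin.cast h (Fin.castAdd q i)))) y)) y := by
    intro v
    simp only [wedge_apply, tensor_apply]
    refine HasFDerivAt.const_mul (HasFDerivAt.fun_sum fun σ _ => ?_) _
    refine HasFDerivAt.const_smul (R := ℤ) ?_ _
    exact (differentiableAt_eval ha _).hasFDerivAt.mul (differentiableAt_eval hb _).hasFDerivAt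
  ext v
  rw [← fderiv_eval (differentiableAt_of_eval fun v => (hd v).differentiableAt), (hd v).fderiv]
  rw [ContinuousAlternatingMap.add_apply, wedge_apply, wedge_apply, ← mul_add,
    ← Finset.sum_add_distrib]
  simp only [smul_apply, sum_apply, add_apply, fderiv_eval ha, fderiv_eval hb, tensor_apply,
    smul_eq_mul]
  congr 1
  refine Finset.sum_congr rfl fun σ _ => ?_
  rw [Units.smul_def, Units.smul_def, ← smul_add]
  congr 1
  ring

/-- The directional derivative of a form. -/
def dirDeriv (f : E → ExtForm E) (y u : E) : ExtForm E := fun k => fderiv ℝ (fun z => f z k) y u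

/-- The exterior derivative of a form on a vector space. -/
def extD (f : E → ExtForm E) (y : E) : ExtForm E
  | 0 => 0
  | k + 1 => extDeriv (fun z => f z k) y

/-- The coordinate 1-forms of a basis. -/
def coordForm {N : ℕ} [FiniteDimensional ℝ E] (b : Module.Basis (Fin N) ℝ E) (i : Fin N) :
    E [⋀^Fin 1]→L[ℝ] ℂ :=
  ContinuousAlternatingMap.ofSubsingleton ℝ E ℂ (0 : Fin 1)
    (Complex.ofRealCLM.comp (LinearMap.toContinuousLinearMap (b.coord i)))

variable [FiniteDimensional ℝ E] {N : ℕ} (b : Module.Basis (Fin N) ℝ E)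

/-- The formula d = ∑ dx^i ∧ ∂_i reduces the Leibniz rule for ω ∧ a to the product rule for
directional derivatives. -/
theorem extD_eq (f : E → ExtForm E) (y : E) :
    extD f y = ∑ i, covOp (coordForm b i) (dirDeriv f y (b i)) := by
  funext k
  rw [Finset.sum_apply]
  rcases k with _ | k
  · exact (Finset.sum_eq_zero fun i _ => rfl).symm
  ext v
  rw [ContinuousAlternatingMap.sum_apply]
  simp only [covOp_succ_apply]
  change extDeriv (fun z => f z k) y v = _
  rw [extDeriv, ContinuousAlternatingMap.alternatizeUncurryFin_apply, Finset.sum_comm]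
  refine Finset.sum_congr rfl fun j _ => ?_
  have h1 : fderiv ℝ (fun z => f z k) y (v j) =
      ∑ i, b.repr (v j) i • fderiv ℝ (fun z => f z k) y (b i) := by
    conv_lhs => rw [← b.sum_repr (v j), map_sum]
    simp only [map_smul]
  rw [h1, ContinuousAlternatingMap.sum_apply, Finset.smul_sum]
  refine Finset.sum_congr rfl fun i _ => ?_
  rw [zsmul_eq_mul]
  push_cast
  congr 1

/-- The operator of exterior product with the exterior derivative of a 2-form. -/
def torsionOp (w : E → E [⋀^Fin 2]→L[ℝ] ℂ) (y : E) : Module.End ℂ (ExtForm E) :=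
  ∑ i, covOp (coordForm b i) * lefOp (fderiv ℝ w y (b i))

theorem torsionOp_lefOp (w : E → E [⋀^Fin 2]→L[ℝ] ℂ) (y : E) (w' : E [⋀^Fin 2]→L[ℝ] ℂ)
    (a : ExtForm E) : torsionOp b w y (lefOp w' a) = lefOp w' (torsionOp b w y a) := by
  simp only [torsionOp, LinearMap.sum_apply, Module.End.mul_apply, map_sum, lefOp_lefOp _ w',
    lefOp_covOp]

theorem dirDeriv_lefOp {w : E → E [⋀^Fin 2]→L[ℝ] ℂ} {f : E → ExtForm E} {y : E}
    (hw : DifferentiableAt ℝ w y) (hf : ∀ k, DifferentiableAt ℝ (fun z => f z k) y) (u : E) :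
    dirDeriv (fun z => lefOp (w z) (f z)) y u =
      lefOp (fderiv ℝ w y u) (f y) + lefOp (w y) (dirDeriv f y u) := by
  funext k
  rcases k with _ | _ | k
  · show fderiv ℝ (fun _ : E => (0 : E [⋀^Fin 0]→L[ℝ] ℂ)) y u = 0 + 0
    simp
  · show fderiv ℝ (fun _ : E => (0 : E [⋀^Fin 1]→L[ℝ] ℂ)) y u = 0 + 0
    simp
  · exact fderiv_wedge (Nat.add_comm 2 k) hw (hf k) u

theorem extD_lefOp {w : E → E [⋀^Fin 2]→L[ℝ] ℂ} {f : E → ExtForm E} {y : E}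
    (hw : DifferentiableAt ℝ w y) (hf : ∀ k, DifferentiableAt ℝ (fun z => f z k) y) :
    extD (fun z => lefOp (w z) (f z)) y = torsionOp b w y (f y) + lefOp (w y) (extD f y) := by
  rw [extD_eq b, extD_eq b]
  simp only [dirDeriv_lefOp hw hf, map_add, Finset.sum_add_distrib, torsionOp,
    LinearMap.sum_apply, Module.End.mul_apply, map_sum, lefOp_covOp]

end Calculus

end AlmostHermitian
end

noncomputable section

namespace AlmostHermitian

/-! ### Pointwise description of the operators on forms -/

section PointwiseOperators

attribute [local instance] smulFormDegree smulExtForm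

variable {n : ℕ} {M : Type*} [TopologicalSpace M] [ChartedSpace (Model n) M]
  [IsManifold 𝓘(ℝ, Model n) ∞ M]

namespace AlmostHermitianStructure

variable (S : AlmostHermitianStructure n M)

/-- The Hermitian structure of the tangent space at `x`. -/
def herm (x : M) : HermitianSpace n (Tan n x) where
  g := S.g.inner x
  J := S.J x
  w := S.omega x
  b := tanBasis x
  symm := S.g.symm x
  pos := S.g.pos x
  J_J := S.J_J x
  g_J_J := S.g_J_J x
  w_apply _ := rfl

theorem L_apply (a : Form n M) (x : M) : S.L a x = (S.herm x).L (a x) := rfl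

theorem L_iterate_apply (j : ℕ) (a : Form n M) (x : M) :
    S.L^[j] a x = ((S.herm x).L ^ j) (a x) := by
  induction j with
  | zero => rfl
  | succ j ih => rw [Function.iterate_succ_apply', L_apply, ih, pow_succ', Module.End.mul_apply]

theorem vol_apply (x : M) : S.vol x = (S.herm x).vol := by
  rw [HermitianSpace.vol, Module.End.pow_apply]
  rfl

theorem star_apply (a : Form n M) (x : M) : S.star a x = (S.herm x).star (a x) := by
  rw [HermitianSpace.star_apply, ← vol_apply]
  rfl

theorem I_apply (a : Form n M) (x : M) : S.I a x = (S.herm x).I (a x) := rfl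

theorem Lam_apply (a : Form n M) (x : M) : S.Lam a x = (S.herm x).Lam (a x) := by
  have h : (parOp (S.L (S.star a) x) : ExtForm (Tan n x)) =
      parOp ((S.herm x).L ((S.herm x).star (a x))) := by rw [L_apply, star_apply]
  rw [← HermitianSpace.star_par_L_star, ← h]
  exact S.star_apply (fun x k => (-1 : ℂ) ^ k • S.L (S.star a) x k) x

end AlmostHermitianStructure

end PointwiseOperators

end AlmostHermitian
end

noncomputable section

namespace AlmostHermitian

/-! ### Smoothness of the operators on forms -/

section Smoothness

attribute [local instance] smulFormDegree smulExtForm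

variable {n : ℕ} {M : Type*} [TopologicalSpace M] [ChartedSpace (Model n) M]

/-- The differential at `y` of the inverse of the preferred chart at `x₀`. -/
def chartDiff (x₀ : M) (y : Model n) :
    Model n →L[ℝ] Tan n ((extChartAt 𝓘(ℝ, Model n) x₀).symm y) :=
  mfderiv 𝓘(ℝ, Model n) 𝓘(ℝ, Model n) (extChartAt 𝓘(ℝ, Model n) x₀).symm y

/-- The pull-back of a form by the inverse of the preferred chart at `x₀`. -/
def pulled (a : Form n M) (x₀ : M) (y : Model n) : ExtForm (Model n) :=
  pullOp (chartDiff x₀ y) (a ((extChartAt 𝓘(ℝ, Model n) x₀).symm y))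

theorem chartRep_eq_pulled (a : Form n M) (k : ℕ) (x₀ : M) (y : Model n) :
    chartRep a k x₀ y = pulled a x₀ y k := rfl

variable [IsManifold 𝓘(ℝ, Model n) ∞ M]

theorem contMDiffOn_chartDiff (x₀ : M) (u : Model n) :
    ContMDiffOn 𝓘(ℝ, Model n) (𝓘(ℝ, Model n).prod 𝓘(ℝ, Model n)) ∞
      (fun y => Bundle.TotalSpace.mk' (Model n) (E := fun x : M => Tan n x)
        ((extChartAt 𝓘(ℝ, Model n) x₀).symm y) (chartDiff x₀ y u))
      (extChartAt 𝓘(ℝ, Model n) x₀).target := by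
  have hopen := isOpen_extChartAt_target (I := 𝓘(ℝ, Model n)) x₀
  have h1 := (contMDiffOn_extChartAt_symm (I := 𝓘(ℝ, Model n)) (n := ∞)
    x₀).contMDiffOn_tangentMapWithin (m := ∞) le_rfl hopen.uniqueMDiffOn
  have h2 : ContMDiffOn 𝓘(ℝ, Model n) (𝓘(ℝ, Model n).prod 𝓘(ℝ, Model n)) ∞
      (fun y => Bundle.TotalSpace.mk' (Model n)
        (E := fun y : Model n => TangentSpace 𝓘(ℝ, Model n) y) y u)
      (extChartAt 𝓘(ℝ, Model n) x₀).target := fun y _ =>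
    contMDiffWithinAt_vectorSpace_iff_contDiffWithinAt.2 contDiffWithinAt_const
  refine (h1.comp h2 fun y hy => hy).congr fun y hy => ?_
  have : mfderivWithin 𝓘(ℝ, Model n) 𝓘(ℝ, Model n) (extChartAt 𝓘(ℝ, Model n) x₀).symm
      (extChartAt 𝓘(ℝ, Model n) x₀).target y = chartDiff x₀ y :=
    mfderivWithin_of_mem_nhds (hopen.mem_nhds hy)
  simp only [Function.comp_apply, tangentMapWithin]
  rw [← this]
  rfl

namespace AlmostHermitianStructure

variable (S : AlmostHermitianStructure n M)

theorem contDiffOn_omega (x₀ : M) (u v : Model n) :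
    ContDiffOn ℝ ∞ (fun y => S.g.inner _ (S.J _ (chartDiff x₀ y u)) (chartDiff x₀ y v))
      (extChartAt 𝓘(ℝ, Model n) x₀).target := by
  intro y hy
  have hb := contMDiffOn_extChartAt_symm (I := 𝓘(ℝ, Model n)) (n := ∞) x₀ y hy
  have hu := contMDiffOn_chartDiff x₀ u y hy
  have hv := contMDiffOn_chartDiff x₀ v y hy
  have hJ := ContMDiffAt.comp_contMDiffWithinAt y S.contMDiff_J.contMDiffAt hb
  have hg := ContMDiffAt.comp_contMDiffWithinAt y S.g.contMDiff.contMDiffAt hb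
  have hJu := ContMDiffWithinAt.clm_bundle_apply hJ hu
  have : ContMDiffWithinAt 𝓘(ℝ, Model n) (𝓘(ℝ, Model n).prod 𝓘(ℝ)) ∞
      (fun y => Bundle.TotalSpace.mk' ℝ (E := Bundle.Trivial M ℝ)
        ((extChartAt 𝓘(ℝ, Model n) x₀).symm y)
        (S.g.inner _ (S.J _ (chartDiff x₀ y u)) (chartDiff x₀ y v)))
      (extChartAt 𝓘(ℝ, Model n) x₀).target y :=
    ContMDiffWithinAt.clm_bundle_apply₂ (F₁ := Model n) (F₂ := Model n) hg hJu hv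
  rw [Bundle.contMDiffWithinAt_totalSpace] at this
  exact this.2.contDiffWithinAt

/-- The fundamental form in the preferred chart at `x₀`. -/
def chartOmega (x₀ : M) (y : Model n) : Model n [⋀^Fin 2]→L[ℝ] ℂ :=
  (S.omega ((extChartAt 𝓘(ℝ, Model n) x₀).symm y)).compContinuousLinearMap (chartDiff x₀ y)

theorem contDiffOn_chartOmega (x₀ : M) :
    ContDiffOn ℝ ∞ (S.chartOmega x₀) (extChartAt 𝓘(ℝ, Model n) x₀).target :=
  contDiffOn_of_eval fun v =>
    Complex.ofRealCLM.contDiff.comp_contDiffOn (S.contDiffOn_omega x₀ (v 0) (v 1))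

theorem pulled_L (a : Form n M) (x₀ : M) (y : Model n) :
    pulled (S.L a) x₀ y = lefOp (S.chartOmega x₀ y) (pulled a x₀ y) :=
  pullOp_lefOp _ _ _

theorem isSmooth_L {a : Form n M} (ha : IsSmooth a) : IsSmooth (S.L a) := by
  intro k x₀
  have h : chartRep (S.L a) k x₀ = fun y => lefOp (S.chartOmega x₀ y) (pulled a x₀ y) k :=
    funext fun y => congrFun (S.pulled_L a x₀ y) k
  rw [h]
  rcases k with _ | _ | k
  · exact contDiffOn_const
  · exact contDiffOn_const
  · exact contDiffOn_wedge (Nat.add_comm 2 k) (S.contDiffOn_chartOmega x₀) (ha k x₀)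

end AlmostHermitianStructure

end Smoothness

end AlmostHermitian
end

noncomputable section

namespace AlmostHermitian

/-! ### Smoothness of the dual Lefschetz operator -/

section MatrixSmoothness

variable {E : Type*} [NormedAddCommGroup E] [NormedSpace ℝ E] {ι : Type*} [Fintype ι]
  [DecidableEq ι] {s : Set E} {r : WithTop ℕ∞} {W : E → Matrix ι ι ℝ}

theorem contDiffOn_det (h : ∀ i j, ContDiffOn ℝ r (fun y => W y i j) s) :
    ContDiffOn ℝ r (fun y => (W y).det) s := by
  simp only [Matrix.det_apply]
  exact ContDiffOn.sum fun σ _ => (contDiffOn_prod fun i _ => h _ _).const_smul _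

theorem contDiffOn_matrix_inv (h : ∀ i j, ContDiffOn ℝ r (fun y => W y i j) s)
    (hdet : ∀ y ∈ s, (W y).det ≠ 0) (i j : ι) : ContDiffOn ℝ r (fun y => (W y)⁻¹ i j) s := by
  simp only [Matrix.inv_def, Ring.inverse_eq_inv', Matrix.smul_apply, smul_eq_mul,
    Matrix.adjugate_apply]
  refine ((contDiffOn_det h).inv hdet).mul (contDiffOn_det fun i' j' => ?_)
  by_cases hi : i' = j
  · simpa only [hi, Matrix.updateRow_self] using contDiffOn_const
  · simpa only [Matrix.updateRow_ne hi] using h i' j'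

end MatrixSmoothness

section DualLefschetz

attribute [local instance] smulFormDegree smulExtForm

namespace HermitianSpace

variable {n : ℕ} {V : Type*} [AddCommGroup V] [Module ℝ V] [TopologicalSpace V]
  (S : HermitianSpace n V)

/-- The same Hermitian space with another basis. -/
def withBasis (b : Module.Basis (Fin (2 * n)) ℝ V) : HermitianSpace n V := { S with b := b }

/-- The commutator of Λ with e_u and the value Λ1 = 0 do not mention the basis, and they determine
Λ. This matters for smoothness: `tanBasis x` comes from the preferred chart at x, which need not
vary continuously with x. -/
theorem Lam_withBasis (b : Module.Basis (Fin (2 * n)) ℝ V) (a : ExtForm V) :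
    (S.withBasis b).Lam a = S.Lam a := by
  refine S.end_eq_of_e ?_ (fun u k a _ h => ?_) a
  · rw [S.Lam_one, Lam_one]
  · rw [S.Lam_e, ← h]
    exact (S.withBasis b).Lam_e u a

theorem g_c_b (i k : Fin (2 * n)) : S.g (S.c i) (S.b k) = if i = k then 1 else 0 := by
  have h := congrArg (fun x => S.b.repr x i) (S.sum_g_c_b (S.b k))
  simpa [Finsupp.single_apply, eq_comm] using h

/-- The matrix of the fundamental form. -/
def omegaMatrix : Matrix (Fin (2 * n)) (Fin (2 * n)) ℝ :=
  Matrix.of fun j k => S.g (S.J (S.b j)) (S.b k)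

theorem mul_omegaMatrix :
    (Matrix.of fun i j => -S.g (S.c j) (S.J (S.c i))) * S.omegaMatrix = 1 := by
  ext i k
  rw [Matrix.mul_apply]
  have h := congrArg (fun x => S.g (S.J x) (S.b k)) (S.sum_g_c_b (S.J (S.c i)))
  simp only [map_sum, map_smul, sum_apply, smul_apply, S.J_J, map_neg, neg_apply, g_c_b,
    smul_eq_mul] at h
  simp only [Matrix.of_apply, omegaMatrix, neg_mul, Finset.sum_neg_distrib, h, neg_neg,
    Matrix.one_apply]

/-- Expresses Λ through the matrix of ω alone; in a fixed chart its entries, and those of its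
inverse, are smooth. -/
theorem Lam_eq_omegaMatrix (a : ExtForm V) :
    S.Lam a = (-(1 / 2) : ℂ) • ∑ i, ∑ j,
      (S.omegaMatrix⁻¹ i j : ℂ) • intOp (S.b j) (intOp (S.b i) a) := by
  rw [Lam_apply, neg_smul, ← smul_neg, ← Finset.sum_neg_distrib]
  congr 1
  refine Finset.sum_congr rfl fun i _ => ?_
  conv_lhs => rw [← S.sum_g_c_b (S.J (S.c i)), intOp_sum]
  rw [← Finset.sum_neg_distrib]
  refine Finset.sum_congr rfl fun j _ => ?_
  rw [Matrix.inv_eq_left_inv S.mul_omegaMatrix, Matrix.of_apply, Complex.ofReal_neg, neg_smul,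
    neg_neg]

end HermitianSpace

variable {n : ℕ} {M : Type*} [TopologicalSpace M] [ChartedSpace (Model n) M]
  [IsManifold 𝓘(ℝ, Model n) ∞ M]

/-- The basis of the tangent space given by the preferred chart at `x₀`. -/
def chartBasis (x₀ : M) {y : Model n} (hy : y ∈ (extChartAt 𝓘(ℝ, Model n) x₀).target) :
    Module.Basis (Fin (2 * n)) ℝ (Tan n ((extChartAt 𝓘(ℝ, Model n) x₀).symm y)) :=
  (EuclideanSpace.basisFun (Fin (2 * n)) ℝ).toBasis.map
    (LinearEquiv.ofBijective (chartDiff x₀ y).toLinearMap (by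
      have h := isInvertible_mfderivWithin_extChartAt_symm (I := 𝓘(ℝ, Model n)) hy
      rw [modelWithCornersSelf_coe, Set.range_id, mfderivWithin_univ] at h
      exact h.bijective))

theorem chartBasis_apply (x₀ : M) {y : Model n} (hy : y ∈ (extChartAt 𝓘(ℝ, Model n) x₀).target)
    (i : Fin (2 * n)) :
    chartBasis x₀ hy i = chartDiff x₀ y (EuclideanSpace.basisFun (Fin (2 * n)) ℝ i) := by
  refine (Module.Basis.map_apply _ _ i).trans ?_
  rw [OrthonormalBasis.coe_toBasis]
  rfl

namespace AlmostHermitianStructure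

variable (S : AlmostHermitianStructure n M)

/-- The matrix of the fundamental form in the preferred chart at `x₀`. -/
def chartOmegaMatrix (x₀ : M) (y : Model n) : Matrix (Fin (2 * n)) (Fin (2 * n)) ℝ :=
  Matrix.of fun j k => S.g.inner _
    (S.J _ (chartDiff x₀ y (EuclideanSpace.basisFun (Fin (2 * n)) ℝ j)))
    (chartDiff x₀ y (EuclideanSpace.basisFun (Fin (2 * n)) ℝ k))

theorem omegaMatrix_chartBasis (x₀ : M) {y : Model n}
    (hy : y ∈ (extChartAt 𝓘(ℝ, Model n) x₀).target) :
    ((S.herm _).withBasis (chartBasis x₀ hy)).omegaMatrix = S.chartOmegaMatrix x₀ y := by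
  ext j k
  show S.g.inner _ (S.J _ (chartBasis x₀ hy j)) (chartBasis x₀ hy k) = _
  rw [chartBasis_apply, chartBasis_apply]
  rfl

theorem pulled_Lam (a : Form n M) (x₀ : M) {y : Model n}
    (hy : y ∈ (extChartAt 𝓘(ℝ, Model n) x₀).target) :
    pulled (S.Lam a) x₀ y = (-(1 / 2) : ℂ) • ∑ i, ∑ j, ((S.chartOmegaMatrix x₀ y)⁻¹ i j : ℂ) •
      intOp (EuclideanSpace.basisFun (Fin (2 * n)) ℝ j)
        (intOp (EuclideanSpace.basisFun (Fin (2 * n)) ℝ i) (pulled a x₀ y)) := by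
  rw [pulled, Lam_apply, ← HermitianSpace.Lam_withBasis _ (chartBasis x₀ hy),
    HermitianSpace.Lam_eq_omegaMatrix, omegaMatrix_chartBasis]
  simp only [map_smul, map_sum]
  congr 1
  refine Finset.sum_congr rfl fun i _ => Finset.sum_congr rfl fun j _ => ?_
  congr 1
  rw [pulled, intOp_pullOp, intOp_pullOp, ← chartBasis_apply x₀ hy, ← chartBasis_apply x₀ hy]
  rfl

theorem isSmooth_Lam {a : Form n M} (ha : IsSmooth a) : IsSmooth (S.Lam a) := by
  intro k x₀
  refine contDiffOn_of_eval fun v => ?_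
  have h : ∀ y ∈ (extChartAt 𝓘(ℝ, Model n) x₀).target, chartRep (S.Lam a) k x₀ y v =
      (-(1 / 2) : ℂ) * ∑ i, ∑ j, ((S.chartOmegaMatrix x₀ y)⁻¹ i j : ℂ) *
        chartRep a (k + 2) x₀ y (Fin.cons (EuclideanSpace.basisFun (Fin (2 * n)) ℝ i)
          (Fin.cons (EuclideanSpace.basisFun (Fin (2 * n)) ℝ j) v)) := by
    intro y hy
    rw [chartRep_eq_pulled, S.pulled_Lam a x₀ hy]
    simp only [Pi.smul_apply, Finset.sum_apply, ContinuousAlternatingMap.smul_apply,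
      ContinuousAlternatingMap.sum_apply, smul_eq_mul]
    rfl
  refine ContDiffOn.congr ?_ h
  refine contDiffOn_const.mul (ContDiffOn.sum fun i _ => ContDiffOn.sum fun j _ => ?_)
  refine ContDiffOn.mul (Complex.ofRealCLM.contDiff.comp_contDiffOn ?_)
    (contDiffOn_eval (ha (k + 2) x₀) _)
  refine contDiffOn_matrix_inv (W := S.chartOmegaMatrix x₀) (fun i j => S.contDiffOn_omega x₀ _ _) (fun y hy => ?_) i j
  rw [← S.omegaMatrix_chartBasis x₀ hy]
  exact Matrix.det_ne_zero_of_left_inverse (HermitianSpace.mul_omegaMatrix _)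

end AlmostHermitianStructure

end DualLefschetz

end AlmostHermitian
end

noncomputable section

namespace AlmostHermitian

/-! ### The exterior derivative on a manifold -/

section ExteriorDerivative

attribute [local instance] smulFormDegree smulExtForm

variable {n : ℕ} {M : Type*} [TopologicalSpace M] [ChartedSpace (Model n) M]

/-- A chart followed by its inverse returns to a point that is equal, but not definitionally equal,
to the original; the equation is kept as a variable so that it can be substituted. -/
theorem compContinuousLinearMap_eq_of_eq {k : ℕ}
    (a : ∀ x : M, Tan n x [⋀^Fin k]→L[ℝ] ℂ) {q q' : M} (h : q' = q)
    (B : Model n →L[ℝ] Tan n q') (C : Tan n q →L[ℝ] Model n)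
    (hBC : ∀ v : Model n, (B (C v) : Model n) = v) :
    ((a q').compContinuousLinearMap B).compContinuousLinearMap C = a q := by
  subst h
  ext v
  exact congrArg (a q') (funext fun i => hBC (v i))

theorem differentiableAt_pulled {a : Form n M} (ha : IsSmooth a) (x : M) (k : ℕ) :
    DifferentiableAt ℝ (fun y => pulled a x y k) (extChartAt 𝓘(ℝ, Model n) x x) :=
  ((ha k x).contDiffAt ((isOpen_extChartAt_target x).mem_nhds
      (mem_extChartAt_target x))).differentiableAt (by simp)

theorem isSmooth_zero : IsSmooth (0 : Form n M) := fun k _ =>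
  contDiffOn_const (c := (0 : Model n [⋀^Fin k]→L[ℝ] ℂ))

theorem IsSmooth.add {a b : Form n M} (ha : IsSmooth a) (hb : IsSmooth b) : IsSmooth (a + b) :=
  fun k x₀ => (ha k x₀).add (hb k x₀)

theorem IsSmooth.smul (c : ℂ) {a : Form n M} (ha : IsSmooth a) : IsSmooth (c • a) := fun k x₀ =>
  contDiffOn_of_eval fun v => contDiffOn_const.mul (contDiffOn_eval (ha k x₀) v)

theorem extD_smul {E : Type*} [NormedAddCommGroup E] [NormedSpace ℝ E] [FiniteDimensional ℝ E]
    (c : ℂ) (f : E → ExtForm E) (y : E) : extD (fun z => c • f z) y = c • extD f y := by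
  have h : ∀ u, dirDeriv (fun z => c • f z) y u = c • dirDeriv f y u := fun u => by
    funext k
    exact congrArg (fun g => g y u)
      (fderiv_const_smul_field (𝕜 := ℝ) (R := ℂ) (f := fun z => f z k) c)
  rw [extD_eq (Module.finBasis ℝ E), extD_eq (Module.finBasis ℝ E)]
  simp only [h, map_smul, Finset.smul_sum]

variable [IsManifold 𝓘(ℝ, Model n) ∞ M]

theorem compContinuousLinearMap_chartDiff {k : ℕ} (a : ∀ x : M, Tan n x [⋀^Fin k]→L[ℝ] ℂ)
    {p q : M} (hq : q ∈ (extChartAt 𝓘(ℝ, Model n) p).source) :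
    ((a ((extChartAt 𝓘(ℝ, Model n) p).symm (extChartAt 𝓘(ℝ, Model n) p q))
      ).compContinuousLinearMap (chartDiff p (extChartAt 𝓘(ℝ, Model n) p q))
      ).compContinuousLinearMap
        (mfderiv 𝓘(ℝ, Model n) 𝓘(ℝ, Model n) (extChartAt 𝓘(ℝ, Model n) p) q) = a q := by
  refine compContinuousLinearMap_eq_of_eq a ((extChartAt 𝓘(ℝ, Model n) p).left_inv hq) _ _ ?_
  intro v
  have h := mfderivWithin_extChartAt_symm_comp_mfderiv_extChartAt' (I := 𝓘(ℝ, Model n)) hq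
  rw [modelWithCornersSelf_coe, Set.range_id, mfderivWithin_univ] at h
  exact congrArg (fun f => f v) h

theorem compContinuousLinearMap_chartDiff_self {k : ℕ} (a : ∀ x : M, Tan n x [⋀^Fin k]→L[ℝ] ℂ)
    (x : M) :
    (a ((extChartAt 𝓘(ℝ, Model n) x).symm (extChartAt 𝓘(ℝ, Model n) x x))
      ).compContinuousLinearMap (chartDiff x (extChartAt 𝓘(ℝ, Model n) x x)) = a x := by
  have h := compContinuousLinearMap_chartDiff a (mem_extChartAt_source (I := 𝓘(ℝ, Model n)) x)
  rw [mfderiv_extChartAt_self] at h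
  exact h

theorem pulled_self (a : Form n M) (x : M) :
    pulled a x (extChartAt 𝓘(ℝ, Model n) x x) = a x :=
  funext fun k => compContinuousLinearMap_chartDiff_self (fun z => a z k) x

/-- The preferred chart at x has the identity as its differential at x, so the final pull-back
disappears. -/
theorem d_apply (a : Form n M) (x : M) :
    d a x = extD (pulled a x) (extChartAt 𝓘(ℝ, Model n) x x) := by
  funext k
  rcases k with _ | k
  · rfl
  · show (extDeriv (chartRep a k x) (extChartAt 𝓘(ℝ, Model n) x x)).compContinuousLinearMap
      (mfderiv 𝓘(ℝ, Model n) 𝓘(ℝ, Model n) (extChartAt 𝓘(ℝ, Model n) x) x) = _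
    rw [mfderiv_extChartAt_self]
    rfl

theorem chartRep_change (a : Form n M) (k : ℕ) (x₀ p : M) {z : Model n}
    (hz : z ∈ (extChartAt 𝓘(ℝ, Model n) x₀).target)
    (hz' : (extChartAt 𝓘(ℝ, Model n) x₀).symm z ∈ (extChartAt 𝓘(ℝ, Model n) p).source) :
    ((mfderiv 𝓘(ℝ, Model n) 𝓘(ℝ, Model n) (extChartAt 𝓘(ℝ, Model n) p)
      ((extChartAt 𝓘(ℝ, Model n) x₀).symm z)).comp (chartDiff x₀ z) : Model n →L[ℝ] Model n) =
        fderiv ℝ (extChartAt 𝓘(ℝ, Model n) p ∘ (extChartAt 𝓘(ℝ, Model n) x₀).symm) z ∧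
    chartRep a k x₀ z = (chartRep a k p
      ((extChartAt 𝓘(ℝ, Model n) p ∘ (extChartAt 𝓘(ℝ, Model n) x₀).symm) z)
        ).compContinuousLinearMap
          (fderiv ℝ (extChartAt 𝓘(ℝ, Model n) p ∘ (extChartAt 𝓘(ℝ, Model n) x₀).symm) z) := by
  have h1 : MDifferentiableAt 𝓘(ℝ, Model n) 𝓘(ℝ, Model n) (extChartAt 𝓘(ℝ, Model n) x₀).symm z :=
    ((contMDiffOn_extChartAt_symm (I := 𝓘(ℝ, Model n)) (n := ∞) x₀).contMDiffAt
      ((isOpen_extChartAt_target x₀).mem_nhds hz)).mdifferentiableAt (by simp)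
  have h2 : MDifferentiableAt 𝓘(ℝ, Model n) 𝓘(ℝ, Model n) (extChartAt 𝓘(ℝ, Model n) p)
      ((extChartAt 𝓘(ℝ, Model n) x₀).symm z) :=
    mdifferentiableAt_extChartAt (by rwa [extChartAt_source] at hz')
  have h3 : ((mfderiv 𝓘(ℝ, Model n) 𝓘(ℝ, Model n) (extChartAt 𝓘(ℝ, Model n) p)
      ((extChartAt 𝓘(ℝ, Model n) x₀).symm z)).comp (chartDiff x₀ z) : Model n →L[ℝ] Model n) =
        fderiv ℝ (extChartAt 𝓘(ℝ, Model n) p ∘ (extChartAt 𝓘(ℝ, Model n) x₀).symm) z := by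
    rw [← mfderiv_eq_fderiv]
    exact (mfderiv_comp z h2 h1).symm
  refine ⟨h3, ?_⟩
  rw [← h3]
  exact congrArg (fun c => c.compContinuousLinearMap (chartDiff x₀ z))
    (compContinuousLinearMap_chartDiff (fun x => a x k) hz').symm

theorem contDiffAt_chart_change (x₀ p : M) {z : Model n}
    (hz : z ∈ (extChartAt 𝓘(ℝ, Model n) x₀).target)
    (hz' : (extChartAt 𝓘(ℝ, Model n) x₀).symm z ∈ (extChartAt 𝓘(ℝ, Model n) p).source) :
    ContDiffAt ℝ ∞ (extChartAt 𝓘(ℝ, Model n) p ∘ (extChartAt 𝓘(ℝ, Model n) x₀).symm) z := by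
  have h1 := (contMDiffOn_extChartAt_symm (I := 𝓘(ℝ, Model n)) (n := ∞) x₀).contMDiffAt
      ((isOpen_extChartAt_target x₀).mem_nhds hz)
  have h2 : ContMDiffAt 𝓘(ℝ, Model n) 𝓘(ℝ, Model n) ∞ (extChartAt 𝓘(ℝ, Model n) p)
      ((extChartAt 𝓘(ℝ, Model n) x₀).symm z) :=
    contMDiffAt_extChartAt' (by rwa [extChartAt_source] at hz')
  exact (h2.comp z h1).contDiffAt

/-- Each value of d is taken in a chart depending on the point. Naturality of `extDeriv` under the
transition map shows that one fixed chart gives the same values, which yields smoothness of da. -/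
theorem chartRep_d {a : Form n M} (ha : IsSmooth a) (k : ℕ) (x₀ : M) {y : Model n}
    (hy : y ∈ (extChartAt 𝓘(ℝ, Model n) x₀).target) :
    chartRep (d a) (k + 1) x₀ y = extDeriv (chartRep a k x₀) y := by
  set p := (extChartAt 𝓘(ℝ, Model n) x₀).symm y with hp
  have hpp := mem_extChartAt_source (I := 𝓘(ℝ, Model n)) p
  have hnear : ∀ᶠ z in nhds y, z ∈ (extChartAt 𝓘(ℝ, Model n) x₀).target ∧
      (extChartAt 𝓘(ℝ, Model n) x₀).symm z ∈ (extChartAt 𝓘(ℝ, Model n) p).source := by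
    refine ((isOpen_extChartAt_target x₀).mem_nhds hy |> Filter.Eventually.and) ?_
    exact (continuousAt_extChartAt_symm'' hy).preimage_mem_nhds
      ((isOpen_extChartAt_source p).mem_nhds hpp)
  have h1 : chartRep a k x₀ =ᶠ[nhds y] fun z => (chartRep a k p
      ((extChartAt 𝓘(ℝ, Model n) p ∘ (extChartAt 𝓘(ℝ, Model n) x₀).symm) z)
        ).compContinuousLinearMap
          (fderiv ℝ (extChartAt 𝓘(ℝ, Model n) p ∘ (extChartAt 𝓘(ℝ, Model n) x₀).symm) z) :=
    hnear.mono fun z hz => (chartRep_change a k x₀ p hz.1 hz.2).2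
  rw [h1.extDeriv_eq, extDeriv_pullback (r := ∞)]
  · rw [← (chartRep_change a k x₀ p hy hpp).1]
    rfl
  · exact ((ha k p).contDiffAt ((isOpen_extChartAt_target p).mem_nhds
      (mem_extChartAt_target p))).differentiableAt (by simp)
  · exact contDiffAt_chart_change x₀ p hy hpp
  · rw [minSmoothness_of_isRCLikeNormedField]
    exact WithTop.coe_le_coe.2 le_top

theorem isSmooth_d {a : Form n M} (ha : IsSmooth a) : IsSmooth (d a) := by
  intro k x₀
  rcases k with _ | k
  · refine contDiffOn_const (c := (0 : Model n [⋀^Fin 0]→L[ℝ] ℂ)) |>.congr fun y _ => rfl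
  refine ContDiffOn.congr ?_ fun y hy => chartRep_d ha k x₀ hy
  have h := (ha k x₀).fderiv_of_isOpen (m := ∞) (isOpen_extChartAt_target x₀) le_rfl
  refine contDiffOn_of_eval fun v => ?_
  simp only [extDeriv, ContinuousAlternatingMap.alternatizeUncurryFin_apply]
  exact ContDiffOn.sum fun i _ =>
    (contDiffOn_eval (h.clm_apply contDiffOn_const) _).const_smul _

theorem d_smul (c : ℂ) (a : Form n M) : d (c • a) = c • d a := by
  funext x
  rw [d_apply]
  exact (extD_smul c _ _).trans (congrArg (c • ·) (d_apply a x).symm)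

namespace AlmostHermitianStructure

variable (S : AlmostHermitianStructure n M)

/-- Exterior product with `dω`, at `x`. -/
def torsion (x : M) : Module.End ℂ (ExtForm (Tan n x)) :=
  torsionOp (E := Model n) (EuclideanSpace.basisFun (Fin (2 * n)) ℝ).toBasis (S.chartOmega x)
    (extChartAt 𝓘(ℝ, Model n) x x)

theorem torsion_L (x : M) (a : ExtForm (Tan n x)) :
    S.torsion x ((S.herm x).L a) = (S.herm x).L (S.torsion x a) :=
  torsionOp_lefOp (E := Model n) _ _ _ _ _

theorem d_L_apply {a : Form n M} (ha : IsSmooth a) (x : M) :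
    d (S.L a) x = S.torsion x (a x) + (S.herm x).L (d a x) := by
  have h : pulled (S.L a) x = fun y => lefOp (S.chartOmega x y) (pulled a x y) :=
    funext fun y => S.pulled_L a x y
  rw [d_apply, d_apply, h, extD_lefOp (EuclideanSpace.basisFun (Fin (2 * n)) ℝ).toBasis
    (((S.contDiffOn_chartOmega x).contDiffAt ((isOpen_extChartAt_target x).mem_nhds
      (mem_extChartAt_target x))).differentiableAt (by simp)) (differentiableAt_pulled ha x),
    pulled_self]
  have h2 : S.chartOmega x (extChartAt 𝓘(ℝ, Model n) x x) = S.omega x :=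
    compContinuousLinearMap_chartDiff_self S.omega x
  rw [h2]
  rfl

end AlmostHermitianStructure

end ExteriorDerivative

end AlmostHermitian
end

noncomputable section

namespace AlmostHermitian

/-! ### The Hodge star on the Lefschetz components of a form -/

section LefschetzComponents

attribute [local instance] smulFormDegree smulExtForm

theorem weilSign_add_two_mul (k r : ℕ) : weilSign (k + 2 * r) = (-1) ^ r * weilSign k := by
  induction r with
  | zero => simp
  | succ r ih =>
    rw [show k + 2 * (r + 1) = k + 2 * r + 1 + 1 by ring, weilSign_succ, weilSign_succ, ih]
    have h : ((-1 : ℂ) ^ (k + 2 * r)) * (-1) ^ (k + 2 * r) = 1 := by rw [← mul_pow]; simp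
    linear_combination (-((-1) ^ r * weilSign k)) * h

/-- The coefficient of `⋆ 𝕀` on `L ^ j α`, for `α` primitive of degree `k`. -/
def weilCoeff (n k j : ℕ) : ℂ :=
  if k + j ≤ n then weilSign k * (-1) ^ k * ((j ! : ℂ) / ((n - k - j) ! : ℂ)) else 0

/-- At k + j = n the factor n - k - j is 0, which agrees with the convention 1/m! = 0 for negative
m; beyond that both coefficients are 0. -/
theorem weilCoeff_succ (n k j : ℕ) :
    weilCoeff n k (j + 1) = ((j : ℂ) + 1) * ((n - k - j : ℕ) * weilCoeff n k j) := by
  unfold weilCoeff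
  by_cases h : k + (j + 1) ≤ n
  · obtain ⟨m, rfl⟩ := Nat.exists_eq_add_of_le h
    rw [if_pos h, if_pos (by omega), show k + (j + 1) + m - k - (j + 1) = m by omega,
      show k + (j + 1) + m - k - j = m + 1 by omega, Nat.factorial_succ, Nat.factorial_succ]
    have : ((m ! : ℕ) : ℂ) ≠ 0 := by exact_mod_cast m.factorial_ne_zero
    have : ((m + 1 : ℕ) : ℂ) ≠ 0 := by exact_mod_cast m.succ_ne_zero
    push_cast at *
    field_simp
  · rw [if_neg h]
    by_cases h' : k + j ≤ n
    · rw [show n - k - j = 0 by omega]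
      simp
    · simp [if_neg h']

namespace HermitianSpace

variable {n : ℕ} {V : Type*} [AddCommGroup V] [Module ℝ V] [TopologicalSpace V]
  (S : HermitianSpace n V)

/-- The inverse of `𝕀`. -/
def IInv : Module.End ℂ (ExtForm V) := S.I * parOp

theorem IInv_eq (a : ExtForm V) : S.IInv a = S.I (parOp a) := rfl

theorem IInv_I (a : ExtForm V) : S.IInv (S.I a) = a := by
  rw [IInv_eq, par_I, I_I, parOp_parOp]

theorem star_IInv (a : ExtForm V) : S.star (S.IInv a) = S.IInv (S.star a) := by
  rw [IInv_eq, IInv_eq, ← I_star, star_par]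

theorem IInv_L_pow (j : ℕ) (a : ExtForm V) : S.IInv ((S.L ^ j) a) = (S.L ^ j) (S.IInv a) := by
  have h : parOp ((S.L ^ j) a) = (S.L ^ j) (parOp a) := by
    induction j with
    | zero => rfl
    | succ j ih => rw [pow_succ', Module.End.mul_apply, Module.End.mul_apply, par_L, ih]
  rw [IInv_eq, IInv_eq, h, I_L_pow]

theorem L_L_pow (i j : ℕ) (a : ExtForm V) : (S.L ^ i) ((S.L ^ j) a) = (S.L ^ (i + j)) a := by
  rw [pow_add, Module.End.mul_apply]

theorem L_pow_eq_zero {k s : ℕ} (hs : n < k + s) {a : ExtForm V} (ha : a ∈ S.prim k) :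
    (S.L ^ s) a = 0 := S.lefschetz.L_pow_eq_zero hs ha

theorem Lam_L_pow {k : ℕ} {a : ExtForm V} (ha : a ∈ S.prim k) (s : ℕ) :
    S.Lam ((S.L ^ s) a) = ((s : ℂ) * ((n : ℂ) - k - s + 1)) • (S.L ^ (s - 1)) a := by
  rcases s with _ | s
  · have h : S.Lam a = 0 := (S.lefschetz.mem_prim.1 ha).2
    rw [pow_zero, Module.End.one_apply, h]
    simp
  · refine (S.lefschetz.Lam_L_pow ha s).trans ?_
    rw [Nat.add_sub_cancel]
    show _ • (S.L ^ s) a = _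
    congr 1
    push_cast
    ring

theorem I_star_L_pow {k : ℕ} {a : ExtForm V} (ha : a ∈ S.prim k) (j : ℕ) :
    S.I (S.star ((S.L ^ j) a)) = weilCoeff n k j • (S.L ^ (n - k - j)) a := by
  unfold weilCoeff
  split_ifs with h
  · obtain ⟨m, rfl⟩ := Nat.exists_eq_add_of_le h
    rw [show k + j + m - k - j = m by omega,
      S.star_L_pow_of_prim (show k + (j + m) = k + j + m by ring) ha, map_smul, I_L_pow,
      S.I_I_of_mem (S.lefschetz.mem_prim.1 ha).1, map_smul, smul_smul]
    congr 1
    ring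
  · rw [S.L_pow_eq_zero (by omega) ha, map_zero, map_zero, zero_smul]

/-- Weil's formula for a component of degree q = k + 1 - 2r: the exponent n-k-j+r is complementary
to j+r-1, as their sum is n - q. This produces the factorial part of f(r). -/
theorem star_IInv_L_pow {k q j r : ℕ} (hq : q + 2 * r = k + 1) (hjr : 1 ≤ j + r)
    {a : ExtForm V} (ha : a ∈ S.prim q) (h : k + j ≤ n) :
    weilCoeff n k j • S.star (S.IInv ((S.L ^ (n - k - j)) ((S.L ^ r) a))) =
      (-((-1 : ℂ) ^ r * (((j ! : ℂ) * ((n - k - j + r) ! : ℂ)) /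
        (((j + r - 1) ! : ℂ) * ((n - k - j) ! : ℂ))))) • (S.L ^ (j + r - 1)) a := by
  -- Passing from q to k + 1 = q + 2r changes the Weil sign by (-1)^r, and from k to k + 1 by
  -- (-1)^(k+1).
  have hs : weilSign q * weilSign k * (-1) ^ k = -(-1) ^ r := by
    have h1 := weilSign_add_two_mul q r
    rw [hq, weilSign_succ] at h1
    have h2 := weilSign_mul_self k
    have h3 : ((-1 : ℂ) ^ r) * (-1) ^ r = 1 := by rw [← mul_pow]; simp
    have h4 : ((-1 : ℂ) ^ k) * (-1) ^ k = 1 := by rw [← mul_pow]; simp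
    have h5 : weilSign q = (-1) ^ r * ((-1) ^ (k + 1) * weilSign k) := by
      rw [h1, ← mul_assoc, h3, one_mul]
    rw [h5, pow_succ]
    linear_combination (-(-1) ^ r * ((-1) ^ k * (-1) ^ k)) * h2 + (-(-1) ^ r) * h4
  rw [L_L_pow, star_IInv,
    S.star_L_pow_of_prim (show q + (n - k - j + r + (j + r - 1)) = n by omega) ha, map_smul,
    IInv_L_pow, IInv_I, smul_smul, weilCoeff, if_pos h]
  congr 1
  have : (((n - k - j) ! : ℕ) : ℂ) ≠ 0 := by exact_mod_cast (n - k - j).factorial_ne_zero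
  have : (((j + r - 1) ! : ℕ) : ℂ) ≠ 0 := by exact_mod_cast (j + r - 1).factorial_ne_zero
  field_simp
  linear_combination ((j ! : ℂ) * ((n - k - j + r) ! : ℂ)) * hs

/-- The polynomial part of f(r) is (j+r)(n-k-j+r) - j(n-k-j+1) = r(n-k+r) - j, the first product
coming from Λ L^(j+r) in degree q. -/
theorem component_eq_coeff {k q j r : ℕ} (hq : q + 2 * r = k + 1) (hjr : 1 ≤ j + r)
    {a : ExtForm V} (ha : a ∈ S.prim q) :
    S.Lam ((S.L ^ j) ((S.L ^ r) a)) -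
        ((j : ℂ) * ((n : ℂ) - k - j + 1)) • (S.L ^ (j - 1)) ((S.L ^ r) a) -
        weilCoeff n k j • S.star (S.IInv ((S.L ^ (n - k - j)) ((S.L ^ r) a))) =
      coeff n k j r • (S.L ^ (j + r - 1)) a := by
  have h1 : ((j : ℂ) * ((n : ℂ) - k - j + 1)) • (S.L ^ (j - 1)) ((S.L ^ r) a) =
      ((j : ℂ) * ((n : ℂ) - k - j + 1)) • (S.L ^ (j + r - 1)) a := by
    rcases j with _ | j
    · simp
    · rw [L_L_pow, show j + 1 - 1 + r = j + 1 + r - 1 by omega]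
  have h2 : weilCoeff n k j • S.star (S.IInv ((S.L ^ (n - k - j)) ((S.L ^ r) a))) =
      (-(if k + j ≤ n then
      (-1 : ℂ) ^ r * (((j ! : ℂ) * ((n - k - j + r) ! : ℂ)) /
        (((j + r - 1) ! : ℂ) * ((n - k - j) ! : ℂ)))
    else 0)) • (S.L ^ (j + r - 1)) a := by
    split_ifs with h
    · exact S.star_IInv_L_pow hq hjr ha h
    · rw [weilCoeff, if_neg h, zero_smul, neg_zero, zero_smul]
  have h3 : (q : ℂ) = k + 1 - 2 * r := by
    have : ((q + 2 * r : ℕ) : ℂ) = (k + 1 : ℕ) := by rw [hq]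
    push_cast at this
    linear_combination this
  rw [h1, h2, L_L_pow, S.Lam_L_pow ha, ← sub_smul, ← sub_smul, coeff, h3]
  congr 1
  push_cast
  ring

/-- The reason for the sum to start at r = 2. If the power of L does not vanish, then j ≤ n - k for
r = 0 and j ≤ n - k + 1 for r = 1; in these ranges the two parts of f cancel, and at j = n - k + 1
the polynomial part is itself zero. -/
theorem coeff_smul_eq_zero {k q j r : ℕ} (hq : q + 2 * r = k + 1) (hjr : 1 ≤ j + r) (hr : r < 2)
    {a : ExtForm V} (ha : a ∈ S.prim q) : coeff n k j r • (S.L ^ (j + r - 1)) a = 0 := by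
  by_cases h : n < q + (j + r - 1)
  · rw [S.L_pow_eq_zero h ha, smul_zero (M := ℂ) (A := ExtForm V)]
  suffices h0 : coeff n k j r = 0 by rw [h0, zero_smul]
  unfold coeff
  interval_cases r
  · rw [if_pos (by omega)]
    obtain ⟨j, rfl⟩ : ∃ i, j = i + 1 := ⟨j - 1, by omega⟩
    have : (((n - k - (j + 1)) ! : ℕ) : ℂ) ≠ 0 := by
      exact_mod_cast (n - k - (j + 1)).factorial_ne_zero
    have : ((j ! : ℕ) : ℂ) ≠ 0 := by exact_mod_cast j.factorial_ne_zero
    simp only [add_zero, Nat.add_sub_cancel, Nat.factorial_succ]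
    push_cast
    field_simp
    ring
  · by_cases h' : k + j ≤ n
    · obtain ⟨m, rfl⟩ := Nat.exists_eq_add_of_le h'
      rw [if_pos h', show k + j + m - k - j = m by omega, Nat.add_sub_cancel, Nat.factorial_succ]
      have : ((m ! : ℕ) : ℂ) ≠ 0 := by exact_mod_cast m.factorial_ne_zero
      have : ((j ! : ℕ) : ℂ) ≠ 0 := by exact_mod_cast j.factorial_ne_zero
      push_cast
      field_simp
      ring
    · rw [if_neg h']
      have : k + j = n + 1 := by omega
      have : ((k + j : ℕ) : ℂ) = (n + 1 : ℕ) := by rw [this]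
      push_cast at *
      linear_combination -this

/-- The case j = r = 0, where the exponent j + r - 1 would be negative. -/
theorem component_zero_eq_zero {k : ℕ} {a : ExtForm V} (ha : a ∈ S.prim (k + 1)) :
    S.Lam a - weilCoeff n k 0 • S.star (S.IInv ((S.L ^ (n - k)) a)) = 0 := by
  rw [S.L_pow_eq_zero (by omega) ha, map_zero, map_zero, smul_zero (M := ℂ) (A := ExtForm V),
    sub_zero]
  exact (S.lefschetz.mem_prim.1 ha).2

/-- Collects the part of the commutator identity that depends on dα only through its value D at a
point. -/
theorem sum_components {k j : ℕ} {D : ExtForm V} {a : ℕ → ExtForm V}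
    (h : S.lefschetz.IsDecomposition (k + 1) D a) :
    S.Lam ((S.L ^ j) D) - ((j : ℂ) * ((n : ℂ) - k - j + 1)) • (S.L ^ (j - 1)) D -
        weilCoeff n k j • S.star (S.IInv ((S.L ^ (n - k - j)) D)) =
      ∑ r ∈ Finset.Icc 2 ((k + 1) / 2), coeff n k j r • (S.L ^ (j + r - 1)) (a r) := by
  have hsub : Finset.Icc 2 ((k + 1) / 2) ⊆ Finset.range ((k + 1) / 2 + 1) := fun r hr => by
    simp only [Finset.mem_Icc, Finset.mem_range] at *
    omega
  have hD : D = ∑ r ∈ Finset.range ((k + 1) / 2 + 1), (S.L ^ r) (a r) := h.2.2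
  rw [hD]
  simp only [map_sum, Finset.smul_sum, ← Finset.sum_sub_distrib]
  rw [← Finset.sum_subset hsub]
  · refine Finset.sum_congr rfl fun r hr => ?_
    rw [Finset.mem_Icc] at hr
    exact S.component_eq_coeff (q := k + 1 - 2 * r) (by omega) (by omega) (h.1 r (by omega))
  · intro r hr hr'
    simp only [Finset.mem_Icc, Finset.mem_range] at hr hr'
    have hp : a r ∈ S.prim (k + 1 - 2 * r) := h.1 r (by omega)
    by_cases hjr : 1 ≤ j + r
    · rw [S.component_eq_coeff (q := k + 1 - 2 * r) (by omega) hjr hp,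
        S.coeff_smul_eq_zero (q := k + 1 - 2 * r) (by omega) hjr (by omega) hp]
    · obtain ⟨rfl, rfl⟩ : j = 0 ∧ r = 0 := by omega
      simpa using S.component_zero_eq_zero hp

end HermitianSpace

end LefschetzComponents

end AlmostHermitian
end

noncomputable section

namespace AlmostHermitian

/-! ### Lefschetz decomposition of smooth forms and the commutator identity -/

section SmoothForms

attribute [local instance] smulFormDegree smulExtForm

variable {n : ℕ} {M : Type*} [TopologicalSpace M] [ChartedSpace (Model n) M]

/-- Scalar multiplication on forms on a manifold, from the module structure. -/
abbrev smulForm : SMul ℂ (Form n M) :=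
  Module.toDistribMulAction.toDistribSMul.toSMulZeroClass.toSMul

attribute [local instance] smulForm

variable (n M) in
/-- Smooth forms of degree `k`. -/
def smoothDeg (k : ℕ) : Submodule ℂ (Form n M) where
  carrier := {a | IsSmooth a ∧ HasDegree k a}
  add_mem' ha hb := ⟨ha.1.add hb.1, fun x =>
    (degSub (V := Tan n x) k).add_mem (ha.2 x) (hb.2 x)⟩
  zero_mem' := ⟨isSmooth_zero, fun _ _ _ => rfl⟩
  smul_mem' c _ ha := ⟨ha.1.smul c, fun x => (degSub (V := Tan n x) k).smul_mem c (ha.2 x)⟩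

variable [IsManifold 𝓘(ℝ, Model n) ∞ M]

theorem d_mem_smoothDeg {k : ℕ} {a : Form n M} (ha : a ∈ smoothDeg n M k) :
    d a ∈ smoothDeg n M (k + 1) := by
  refine ⟨isSmooth_d ha.1, fun x m hm => ?_⟩
  rcases m with _ | m
  · rfl
  have h : chartRep a m x = fun _ => 0 := funext fun y => by
    rw [chartRep, ha.2 _ m (by omega)]
    rfl
  rw [d_apply]
  show extDeriv (chartRep a m x) _ = 0
  rw [h]
  ext v
  simp [extDeriv, ContinuousAlternatingMap.alternatizeUncurryFin_apply]

namespace AlmostHermitianStructure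

variable (S : AlmostHermitianStructure n M)

/-- The smooth forms on an almost Hermitian manifold, as a Lefschetz module. -/
def lefschetz : LefschetzModule n (Form n M) where
  deg := smoothDeg n M
  L :=
    { toFun := S.L
      map_add' := fun a b => funext fun x => map_add (S.herm x).L (a x) (b x)
      map_smul' := fun c a => funext fun x => map_smul (S.herm x).L c (a x) }
  Lam :=
    { toFun := S.Lam
      map_add' := fun a b => funext fun x => by
        rw [Pi.add_apply, Lam_apply, Lam_apply, Lam_apply, Pi.add_apply, map_add]
      map_smul' := fun c a => funext fun x => by
        rw [Lam_apply]
        exact (map_smul (S.herm x).Lam c (a x)).trans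
          (congrArg (c • ·) (S.Lam_apply a x).symm) }
  L_mem k a ha := ⟨S.isSmooth_L ha.1, fun x => (S.herm x).lefschetz.L_mem k _ (ha.2 x)⟩
  Lam_mem k a ha := ⟨S.isSmooth_Lam ha.1, fun x => by
    rw [LinearMap.coe_mk, AddHom.coe_mk, Lam_apply]
    exact (S.herm x).lefschetz.Lam_mem k _ (ha.2 x)⟩
  Lam_zero k hk a ha := funext fun x => by
    rw [LinearMap.coe_mk, AddHom.coe_mk, Lam_apply]
    exact (S.herm x).lefschetz.Lam_zero k hk _ (ha.2 x)
  deg_eq_zero k hk a ha := funext fun x => (S.herm x).lefschetz.deg_eq_zero k hk _ (ha.2 x)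
  comm k a ha := funext fun x => by
    show S.Lam (S.L a) x = S.L (S.Lam a) x + ((n : ℂ) - k) • a x
    rw [Lam_apply, L_apply, L_apply, Lam_apply]
    exact (S.herm x).lefschetz.comm k _ (ha.2 x)

theorem lefschetz_L_pow (j : ℕ) (a : Form n M) : (S.lefschetz.L ^ j) a = S.L^[j] a := by
  rw [Module.End.pow_apply]
  rfl

theorem isPrimitive_iff {k : ℕ} {a : Form n M} : S.IsPrimitive k a ↔ a ∈ S.lefschetz.prim k := by
  rw [LefschetzModule.mem_prim]
  exact and_assoc.symm

theorem isLefschetzDecomposition_iff {m : ℕ} {b : Form n M} {c : ℕ → Form n M} :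
    S.IsLefschetzDecomposition m b c ↔ S.lefschetz.IsDecomposition m b c := by
  simp only [IsLefschetzDecomposition, LefschetzModule.IsDecomposition, isPrimitive_iff,
    lefschetz_L_pow]

theorem prim_apply {k : ℕ} {a : Form n M} (ha : S.IsPrimitive k a) (x : M) :
    a x ∈ (S.herm x).prim k :=
  (S.herm x).lefschetz.mem_prim.2 ⟨ha.2.1 x, by
    show (S.herm x).Lam (a x) = 0
    rw [← Lam_apply, ha.2.2]
    rfl⟩

theorem isDecomposition_apply {m : ℕ} {b : Form n M} {c : ℕ → Form n M}
    (h : S.IsLefschetzDecomposition m b c) (x : M) :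
    (S.herm x).lefschetz.IsDecomposition m (b x) fun r => c r x := by
  refine ⟨fun r hr => S.prim_apply (h.1 r hr) x, fun r hr => congrFun (h.2.1 r hr) x, ?_⟩
  conv_lhs => rw [h.2.2, Finset.sum_apply]
  exact Finset.sum_congr rfl fun r _ => S.L_iterate_apply r _ x

theorem isSmooth_L_iterate {a : Form n M} (ha : IsSmooth a) (j : ℕ) : IsSmooth (S.L^[j] a) := by
  induction j with
  | zero => exact ha
  | succ j ih =>
    rw [Function.iterate_succ_apply']
    exact S.isSmooth_L ih

/-! ### Leibniz formulas and commutators on powers of L -/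

theorem comm_d_L_apply {a : Form n M} (ha : IsSmooth a) (x : M) :
    comm d S.L a x = S.torsion x (a x) := by
  show d (S.L a) x - (S.herm x).L (d a x) = _
  rw [S.d_L_apply ha, add_sub_cancel_right]

theorem d_L_iterate_apply {a : Form n M} (ha : IsSmooth a) (j : ℕ) (x : M) :
    d (S.L^[j] a) x = ((S.herm x).L ^ j) (d a x) +
      (j : ℂ) • S.torsion x (((S.herm x).L ^ (j - 1)) (a x)) := by
  induction j with
  | zero => simp
  | succ j ih =>
    have h : (j : ℂ) • (S.herm x).L (S.torsion x (((S.herm x).L ^ (j - 1)) (a x))) =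
        (j : ℂ) • S.torsion x (((S.herm x).L ^ j) (a x)) := by
      rcases j with _ | j
      · simp
      · rw [← torsion_L, ← Module.End.mul_apply (S.herm x).L, ← pow_succ', Nat.add_sub_cancel]
    rw [Function.iterate_succ_apply', S.d_L_apply (S.isSmooth_L_iterate ha j), ih,
      L_iterate_apply, map_add, map_smul, h, ← Module.End.mul_apply (S.herm x).L, ← pow_succ',
      Nat.add_sub_cancel]
    push_cast
    module

theorem IInv_apply (a : Form n M) (x : M) : S.IInv a x = (S.herm x).IInv (a x) := by
  funext k
  ext v
  have h := (a x k).toAlternatingMap.map_smul_univ (fun _ => (-1 : ℝ)) fun i => S.J x (v i)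
  simp only [neg_smul, one_smul, Finset.prod_const, Finset.card_univ, Fintype.card_fin] at h
  refine h.trans ?_
  rw [Complex.real_smul]
  push_cast
  rfl

theorem Lam_L_iterate {k : ℕ} {a : Form n M} (ha : S.IsPrimitive k a) (j : ℕ) :
    S.Lam (S.L^[j] a) = ((j : ℂ) * ((n : ℂ) - k - j + 1)) • S.L^[j - 1] a := by
  funext x
  rw [Lam_apply, L_iterate_apply, (S.herm x).Lam_L_pow (S.prim_apply ha x), ← L_iterate_apply]
  rfl

theorem I_star_L_iterate {k : ℕ} {a : Form n M} (ha : S.IsPrimitive k a) (j : ℕ) :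
    S.I (S.star (S.L^[j] a)) = weilCoeff n k j • S.L^[n - k - j] a := by
  funext x
  rw [I_apply, star_apply, L_iterate_apply, (S.herm x).I_star_L_pow (S.prim_apply ha x),
    ← L_iterate_apply]
  rfl

theorem star_I (a : Form n M) : S.star (S.I a) = S.I (S.star a) := by
  funext x
  rw [star_apply, I_apply, I_apply, star_apply, HermitianSpace.I_star]

theorem star_Lam (a : Form n M) : S.star (S.Lam a) = S.L (S.star a) := by
  funext x
  rw [star_apply, Lam_apply, L_apply, star_apply, ← HermitianSpace.star_par_L_star,
    HermitianSpace.star_star, HermitianSpace.par_L, HermitianSpace.par_L,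
    parOp_parOp]

/-- Since ⋆Λ = L⋆ and Λ⋆ = ⋆L, the commutator equals -⋆ [d, L] ⋆. -/
theorem comm_dStar_Lam_apply {a : Form n M} (ha : IsSmooth (S.star a)) (x : M) :
    comm S.dStar S.Lam a x = -(S.herm x).star (S.torsion x (S.star a x)) := by
  have h1 : S.dStar (S.Lam a) x = -(S.herm x).star (S.torsion x (S.star a x) +
      (S.herm x).L (d (S.star a) x)) := by
    rw [← S.d_L_apply ha, ← star_Lam, ← star_apply]
    rfl
  have h2 : S.Lam (S.dStar a) x = -(S.herm x).star ((S.herm x).L (d (S.star a) x)) := by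
    rw [Lam_apply, HermitianSpace.star_L, ← star_apply, ← map_neg]
    rfl
  show S.dStar (S.Lam a) x - S.Lam (S.dStar a) x = _
  rw [h1, h2, map_add]
  abel

theorem exists_isLefschetzDecomposition {k : ℕ} {α : Form n M} (hα : S.IsPrimitive k α) :
    ∃ a : ℕ → Form n M, S.IsLefschetzDecomposition (k + 1) (d α) a := by
  have hd : d α ∈ smoothDeg n M (k + 1) := d_mem_smoothDeg ⟨hα.1, hα.2.1⟩
  by_cases hk : k ≤ n
  · obtain ⟨a, ha⟩ := S.lefschetz.exists_decomposition (by omega : k + 1 ≤ n + 1) hd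
    exact ⟨a, S.isLefschetzDecomposition_iff.2 ha⟩
  · have h0 : α = 0 := S.lefschetz.prim_eq_zero (by omega) (S.isPrimitive_iff.1 hα)
    -- For k > n the primitive form α is 0, and the zero components serve.
    have h1 : d α = 0 := (congrArg d (h0.trans (zero_smul ℂ α).symm)).trans
        ((d_smul _ _).trans (zero_smul ℂ (d α)))
    rw [h1]
    refine ⟨0, S.isLefschetzDecomposition_iff.2 ⟨fun r _ => Submodule.zero_mem _,
      fun r _ => rfl, ?_⟩⟩
    simp

theorem isLefschetzDecomposition_unique {m : ℕ} (hm : m ≤ n + 1) {b : Form n M}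
    {c c' : ℕ → Form n M} (h : S.IsLefschetzDecomposition m b c)
    (h' : S.IsLefschetzDecomposition m b c') : c' = c :=
  S.lefschetz.decomposition_unique hm (S.isLefschetzDecomposition_iff.1 h)
    (S.isLefschetzDecomposition_iff.1 h')

/-- The regrouping behind the identity: the D's are the three terms in dα, the T's the three terms
in dω ∧ ·. The hypotheses match the coefficients of the d* term and of the [d, L] L^(j-2) term. -/
theorem add_comb {E : Type*} [AddCommGroup E] [Module ℂ E] {j j₁ κ c m p q c' : ℂ}
    {D₁ D₂ D₃ T₁ T₂ T₃ : E} (hp : p * c' = -(c * m)) (hq : q = -(κ * j₁)) :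
    D₁ + j • T₁ - κ • (D₂ + j₁ • T₂) - c • (D₃ + m • T₃) =
      p • c' • T₃ + j • T₁ + q • T₂ + (D₁ - κ • D₂ - c • D₃) := by
  rw [smul_smul, hp, hq]
  module

theorem comm_Lam_d_sub_star_apply {k : ℕ} {α : Form n M} (hα : S.IsPrimitive k α)
    {a : ℕ → Form n M} (h : S.IsLefschetzDecomposition (k + 1) (d α) a) (j : ℕ) (x : M) :
    comm S.Lam d (S.L^[j] α) x - S.star (S.IInv (d (S.I (S.star (S.L^[j] α))))) x =
      (1 / ((j : ℂ) + 1)) • S.IInv (comm S.dStar S.Lam (S.I (S.L^[j + 1] α))) x +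
        (j : ℂ) • S.Lam (comm d S.L (S.L^[j - 1] α)) x +
        ((j : ℂ) * ((j : ℂ) - 1) * ((k : ℂ) - n + j - 1)) • comm d S.L (S.L^[j - 2] α) x +
        ∑ r ∈ Finset.Icc 2 ((k + 1) / 2), coeff n k j r • S.L^[j + r - 1] (a r) x := by
  have hs := fun i => S.isSmooth_L_iterate hα.1 i
  have e1 : S.Lam (d (S.L^[j] α)) x = (S.herm x).Lam (((S.herm x).L ^ j) (d α x)) +
      (j : ℂ) • (S.herm x).Lam (S.torsion x (((S.herm x).L ^ (j - 1)) (α x))) := by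
    rw [Lam_apply, S.d_L_iterate_apply hα.1, map_add, map_smul]
  have e2 : d (S.Lam (S.L^[j] α)) x = ((j : ℂ) * ((n : ℂ) - k - j + 1)) •
      (((S.herm x).L ^ (j - 1)) (d α x) +
        ((j - 1 : ℕ) : ℂ) • S.torsion x (((S.herm x).L ^ (j - 2)) (α x))) := by
    rw [S.Lam_L_iterate hα, d_smul, Pi.smul_apply, S.d_L_iterate_apply hα.1]
    rfl
  have e3 : S.star (S.IInv (d (S.I (S.star (S.L^[j] α))))) x = weilCoeff n k j •
      ((S.herm x).star ((S.herm x).IInv (((S.herm x).L ^ (n - k - j)) (d α x))) +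
        ((n - k - j : ℕ) : ℂ) • (S.herm x).IInv ((S.herm x).star (S.torsion x
          (((S.herm x).L ^ (n - k - j - 1)) (α x))))) := by
    rw [S.I_star_L_iterate hα, d_smul, star_apply, IInv_apply, Pi.smul_apply,
      S.d_L_iterate_apply hα.1]
    simp only [map_smul, map_add, HermitianSpace.star_IInv]
  -- This form is a multiple of a power of L on α, hence smooth; smoothness of ⋆ on general forms is
  -- not needed.
  have hstar : S.star (S.I (S.L^[j + 1] α)) =
      weilCoeff n k (j + 1) • S.L^[n - k - (j + 1)] α := by
    rw [star_I, S.I_star_L_iterate hα]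
  have e4 : S.IInv (comm S.dStar S.Lam (S.I (S.L^[j + 1] α))) x = (-weilCoeff n k (j + 1)) •
      (S.herm x).IInv ((S.herm x).star (S.torsion x
        (((S.herm x).L ^ (n - k - j - 1)) (α x)))) := by
    rw [IInv_apply, S.comm_dStar_Lam_apply (by rw [hstar]; exact (hs _).smul _), hstar,
      Pi.smul_apply, L_iterate_apply, map_smul, map_smul, map_neg, map_smul, neg_smul]
    rfl
  have e5 : S.Lam (comm d S.L (S.L^[j - 1] α)) x =
      (S.herm x).Lam (S.torsion x (((S.herm x).L ^ (j - 1)) (α x))) := by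
    rw [Lam_apply, S.comm_d_L_apply (hs _), L_iterate_apply]
  have e6 : comm d S.L (S.L^[j - 2] α) x = S.torsion x (((S.herm x).L ^ (j - 2)) (α x)) := by
    rw [S.comm_d_L_apply (hs _), L_iterate_apply]
  have e7 : ∑ r ∈ Finset.Icc 2 ((k + 1) / 2), coeff n k j r • S.L^[j + r - 1] (a r) x = _ :=
    (Finset.sum_congr rfl fun r _ => by rw [L_iterate_apply]).trans
      ((S.herm x).sum_components (j := j) (S.isDecomposition_apply h x)).symm
  -- At j = 0 the truncated difference is wrong, but the factor j hides it.
  have hj : (j : ℂ) * ((j - 1 : ℕ) : ℂ) = (j : ℂ) * ((j : ℂ) - 1) := by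
    rcases j with _ | j <;> simp
  have hc : (1 / ((j : ℂ) + 1)) * -weilCoeff n k (j + 1) =
      -(weilCoeff n k j * ((n - k - j : ℕ) : ℂ)) := by
    have : (j : ℂ) + 1 ≠ 0 := by exact_mod_cast j.succ_ne_zero
    rw [weilCoeff_succ]
    field_simp
  have hk : (j : ℂ) * ((j : ℂ) - 1) * ((k : ℂ) - n + j - 1) =
      -((j : ℂ) * ((n : ℂ) - k - j + 1) * ((j - 1 : ℕ) : ℂ)) := by
    linear_combination ((n : ℂ) - k - j + 1) * hj
  refine ((congrArg₂ (· - ·) (congrArg₂ (· - ·) e1 e2) e3).trans (add_comb hc hk)).trans ?_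
  exact (congrArg₂ (· + ·) (congrArg₂ (· + ·) (congrArg₂ (· + ·)
    (congrArg ((1 / ((j : ℂ) + 1)) • ·) e4) (congrArg ((j : ℂ) • ·) e5))
    (congrArg (((j : ℂ) * ((j : ℂ) - 1) * ((k : ℂ) - n + j - 1)) • ·) e6)) e7).symm

end AlmostHermitianStructure

end SmoothForms

end AlmostHermitian
end

/-! ### The commutator identity on almost Hermitian manifolds -/

theorem theorem3p1 {n : ℕ} {M : Type*} [TopologicalSpace M]
    [ChartedSpace (AlmostHermitian.Model n) M]
    [IsManifold 𝓘(ℝ, AlmostHermitian.Model n) ∞ M]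
    (S : AlmostHermitian.AlmostHermitianStructure n M)
    (k : ℕ) (α : AlmostHermitian.Form n M) (hα : S.IsPrimitive k α) :
    ∃ a : ℕ → AlmostHermitian.Form n M,
      S.IsLefschetzDecomposition (k + 1) (AlmostHermitian.d α) a ∧
      (k ≤ n → ∀ a' : ℕ → AlmostHermitian.Form n M,
        S.IsLefschetzDecomposition (k + 1) (AlmostHermitian.d α) a' → a' = a) ∧
      ∀ j : ℕ,
        AlmostHermitian.comm S.Lam AlmostHermitian.d (S.L^[j] α) -
            S.star (S.IInv (AlmostHermitian.d (S.I (S.star (S.L^[j] α))))) =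
          (1 / ((j : ℂ) + 1)) •
              S.IInv (AlmostHermitian.comm S.dStar S.Lam (S.I (S.L^[j + 1] α))) +
            (j : ℂ) • S.Lam (AlmostHermitian.comm AlmostHermitian.d S.L (S.L^[j - 1] α)) +
            ((j : ℂ) * ((j : ℂ) - 1) * ((k : ℂ) - n + j - 1)) •
              AlmostHermitian.comm AlmostHermitian.d S.L (S.L^[j - 2] α) +
            ∑ r ∈ Finset.Icc 2 ((k + 1) / 2),
              AlmostHermitian.coeff n k j r • S.L^[j + r - 1] (a r) := by
  obtain ⟨a, ha⟩ := S.exists_isLefschetzDecomposition hα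
  refine ⟨a, ha, fun hk a' ha' => S.isLefschetzDecomposition_unique (by omega) ha ha',
    fun j => funext fun x => ?_⟩
  refine (S.comm_Lam_d_sub_star_apply hα ha j x).trans ?_
  refine congrArg₂ (· + ·) rfl ?_
  rw [Finset.sum_apply]
  rfl
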